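/- Let $\Omega_1\subset\mathbb{R}^2$ be a bounded domain whose boundary $\Gamma=\partial\Omega_1$ is a smooth curvilinear polygon: near every boundary point, $\Omega_1$ is, after a rigid motion, the region above the graph of a continuous function that is $C^\infty$ on each side of that point, up to the point. Suppose that $\Gamma$ has a vertex, that is, a point at which the two one-sided slopes of this function differ (so the interior angle is in $(0,2\pi)\setminus\{\pi\}$). Put $\Omega_0=\mathbb{R}^2\setminus\overline{\Omega_1}$, let $\sigma$ be arc length on $\Gamma$, and let $\gamma>0$. *Spaces.* Let $\|F\|_{H^1_\gamma(\Omega_j)}^2=\|\nabla F\|_{L^2(\Omega_j)}^2+\gamma^{-2}\|F\|^2_{L^2(\Omega_j)}$. Let $H^{1/2}_\gamma(\partial\Omega_j)$ be the space of traces on $\Gamma$ of functions in $H^1(\Omega_j)$, with norm $\|f\|=\inf\{\|F\|_{H^1_\gamma(\Omega_j)}:F|_{\Gamma}=f\}$, and let $H^{-1/2}_\gamma(\partial\Omega_j)$ be its dual, with the dual norm, functions acting by $\langle f,v\rangle=\int_\Gamma fv\,d\sigma$. Put $\mathbb{H}^{-1/2}_\gamma(\Gamma)=H^{-1/2}_\gamma(\partial\Omega_0)\times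 H^{-1/2}_\gamma(\partial\Omega_1)$ and $\mathbb{H}^{0}_\gamma(\Gamma)=L^2(\Gamma)\times L^2(\Gamma)$, and for $-\frac12<s<0$ let $\mathbb{H}^{s}_\gamma(\Gamma)$ be the (normalized, quadratic) interpolation space of exponent $\theta=-2s$ between $\mathbb{H}^{0}_\gamma(\Gamma)$ and $\mathbb{H}^{-1/2}_\gamma(\Gamma)$. *Operators.* Let $\mathcal{G}_\gamma(x)=\frac1{2\pi}K_0(|x|/\gamma)$ be the fundamental solution of $-\Delta+\gamma^{-2}$, where $K_0$ is the modified Bessel function of the second kind of order $0$. For $\phi=(\phi_0,\phi_1)\in\mathbb{H}^{-1/2}_\gamma(\Gamma)$ let $\Psi_\gamma(\phi)(x)=\int_{\Gamma}\mathcal{G}_\gamma(x-y)(\phi_0+\phi_1)(y)\,d\sigma(y)$ for $x\notin\Gamma$ (in the sense of the duality pairing), and let $$(\Pi_\gamma\phi)_j=\phi_j-2\,\partial_{n_j}^{int}\Psi_\gamma(\phi)\quad(j=0,1),\qquad \Pi_0(\phi_0,\phi_1)=-(\phi_1,\phi_0),$$ where $\partial_{n_j}^{int}$ is the (weak) outward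 normal derivative on $\partial\Omega_j$, taken from within $\Omega_j$. *Claim.* There is $c>0$, depending only on $\Omega_1$, such that for all $0<\gamma<c$ and all $-\frac12\le s\le0$ there is a nonzero $\phi_\gamma\in\mathbb{H}^s_\gamma(\Gamma)$ with $\Pi_\gamma\phi_\gamma\in\mathbb{H}^s_\gamma(\Gamma)$ and $$\|(\Pi_\gamma-\Pi_0)\phi_\gamma\|_{\mathbb{H}^s_\gamma(\Gamma)}\ \ge\ c\,\|\phi_\gamma\|_{\mathbb{H}^s_\gamma(\Gamma)}.$$ In particular, for no $-\frac12\le s\le0$ and $0<a<1$ are there constants $c',C,C_a>0$ such that $$\|(\Pi_\gamma-\Pi_0)\phi\|_{\mathbb{H}^s_\gamma(\Gamma)}\le C(1+M^{1/2})\gamma^{1/2}\|\phi\|_{\mathbb{H}^s_\gamma(\Gamma)}$$ holds for all $0<\gamma<c'$, all $0<M<C_a^{-1}\gamma^{-a}$ and all $\phi\in\mathbb{H}^s_\gamma(\Gamma)$ with $\Pi_\gamma\phi$ defined. -/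

import Mathlib

open Set Filter Topology MeasureTheory
open scoped ENNReal ContDiff

noncomputable section

/-- The Euclidean plane. -/
abbrev Plane : Type := EuclideanSpace ℝ (Fin 2)

/-! ### Curvilinear polygons -/

/-- Near `p`, after a rigid motion `x ↦ e (x - p)` taking `p` to the origin, the set `Ω` is the
region above the graph of the function equal to `fneg` on the negative axis and to `fpos` on the
nonnegative axis; both are smooth up to the point `0`, where they vanish. -/
structure IsCornerChart (Ω : Set Plane) (p : Plane) (e : Plane ≃ₗᵢ[ℝ] Plane)
    (fneg fpos : ℝ → ℝ) (r : ℝ) : Prop where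
  radius_pos : 0 < r
  smooth_neg : ContDiff ℝ ∞ fneg
  smooth_pos : ContDiff ℝ ∞ fpos
  neg_zero : fneg 0 = 0
  pos_zero : fpos 0 = 0
  mem_iff : ∀ x ∈ Metric.ball p r,
    (x ∈ Ω ↔ (if e (x - p) 0 < 0 then fneg (e (x - p) 0) else fpos (e (x - p) 0)) < e (x - p) 1)

/-- A bounded planar domain whose boundary is a smooth curvilinear polygon: every boundary point is
either a regular point of a smooth side, or a corner at which two sides, smooth up to the corner,
meet at an interior angle in `(0, 2π)` different from `π`. The corners are isolated, hence finite
in number. -/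
structure IsCurvilinearPolygon (Ω : Set Plane) : Prop where
  isOpen : IsOpen Ω
  isConnected : IsConnected Ω
  isBounded : Bornology.IsBounded Ω
  chart : ∀ p ∈ frontier Ω, ∃ e fneg fpos r, IsCornerChart Ω p e fneg fpos r

/-- A vertex: a boundary point at which the two one-sided tangents are not opposite. -/
def IsVertex (Ω : Set Plane) (p : Plane) : Prop :=
  p ∈ frontier Ω ∧ ∃ e fneg fpos r, IsCornerChart Ω p e fneg fpos r ∧ deriv fneg 0 ≠ deriv fpos 0

/-- The exterior domain `Ω₀ = ℝ² \ closure Ω₁`. -/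
def exterior (Ω₁ : Set Plane) : Set Plane := (closure Ω₁)ᶜ

/-- Arc length measure `σ` on `Γ`. -/
def arcMeasure (Γ : Set Plane) : Measure Plane := (μH[1] : Measure Plane).restrict Γ

/-! ### The space `H¹(Ω)` and boundary traces -/

/-- The partial derivatives `(∂₁ u, ∂₂ u)` of a differentiable function. -/
def classicalGrad (u : Plane → ℂ) (x : Plane) : EuclideanSpace ℂ (Fin 2) :=
  WithLp.toLp 2 fun i => fderiv ℝ u x (EuclideanSpace.single i 1)

/-- `ξ ∈ C_c^∞(Ω)`. -/
structure IsTestFunction (Ω : Set Plane) (ξ : Plane → ℝ) : Prop where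
  smooth : ContDiff ℝ ∞ ξ
  compact : HasCompactSupport ξ
  support : tsupport ξ ⊆ Ω

/-- `F ∈ H¹(Ω)` with weak gradient `G ∈ L²(Ω)`. -/
structure IsH1 (Ω : Set Plane) (F : Plane → ℂ) (G : Plane → EuclideanSpace ℂ (Fin 2)) : Prop where
  memLp : MemLp F 2 (volume.restrict Ω)
  memLp_grad : MemLp G 2 (volume.restrict Ω)
  weak : ∀ ξ, IsTestFunction Ω ξ → ∀ i : Fin 2,
    ∫ x in Ω, F x * ((fderiv ℝ ξ x (EuclideanSpace.single i 1) : ℝ) : ℂ)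
      = - ∫ x in Ω, G x i * ((ξ x : ℝ) : ℂ)

/-- `F ∈ H¹(Ω)`, with weak gradient `G`, has the trace `f` on `Γ`: there are `u n ∈ C_c^∞(ℝ²)`
converging to `F` in `H¹(Ω)` whose restrictions to `Γ` converge to `f` in `L²(Γ)`. -/
structure HasTrace (Ω Γ : Set Plane) (F : Plane → ℂ) (G : Plane → EuclideanSpace ℂ (Fin 2))
    (f : Lp ℂ 2 (arcMeasure Γ)) : Prop where
  isH1 : IsH1 Ω F G
  approx : ∃ u : ℕ → Plane → ℂ, (∀ n, ContDiff ℝ ∞ (u n) ∧ HasCompactSupport (u n)) ∧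
    Tendsto (fun n => eLpNorm (u n - F) 2 (volume.restrict Ω)) atTop (𝓝 0) ∧
    Tendsto (fun n => eLpNorm (classicalGrad (u n) - G) 2 (volume.restrict Ω)) atTop (𝓝 0) ∧
    Tendsto (fun n => eLpNorm (fun x => u n x - f x) 2 (arcMeasure Γ)) atTop (𝓝 0)

/-- `‖F‖_{H¹_γ(Ω)} = (‖∇F‖²_{L²(Ω)} + γ⁻² ‖F‖²_{L²(Ω)})^{1/2}`, for `G = ∇F`. -/
def h1Norm (γ : ℝ) (Ω : Set Plane) (F : Plane → ℂ) (G : Plane → EuclideanSpace ℂ (Fin 2)) : ℝ≥0∞ :=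
  (eLpNorm G 2 (volume.restrict Ω) ^ 2
    + ENNReal.ofReal (γ⁻¹ ^ 2) * eLpNorm F 2 (volume.restrict Ω) ^ 2) ^ (1 / 2 : ℝ)

theorem continuous_classicalGrad {u : Plane → ℂ} (hu : ContDiff ℝ ∞ u) :
    Continuous (classicalGrad u) := by
  have h : Continuous (fderiv ℝ u) := hu.continuous_fderiv (by simp)
  unfold classicalGrad
  refine (PiLp.continuous_toLp 2 _).comp ?_
  exact continuous_pi fun i => h.clm_apply continuous_const

theorem IsTestFunction.integrable_mul {Ω : Set Plane} {ξ : Plane → ℝ} {F : Plane → ℂ}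
    {η : Plane → ℝ} (hξ : IsTestFunction Ω ξ) (hF : MemLp F 2 (volume.restrict Ω))
    (hc : Continuous η) (hη : tsupport η ⊆ tsupport ξ) :
    Integrable (fun x => F x * ((η x : ℝ) : ℂ)) (volume.restrict Ω) := by
  have h1 : HasCompactSupport η := hξ.compact.of_isClosed_subset (isClosed_tsupport η) hη
  have hcs : HasCompactSupport fun x => ((η x : ℝ) : ℂ) :=
    h1.comp_left (g := fun t : ℝ => (t : ℂ)) (by simp)
  have h2 : MemLp (fun x => ((η x : ℝ) : ℂ)) 2 (volume.restrict Ω) :=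
    ((Complex.continuous_ofReal.comp hc).memLp_of_hasCompactSupport hcs).restrict _
  exact hF.integrable_mul h2

theorem IsTestFunction.integrable_deriv {Ω : Set Plane} {ξ : Plane → ℝ} {F : Plane → ℂ}
    (hξ : IsTestFunction Ω ξ) (hF : MemLp F 2 (volume.restrict Ω)) (i : Fin 2) :
    Integrable (fun x => F x * ((fderiv ℝ ξ x (EuclideanSpace.single i 1) : ℝ) : ℂ))
      (volume.restrict Ω) := by
  refine hξ.integrable_mul hF
    ((hξ.smooth.continuous_fderiv (by simp)).clm_apply continuous_const) ?_
  refine (closure_mono ?_).trans (tsupport_fderiv_subset ℝ (f := ξ))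
  intro x hx h
  exact hx (by simp [h])

theorem memLp_coord {μ : Measure Plane} {G : Plane → EuclideanSpace ℂ (Fin 2)} (hG : MemLp G 2 μ)
    (i : Fin 2) : MemLp (fun x => G x i) 2 μ :=
  (EuclideanSpace.proj (𝕜 := ℂ) i).comp_memLp' hG

theorem tendsto_eLpNorm_add {E : Type*} [NormedAddCommGroup E] {μ : Measure Plane}
    {f g : ℕ → Plane → E} (hfm : ∀ n, AEStronglyMeasurable (f n) μ)
    (hgm : ∀ n, AEStronglyMeasurable (g n) μ)
    (hf : Tendsto (fun n => eLpNorm (f n) 2 μ) atTop (𝓝 0))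
    (hg : Tendsto (fun n => eLpNorm (g n) 2 μ) atTop (𝓝 0)) :
    Tendsto (fun n => eLpNorm (f n + g n) 2 μ) atTop (𝓝 0) :=
  tendsto_of_tendsto_of_tendsto_of_le_of_le tendsto_const_nhds (by simpa using hf.add hg)
    (fun _ => zero_le) (fun n => eLpNorm_add_le (hfm n) (hgm n) (by norm_num))

theorem tendsto_eLpNorm_smul {E : Type*} [NormedAddCommGroup E] [NormedSpace ℂ E]
    {μ : Measure Plane} {f : ℕ → Plane → E} (a : ℂ)
    (hf : Tendsto (fun n => eLpNorm (f n) 2 μ) atTop (𝓝 0)) :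
    Tendsto (fun n => eLpNorm (a • f n) 2 μ) atTop (𝓝 0) := by
  simp only [eLpNorm_const_smul]
  simpa using ENNReal.Tendsto.const_mul (a := ‖a‖ₑ) hf (Or.inr (by simp))

theorem classicalGrad_add {u v : Plane → ℂ} (hu : ContDiff ℝ ∞ u) (hv : ContDiff ℝ ∞ v) :
    classicalGrad (u + v) = classicalGrad u + classicalGrad v := by
  funext x
  ext i
  simp [classicalGrad, fderiv_add (hu.differentiable (by simp) x) (hv.differentiable (by simp) x)]

theorem classicalGrad_smul {u : Plane → ℂ} (a : ℂ) (hu : ContDiff ℝ ∞ u) :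
    classicalGrad (a • u) = a • classicalGrad u := by
  funext x
  ext i
  simp [classicalGrad, fderiv_const_smul (hu.differentiable (by simp) x) a]

theorem HasTrace.zero (Ω Γ : Set Plane) : HasTrace Ω Γ 0 0 0 where
  isH1 := ⟨by simp, by simp, by simp⟩
  approx := by
    refine ⟨fun _ => 0, fun _ => ⟨contDiff_const, HasCompactSupport.zero⟩, by simp, ?_, ?_⟩
    · have : classicalGrad 0 = 0 := by funext x; ext i; simp [classicalGrad]
      simp [this]
    · refine tendsto_const_nhds.congr fun n => ?_
      rw [← eLpNorm_zero (ε := ℂ) (α := Plane) (p := 2) (μ := arcMeasure Γ)]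
      refine eLpNorm_congr_ae ?_
      filter_upwards [Lp.coeFn_zero ℂ 2 (arcMeasure Γ)] with x hx
      rw [hx]
      simp

theorem HasTrace.add {Ω Γ : Set Plane} {F F' : Plane → ℂ}
    {G G' : Plane → EuclideanSpace ℂ (Fin 2)} {f f' : Lp ℂ 2 (arcMeasure Γ)}
    (h : HasTrace Ω Γ F G f) (h' : HasTrace Ω Γ F' G' f') :
    HasTrace Ω Γ (F + F') (G + G') (f + f') where
  isH1 := by
    refine ⟨h.isH1.memLp.add h'.isH1.memLp, h.isH1.memLp_grad.add h'.isH1.memLp_grad,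
      fun ξ hξ i => ?_⟩
    have e1 := h.isH1.weak ξ hξ i
    have e2 := h'.isH1.weak ξ hξ i
    simp only [Pi.add_apply, PiLp.add_apply, add_mul]
    rw [integral_add (hξ.integrable_deriv h.isH1.memLp i) (hξ.integrable_deriv h'.isH1.memLp i),
      integral_add (hξ.integrable_mul (memLp_coord h.isH1.memLp_grad i) hξ.smooth.continuous
        subset_rfl) (hξ.integrable_mul (memLp_coord h'.isH1.memLp_grad i) hξ.smooth.continuous
        subset_rfl), e1, e2]
    ring
  approx := by
    obtain ⟨u, hu, h1, h2, h3⟩ := h.approx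
    obtain ⟨v, hv, k1, k2, k3⟩ := h'.approx
    refine ⟨fun n => u n + v n, fun n => ⟨(hu n).1.add (hv n).1, (hu n).2.add (hv n).2⟩, ?_, ?_, ?_⟩
    · refine (tendsto_eLpNorm_add
        (fun n => ((hu n).1.continuous.aestronglyMeasurable.sub h.isH1.memLp.1))
        (fun n => ((hv n).1.continuous.aestronglyMeasurable.sub h'.isH1.memLp.1)) h1 k1).congr
        fun n => ?_
      rw [add_sub_add_comm]
    · refine (tendsto_eLpNorm_add
        (fun n => ((continuous_classicalGrad (hu n).1).aestronglyMeasurable.sub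
          h.isH1.memLp_grad.1))
        (fun n => ((continuous_classicalGrad (hv n).1).aestronglyMeasurable.sub
          h'.isH1.memLp_grad.1)) h2 k2).congr fun n => ?_
      rw [classicalGrad_add (hu n).1 (hv n).1, add_sub_add_comm]
    · refine (tendsto_eLpNorm_add
        (fun n => ((hu n).1.continuous.aestronglyMeasurable.sub (Lp.aestronglyMeasurable f)))
        (fun n => ((hv n).1.continuous.aestronglyMeasurable.sub
          (Lp.aestronglyMeasurable f'))) h3 k3).congr fun n => eLpNorm_congr_ae ?_
      filter_upwards [Lp.coeFn_add f f'] with x hx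
      rw [hx]
      exact (add_sub_add_comm _ _ _ _).symm

theorem HasTrace.smul {Ω Γ : Set Plane} {F : Plane → ℂ} {G : Plane → EuclideanSpace ℂ (Fin 2)}
    {f : Lp ℂ 2 (arcMeasure Γ)} (a : ℂ) (h : HasTrace Ω Γ F G f) :
    HasTrace Ω Γ (a • F) (a • G) (a • f) where
  isH1 := by
    refine ⟨h.isH1.memLp.const_smul a, h.isH1.memLp_grad.const_smul a, fun ξ hξ i => ?_⟩
    simp only [Pi.smul_apply, PiLp.smul_apply, smul_eq_mul, mul_assoc]
    rw [integral_const_mul, integral_const_mul, h.isH1.weak ξ hξ i]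
    ring
  approx := by
    obtain ⟨u, hu, h1, h2, h3⟩ := h.approx
    refine ⟨fun n => a • u n, fun n => ⟨contDiff_const.smul (hu n).1, ?_⟩, ?_, ?_, ?_⟩
    · exact (hu n).2.comp_left (g := fun z : ℂ => a • z) (by simp)
    · simpa only [smul_sub] using tendsto_eLpNorm_smul a h1
    · refine (tendsto_eLpNorm_smul a h2).congr fun n => ?_
      rw [classicalGrad_smul a (hu n).1, smul_sub]
    · refine (tendsto_eLpNorm_smul a h3).congr fun n => eLpNorm_congr_ae ?_
      filter_upwards [Lp.coeFn_smul a f] with x hx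
      rw [hx]
      simp [mul_sub]

/-- The space of traces on `Γ` of functions in `H¹(Ω)`. -/
def traceSpace (Ω Γ : Set Plane) : Submodule ℂ (Lp ℂ 2 (arcMeasure Γ)) where
  carrier := {f | ∃ F G, HasTrace Ω Γ F G f}
  zero_mem' := ⟨0, 0, HasTrace.zero Ω Γ⟩
  add_mem' := by
    rintro f f' ⟨F, G, h⟩ ⟨F', G', h'⟩
    exact ⟨_, _, h.add h'⟩
  smul_mem' := by
    rintro a f ⟨F, G, h⟩
    exact ⟨_, _, h.smul a⟩

/-! ### The spaces on `Γ = ∂Ω₀ = ∂Ω₁` -/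

/-- The vector space `H^{1/2}(Γ)`: functions on `Γ = ∂Ω₁` that are traces from `Ω₀` and from `Ω₁`.
(For a curvilinear polygon, the traces from the two sides form the same space, so that
this is the underlying vector space both of `H^{1/2}_γ(∂Ω₀)` and of `H^{1/2}_γ(∂Ω₁)`.) -/
abbrev HHalf (Ω₁ : Set Plane) : Submodule ℂ (Lp ℂ 2 (arcMeasure (frontier Ω₁))) :=
  traceSpace (exterior Ω₁) (frontier Ω₁) ⊓ traceSpace Ω₁ (frontier Ω₁)

/-- The two sides of `Γ`: `side Ω₁ 0 = Ω₀` and `side Ω₁ 1 = Ω₁`. -/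
def side (Ω₁ : Set Plane) (j : Fin 2) : Set Plane := if j = 0 then exterior Ω₁ else Ω₁

/-- `‖v‖_{H^{1/2}_γ(∂Ω_j)}`, the infimum of `‖F‖_{H¹_γ(Ω_j)}` over all `F` with trace `v`. -/
def hHalfNorm (γ : ℝ) (Ω₁ : Set Plane) (j : Fin 2) (v : Lp ℂ 2 (arcMeasure (frontier Ω₁))) : ℝ≥0∞ :=
  ⨅ (F) (G) (_ : HasTrace (side Ω₁ j) (frontier Ω₁) F G v), h1Norm γ (side Ω₁ j) F G

/-- Linear functionals on `H^{1/2}(Γ)`; a function `f` on `Γ` acts by the bilinear pairing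
`v ↦ ∫_Γ f v dσ`. -/
abbrev Functional (Ω₁ : Set Plane) : Type := HHalf Ω₁ →ₗ[ℂ] ℂ

/-- The norm of `H^{-1/2}_γ(∂Ω_j)`, the dual of `H^{1/2}_γ(∂Ω_j)`; it is finite exactly on
that space. -/
def dualNorm (γ : ℝ) (Ω₁ : Set Plane) (j : Fin 2) (φ : Functional Ω₁) : ℝ≥0∞ :=
  ⨆ (v : HHalf Ω₁) (_ : hHalfNorm γ Ω₁ j v ≤ 1), ‖φ v‖ₑ

/-- The norm of `L²(Γ)`, infinite for functionals that are not given by an `L²` function. -/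
def l2Norm (Ω₁ : Set Plane) (φ : Functional Ω₁) : ℝ≥0∞ :=
  ⨅ (f : Lp ℂ 2 (arcMeasure (frontier Ω₁)))
    (_ : ∀ v : HHalf Ω₁, φ v = ∫ x, f x * (v : Lp ℂ 2 (arcMeasure (frontier Ω₁))) x
      ∂(arcMeasure (frontier Ω₁))), ‖f‖ₑ

/-- Pairs `φ = (φ₀, φ₁)`, the component `φ_j` being attached to `∂Ω_j`. -/
abbrev NeumannPair (Ω₁ : Set Plane) : Type := Fin 2 → Functional Ω₁

/-- The norm of `H⁰(Γ) = L²(∂Ω₀) × L²(∂Ω₁)`. -/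
def pairL2Norm (Ω₁ : Set Plane) (φ : NeumannPair Ω₁) : ℝ≥0∞ :=
  (∑ j, l2Norm Ω₁ (φ j) ^ 2) ^ (1 / 2 : ℝ)

/-- The norm of `H^{-1/2}_γ(Γ) = H^{-1/2}_γ(∂Ω₀) × H^{-1/2}_γ(∂Ω₁)`. -/
def pairDualNorm (γ : ℝ) (Ω₁ : Set Plane) (φ : NeumannPair Ω₁) : ℝ≥0∞ :=
  (∑ j, dualNorm γ Ω₁ j (φ j) ^ 2) ^ (1 / 2 : ℝ)

/-- The square of the (quadratic) `K`-functional of the couple `(H⁰(Γ), H^{-1/2}_γ(Γ))`. -/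
def kFunctionalSq (γ : ℝ) (Ω₁ : Set Plane) (t : ℝ) (φ : NeumannPair Ω₁) : ℝ≥0∞ :=
  ⨅ χ : NeumannPair Ω₁,
    pairL2Norm Ω₁ χ ^ 2 + ENNReal.ofReal (t ^ 2) * pairDualNorm γ Ω₁ (φ - χ) ^ 2

/-- The norm of the interpolation space `(H⁰(Γ), H^{-1/2}_γ(Γ))_{θ,2}`, for `0 < θ < 1`, with the
normalization that makes it agree with complex interpolation. -/
def interpNorm (γ : ℝ) (Ω₁ : Set Plane) (θ : ℝ) (φ : NeumannPair Ω₁) : ℝ≥0∞ :=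
  (ENNReal.ofReal (2 * Real.sin (Real.pi * θ) / Real.pi)
    * ∫⁻ t in Ioi (0 : ℝ), ENNReal.ofReal (t ^ (-2 * θ - 1)) * kFunctionalSq γ Ω₁ t φ)
      ^ (1 / 2 : ℝ)

/-- The norm of `H^s_γ(Γ)` for `-1/2 ≤ s ≤ 0`; it is finite exactly on that space. -/
def hsNorm (γ : ℝ) (Ω₁ : Set Plane) (s : ℝ) (φ : NeumannPair Ω₁) : ℝ≥0∞ :=
  if s = 0 then pairL2Norm Ω₁ φ
  else if s = -(1 / 2) then pairDualNorm γ Ω₁ φ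
  else interpNorm γ Ω₁ (-2 * s) φ

/-- `φ ∈ H^s_γ(Γ)`. -/
def MemHs (γ : ℝ) (Ω₁ : Set Plane) (s : ℝ) (φ : NeumannPair Ω₁) : Prop :=
  hsNorm γ Ω₁ s φ < ⊤

/-! ### The exchange operators -/

/-- The modified Bessel function `K₀(r) = ∫₀^∞ exp(-r cosh t) dt`, for `r > 0`. -/
def besselK0 (r : ℝ) : ℝ := ∫ t in Ioi (0 : ℝ), Real.exp (-r * Real.cosh t)

/-- The fundamental solution `𝒢_γ(x) = (2π)⁻¹ K₀(|x| / γ)` of `-Δ + γ⁻²` on the plane. -/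
def greenFn (γ : ℝ) (x : Plane) : ℝ := (2 * Real.pi)⁻¹ * besselK0 (‖x‖ / γ)

open Classical in
/-- The pairing of a functional on `H^{1/2}(Γ)` with a function on `Γ` (whose class is uniquely
determined), and `0` if the function does not belong to `H^{1/2}(Γ)`. -/
def pairing {Ω₁ : Set Plane} (φ : Functional Ω₁) (g : Plane → ℂ) : ℂ :=
  if h : ∃ v : HHalf Ω₁, ((v : Lp ℂ 2 (arcMeasure (frontier Ω₁))) : Plane → ℂ)
      =ᵐ[arcMeasure (frontier Ω₁)] g
  then φ h.choose else 0

/-- The potential `Ψ_γ(φ)(x) = ∫_Γ 𝒢_γ(x - y) φ₀(y) dσ(y) + ∫_Γ 𝒢_γ(x - y) φ₁(y) dσ(y)`, for `x`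
off `Γ`, where `y ↦ 𝒢_γ(x - y)` is smooth on `Γ`. -/
def layerPotential (γ : ℝ) {Ω₁ : Set Plane} (φ : NeumannPair Ω₁) (x : Plane) : ℂ :=
  ∑ j, pairing (φ j) (fun y => (greenFn γ (x - y) : ℂ))

/-- `g ∈ L²(Ω)` is the weak divergence of `G` in `Ω`. -/
def IsWeakDiv (Ω : Set Plane) (G : Plane → EuclideanSpace ℂ (Fin 2)) (g : Plane → ℂ) : Prop :=
  MemLp g 2 (volume.restrict Ω) ∧ ∀ ξ, IsTestFunction Ω ξ →
    ∫ x in Ω, ∑ i, G x i * ((fderiv ℝ ξ x (EuclideanSpace.single i 1) : ℝ) : ℂ)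
      = - ∫ x in Ω, g x * ((ξ x : ℝ) : ℂ)

/-- `η` is the outward normal derivative on `∂Ω_j`, taken from within `Ω_j`, of the function
`u ∈ H¹(Ω_j)` with `Δu ∈ L²(Ω_j)`, that is
`⟨η, v⟩ = ∫_{Ω_j} (∇u · ∇V + (Δu) V)` for all `V ∈ H¹(Ω_j)` with trace `v ∈ H^{1/2}(Γ)`. -/
def IsNormalDeriv (Ω₁ : Set Plane) (j : Fin 2) (u : Plane → ℂ) (η : Functional Ω₁) : Prop :=
  ∃ G g, IsH1 (side Ω₁ j) u G ∧ IsWeakDiv (side Ω₁ j) G g ∧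
    ∀ (v : HHalf Ω₁) (V : Plane → ℂ) (H : Plane → EuclideanSpace ℂ (Fin 2)),
      HasTrace (side Ω₁ j) (frontier Ω₁) V H v →
        η v = ∫ x in side Ω₁ j, ((∑ i, G x i * H x i) + g x * V x)

/-- `ψ = Π_γ φ`, that is `ψ_j = φ_j - 2 ∂_{n_j}^{int} Ψ_γ(φ)` for `j = 0, 1`. -/
def IsExchange (γ : ℝ) (Ω₁ : Set Plane) (φ ψ : NeumannPair Ω₁) : Prop :=
  ∃ η : NeumannPair Ω₁, (∀ j, IsNormalDeriv Ω₁ j (layerPotential γ φ) (η j)) ∧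
    ∀ j, ψ j = φ j - (2 : ℂ) • η j

/-- The local exchange operator `Π₀ (φ₀, φ₁) = -(φ₁, φ₀)`. -/
def localExchange {Ω₁ : Set Plane} (φ : NeumannPair Ω₁) : NeumannPair Ω₁ := ![-φ 1, -φ 0]

end

/-!
The lower bound is produced by a single density near a vertex. Let `Ω` be the region above the graph
of `F` near the vertex, let `δ ≠ 0` be the jump of `F'` there, and write `κ(s) = (s, F(s))` in the
chart. For small `γ`, take `φ = (0, f)`, where `f` is a bump of scale `γ` centred at `κ(2γ)`, on one
side of the vertex, and test `χ = Π_γ φ - Π₀ φ` against a bump `V` of scale `γ` centred at `κ(-2γ)`,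
on the other side. Since `f` vanishes on the support of `V`, the value of `χ₁` at `V` is `-2` times
the pairing of `V` with the interior normal derivative of the potential of `f`.

*The value on the test function.* The kernel of this normal derivative is the double layer kernel,
whose numerator is the scalar product of the normal at `κ(s)` with the chord `κ(s) - κ(t₀)`. On a
smooth arc this product is quadratic in `s - t₀`, but across the vertex it is close to `δ t₀`, thus of
order `γ` and of constant sign (`IsLegPair.exists_normalChord_lower`). As the potential is scaled by
the same `γ`, the double layer kernel is then of order `γ⁻¹`, and the value at the normalized bump is
of order `γ`, with no decay relative to `f` as `γ → 0` (`IsCornerChart.exists_greenEnergy_lower`). To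
work with smooth kernels, the fundamental solution is written as the integral over time of heat
kernels (`greenK_eq_greenFn`); the boundary terms of the heat kernels all have the same sign, and
those at times comparable with `γ ^ 2` suffice for the bound (`tendsto_boundaryTerm`).

*The spaces.* The norm of `f` is `O(γ ^ (1 / 2))` in `L²(Γ)`, and `O(γ)` in the dual norm
(`IsCornerChart.dualNorm_le_of_bump`). The test function has norm at most `1` in `H¹_γ` and
`O(γ ^ (1 / 2))` in `L²(Γ)`. Hence both endpoint norms of `χ` dominate those of `φ`. The same test
function bounds the `K`-functional of `χ` from below at every scale (`le_kFunctionalSq`), and the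
comparison therefore holds pointwise under the interpolation integral, for all exponents with one
constant (`le_hsNorm`).

*The operator.* The normal derivatives have to exist in the weak sense, with square integrable values.
For a pole on a smooth side of the boundary, the double layer kernel is bounded, by the second order
tangency of chords on the same side and by the distance elsewhere. Thus the energy form of the
potential is bounded, on test functions, by the `L²` norm of their restrictions to `Γ`
(`IsCurvilinearPolygon.exists_greenEnergy_bound`), and the theorems of Hahn–Banach and Riesz represent
it by a function in `L²(Γ)` (`IsCurvilinearPolygon.exists_normal_density`). The exterior normal
derivative follows from Green's identity in the whole plane (`integral_greenEnergy_univ`), which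
contributes the jump `f`. By density, these formulas extend to all traces (`isExchange_of_density`).

The negative statement follows on fixing `M = 1` and letting `γ → 0`.
-/

open scoped NNReal

noncomputable section

/-! ### The divergence theorem in a chart -/

/-- The function equal to `fneg` on the negative axis and to `fpos` on the nonnegative axis. -/
def legFun (fneg fpos : ℝ → ℝ) (s : ℝ) : ℝ := if s < 0 then fneg s else fpos s

/-- The derivative of `legFun fneg fpos` away from `0`. -/
def legDeriv (fneg fpos : ℝ → ℝ) (s : ℝ) : ℝ := if s < 0 then deriv fneg s else deriv fpos s

/-- The standing hypotheses on the two sides of a corner. -/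
structure IsLegPair (fneg fpos : ℝ → ℝ) : Prop where
  smooth_neg : ContDiff ℝ ∞ fneg
  smooth_pos : ContDiff ℝ ∞ fpos
  neg_zero : fneg 0 = 0
  pos_zero : fpos 0 = 0

namespace IsLegPair

variable {fneg fpos : ℝ → ℝ}

theorem continuous_legFun (h : IsLegPair fneg fpos) : Continuous (legFun fneg fpos) := by
  unfold legFun
  refine Continuous.if ?_ h.smooth_neg.continuous h.smooth_pos.continuous
  intro a ha
  have : a = 0 := by simpa [Set.Iio_def] using ha
  rw [this, h.neg_zero, h.pos_zero]

theorem measurable_legDeriv (h : IsLegPair fneg fpos) : Measurable (legDeriv fneg fpos) :=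
  Measurable.ite measurableSet_Iio (h.smooth_neg.continuous_deriv (by simp)).measurable
    (h.smooth_pos.continuous_deriv (by simp)).measurable

theorem hasDerivAt_legFun (h : IsLegPair fneg fpos) {s : ℝ} (hs : s ≠ 0) :
    HasDerivAt (legFun fneg fpos) (legDeriv fneg fpos s) s := by
  rcases lt_or_gt_of_ne hs with hs | hs
  · have h1 : HasDerivAt fneg (deriv fneg s) s :=
      (h.smooth_neg.differentiable (by simp) s).hasDerivAt
    simp only [legDeriv, hs, if_true]
    refine h1.congr_of_eventuallyEq ?_
    filter_upwards [Iio_mem_nhds hs] with x hx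
    simp only [legFun, mem_Iio.1 hx, if_true]
  · have h1 : HasDerivAt fpos (deriv fpos s) s :=
      (h.smooth_pos.differentiable (by simp) s).hasDerivAt
    simp only [legDeriv, not_lt.2 hs.le, if_false]
    refine h1.congr_of_eventuallyEq ?_
    filter_upwards [Ioi_mem_nhds hs] with x hx
    simp only [legFun, not_lt.2 (mem_Ioi.1 hx).le, if_false]

theorem exists_bound_legDeriv (h : IsLegPair fneg fpos) (R : ℝ) :
    ∃ C, 0 ≤ C ∧ ∀ s ∈ Icc (-R) R, |legDeriv fneg fpos s| ≤ C := by
  obtain ⟨C1, hC1⟩ := (isCompact_Icc (a := -R) (b := R)).exists_bound_of_continuousOn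
    (h.smooth_neg.continuous_deriv (by simp)).continuousOn
  obtain ⟨C2, hC2⟩ := (isCompact_Icc (a := -R) (b := R)).exists_bound_of_continuousOn
    (h.smooth_pos.continuous_deriv (by simp)).continuousOn
  refine ⟨max 0 (max C1 C2), le_max_left _ _, fun s hs => ?_⟩
  unfold legDeriv
  split_ifs
  · exact (hC1 s hs).trans ((le_max_left _ _).trans (le_max_right _ _))
  · exact (hC2 s hs).trans ((le_max_right _ _).trans (le_max_right _ _))

end IsLegPair

/-- The shear `(s, h) ↦ (s, F s + h)`, which straightens the graph of `F`. -/
def graphShear (F : ℝ → ℝ) (hF : Continuous F) : ℝ × ℝ ≃ₜ ℝ × ℝ where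
  toFun z := (z.1, F z.1 + z.2)
  invFun z := (z.1, z.2 - F z.1)
  left_inv z := by simp
  right_inv z := by simp
  continuous_toFun := by fun_prop
  continuous_invFun := by fun_prop

theorem measurePreserving_graphShear (F : ℝ → ℝ) (hF : Continuous F) :
    MeasurePreserving (graphShear F hF) := by
  refine (MeasurePreserving.id (volume : Measure ℝ)).skew_product (g := fun s h => F s + h) ?_ ?_
  · exact (hF.measurable.comp measurable_fst).add measurable_snd
  · exact Eventually.of_forall fun s => (measurePreserving_add_left volume (F s)).map_eq

theorem setIntegral_above_graph {F : ℝ → ℝ} (hF : Continuous F) (k : ℝ × ℝ → ℂ) :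
    ∫ z in {z : ℝ × ℝ | F z.1 < z.2}, k z =
      ∫ z in (univ : Set ℝ) ×ˢ Ioi (0 : ℝ), k (graphShear F hF z) := by
  rw [← (measurePreserving_graphShear F hF).setIntegral_preimage_emb
    (graphShear F hF).measurableEmbedding]
  congr 2
  ext z
  simp [graphShear]

theorem integral_slice_above_graph {F : ℝ → ℝ} (hF : Continuous F) {g : ℝ × ℝ → ℂ}
    (hg : ContDiff ℝ 1 g) (hc : HasCompactSupport g) (s : ℝ) :
    ∫ h in Ioi (0 : ℝ), fderiv ℝ g (graphShear F hF (s, h)) (0, 1) = - g (s, F s) := by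
  obtain ⟨R, hR⟩ := hc.isCompact.isBounded.subset_closedBall (0 : ℝ × ℝ)
  have hsl : HasCompactSupport fun h : ℝ => g (s, F s + h) := by
    refine HasCompactSupport.of_support_subset_isCompact
      (isCompact_Icc (a := -R - F s) (b := R - F s)) fun t ht => ?_
    have h1 := hR (subset_tsupport g ht)
    rw [mem_closedBall_zero_iff] at h1
    have h2 := abs_le.1 ((norm_snd_le (s, F s + t)).trans h1)
    constructor <;> linarith [h2.1, h2.2]
  have hd : ContDiff ℝ 1 fun h : ℝ => g (s, F s + h) :=
    hg.comp (contDiff_const.prodMk (contDiff_const.add contDiff_id))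
  have := hsl.integral_Ioi_deriv_eq hd 0
  simp only [add_zero] at this
  rw [← this]
  refine setIntegral_congr_fun measurableSet_Ioi fun h _ => ?_
  have h1 : HasDerivAt (fun h : ℝ => (s, F s + h)) ((0 : ℝ), (1 : ℝ)) h :=
    (hasDerivAt_const h s).prodMk ((hasDerivAt_id h).const_add (F s))
  have h2 := ((hg.differentiable (by simp)) (s, F s + h)).hasFDerivAt.comp_hasDerivAt h h1
  exact h2.deriv.symm

theorem integral_above_graph_vertical {F : ℝ → ℝ} (hF : Continuous F) {g : ℝ × ℝ → ℂ}
    (hg : ContDiff ℝ 1 g) (hc : HasCompactSupport g) :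
    ∫ z in {z : ℝ × ℝ | F z.1 < z.2}, fderiv ℝ g z (0, 1) = - ∫ s, g (s, F s) := by
  rw [setIntegral_above_graph hF]
  have hcont : Continuous fun z => fderiv ℝ g (graphShear F hF z) (0, 1) :=
    ((hg.continuous_fderiv (by simp)).comp (graphShear F hF).continuous).clm_apply
      continuous_const
  have hcs : HasCompactSupport fun z => fderiv ℝ g (graphShear F hF z) (0, 1) := by
    have := (hc.fderiv_apply ℝ (0, 1)).comp_homeomorph (graphShear F hF)
    exact this
  have hint := hcont.integrable_of_hasCompactSupport hcs (μ := (volume : Measure (ℝ × ℝ)))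
  rw [Measure.volume_eq_prod, setIntegral_prod _ hint.integrableOn, setIntegral_univ,
    ← integral_neg]
  congr 1
  funext s
  exact integral_slice_above_graph hF hg hc s

/-- The exceptional point `0` is where the two sides of a corner meet: a continuous function may have
a jump in its derivative there. -/
theorem integral_eq_zero_of_hasDerivAt_off_zero {k k' : ℝ → ℂ} (hk : Continuous k)
    (hc : HasCompactSupport k) (hd : ∀ s, s ≠ 0 → HasDerivAt k (k' s) s) (hi : Integrable k') :
    ∫ s, k' s = 0 := by
  have t1 : Tendsto k atTop (𝓝 0) :=
    (hc.is_zero_at_infty).mono_left atTop_le_cocompact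
  have t2 : Tendsto k atBot (𝓝 0) :=
    (hc.is_zero_at_infty).mono_left atBot_le_cocompact
  have e1 := integral_Ioi_of_hasDerivAt_of_tendsto hk.continuousAt.continuousWithinAt
    (fun x hx => hd x (ne_of_gt hx)) hi.integrableOn t1 (a := 0)
  have e2 := integral_Iic_of_hasDerivAt_of_tendsto hk.continuousAt.continuousWithinAt
    (fun x hx => hd x (ne_of_lt hx)) hi.integrableOn t2 (a := 0)
  rw [← intervalIntegral.integral_Iic_add_Ioi hi.integrableOn hi.integrableOn (b := 0), e1, e2]
  simp

theorem integral_above_graph_horizontal {fneg fpos : ℝ → ℝ} (h : IsLegPair fneg fpos)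
    {g : ℝ × ℝ → ℂ} (hg : ContDiff ℝ 1 g) (hc : HasCompactSupport g) :
    ∫ z in {z : ℝ × ℝ | legFun fneg fpos z.1 < z.2}, fderiv ℝ g z (1, 0) =
      ∫ s, (legDeriv fneg fpos s : ℂ) * g (s, legFun fneg fpos s) := by
  set F := legFun fneg fpos with hFdef
  set F' := legDeriv fneg fpos with hF'def
  have hF : Continuous F := h.continuous_legFun
  obtain ⟨R, hR⟩ := hc.isCompact.isBounded.subset_closedBall (0 : ℝ × ℝ)
  obtain ⟨C, hC0, hC⟩ := h.exists_bound_legDeriv R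
  rw [setIntegral_above_graph hF]
  have hcont : ∀ w : ℝ × ℝ, Continuous fun z => fderiv ℝ g (graphShear F hF z) w := fun w =>
    ((hg.continuous_fderiv (by simp)).comp (graphShear F hF).continuous).clm_apply
      continuous_const
  have hcs : ∀ w : ℝ × ℝ, HasCompactSupport fun z => fderiv ℝ g (graphShear F hF z) w := fun w =>
    (hc.fderiv_apply ℝ w).comp_homeomorph (graphShear F hF)
  have hint := fun w =>
    (hcont w).integrable_of_hasCompactSupport (hcs w) (μ := (volume : Measure (ℝ × ℝ)))
  have hzero : ∀ z : ℝ × ℝ, z.1 ∉ Icc (-R) R → ∀ w, fderiv ℝ g (graphShear F hF z) w = 0 := by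
    intro z hz w
    have : graphShear F hF z ∉ tsupport g := by
      intro hmem
      have h1 := hR hmem
      rw [mem_closedBall_zero_iff] at h1
      have h2 : |z.1| ≤ R := (norm_fst_le (graphShear F hF z)).trans h1
      exact hz (abs_le.1 h2)
    rw [image_eq_zero_of_notMem_tsupport (f := fderiv ℝ g)
      (fun h' => this (tsupport_fderiv_subset ℝ h'))]
    simp
  have hint2 : Integrable (fun z : ℝ × ℝ => (F' z.1 : ℂ) * fderiv ℝ g (graphShear F hF z) (0, 1)) := by
    have hm : Measurable fun z : ℝ × ℝ => (F' z.1 : ℂ) :=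
      Complex.measurable_ofReal.comp (h.measurable_legDeriv.comp measurable_fst)
    refine ((hint (0, 1)).const_mul (C : ℂ)).mono
      (hm.aestronglyMeasurable.mul (hint (0, 1)).aestronglyMeasurable) ?_
    refine Eventually.of_forall fun z => ?_
    by_cases hz : z.1 ∈ Icc (-R) R
    · simp only [norm_mul, Complex.norm_real, Real.norm_eq_abs, abs_of_nonneg hC0]
      gcongr
      exact hC _ hz
    · simp [hzero z hz]
  have key : ∫ z in (univ : Set ℝ) ×ˢ Ioi (0 : ℝ), (fderiv ℝ g (graphShear F hF z) (1, 0)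
      + (F' z.1 : ℂ) * fderiv ℝ g (graphShear F hF z) (0, 1)) = 0 := by
    have hsum := (hint (1, 0)).add hint2
    rw [Measure.volume_eq_prod, ← setIntegral_prod_swap, setIntegral_prod]
    · have hae : ∀ᵐ t : ℝ, Integrable fun s : ℝ => fderiv ℝ g (graphShear F hF (s, t)) (1, 0)
          + (F' s : ℂ) * fderiv ℝ g (graphShear F hF (s, t)) (0, 1) := by
        have := hsum.swap.prod_right_ae
        exact this
      rw [← integral_zero ℝ ℂ (μ := volume.restrict (Ioi 0))]
      refine integral_congr_ae (ae_restrict_of_ae ?_)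
      filter_upwards [hae] with t ht
      rw [setIntegral_univ]
      refine integral_eq_zero_of_hasDerivAt_off_zero (k := fun s => g (s, F s + t)) ?_ ?_ ?_ ht
      · exact hg.continuous.comp (by fun_prop)
      · refine HasCompactSupport.of_support_subset_isCompact (isCompact_Icc (a := -R) (b := R)) ?_
        intro s hs
        have h1 := hR (subset_tsupport g hs)
        rw [mem_closedBall_zero_iff] at h1
        exact abs_le.1 ((norm_fst_le (s, F s + t)).trans h1)
      · intro s hs
        have h1 : HasDerivAt (fun s : ℝ => (s, F s + t)) ((1 : ℝ), F' s) s :=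
          (hasDerivAt_id s).prodMk ((h.hasDerivAt_legFun hs).add_const t)
        have h2 := ((hg.differentiable (by simp)) (s, F s + t)).hasFDerivAt.comp_hasDerivAt s h1
        have h3 : fderiv ℝ g (s, F s + t) ((1 : ℝ), F' s)
            = fderiv ℝ g (graphShear F hF (s, t)) (1, 0)
              + (F' s : ℂ) * fderiv ℝ g (graphShear F hF (s, t)) (0, 1) := by
          have : ((1 : ℝ), F' s) = (1, 0) + F' s • ((0 : ℝ), (1 : ℝ)) := by simp
          rw [this, map_add, map_smul]
          simp [graphShear]
        rw [h3] at h2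
        exact h2
    · exact hsum.swap.integrableOn
  have hB : ∫ z in (univ : Set ℝ) ×ˢ Ioi (0 : ℝ),
      (F' z.1 : ℂ) * fderiv ℝ g (graphShear F hF z) (0, 1) = - ∫ s, (F' s : ℂ) * g (s, F s) := by
    rw [Measure.volume_eq_prod, setIntegral_prod _ hint2.integrableOn, setIntegral_univ,
      ← integral_neg]
    congr 1
    funext s
    change ∫ y in Ioi (0 : ℝ), (F' s : ℂ) * fderiv ℝ g (graphShear F hF (s, y)) (0, 1) = _
    rw [integral_const_mul, integral_slice_above_graph hF hg hc s, mul_neg]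
  rw [integral_add (hint (1, 0)).integrableOn hint2.integrableOn, hB] at key
  exact eq_of_sub_eq_zero (by rw [sub_eq_add_neg]; exact key)

/-! ### Charts at a boundary point -/

/-- The rigid motion taking the origin to `p`, as a map from `ℝ × ℝ` to the plane. -/
def chartHomeo (p : Plane) (e : Plane ≃ₗᵢ[ℝ] Plane) : ℝ × ℝ ≃ₜ Plane :=
  ((Homeomorph.finTwoArrow.symm.trans (PiLp.homeomorph 2 (fun _ : Fin 2 => ℝ)).symm).trans
    e.symm.toHomeomorph).trans (Homeomorph.addLeft p)

theorem chartHomeo_apply (p : Plane) (e : Plane ≃ₗᵢ[ℝ] Plane) (z : ℝ × ℝ) :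
    chartHomeo p e z = p + e.symm (WithLp.toLp 2 ![z.1, z.2]) := by
  rfl

theorem chart_coord (p : Plane) (e : Plane ≃ₗᵢ[ℝ] Plane) (z : ℝ × ℝ) :
    e (chartHomeo p e z - p) = WithLp.toLp 2 ![z.1, z.2] := by
  simp [chartHomeo_apply]

theorem measurePreserving_chartHomeo (p : Plane) (e : Plane ≃ₗᵢ[ℝ] Plane) :
    MeasurePreserving (chartHomeo p e) := by
  have h1 : MeasurePreserving (Homeomorph.finTwoArrow (X := ℝ)).symm :=
    (volume_preserving_finTwoArrow ℝ).symm _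
  have h2 : MeasurePreserving (PiLp.homeomorph 2 (fun _ : Fin 2 => ℝ)).symm :=
    PiLp.volume_preserving_toLp (Fin 2)
  have h3 : MeasurePreserving e.symm := e.symm.measurePreserving
  have h4 : MeasurePreserving (fun x : Plane => p + x) := measurePreserving_add_left volume p
  exact h4.comp (h3.comp (h2.comp h1))

/-- The graph of `F` in the chart at `p`. -/
def graphPt (p : Plane) (e : Plane ≃ₗᵢ[ℝ] Plane) (F : ℝ → ℝ) (s : ℝ) : Plane :=
  chartHomeo p e (s, F s)

theorem continuous_graphPt (p : Plane) (e : Plane ≃ₗᵢ[ℝ] Plane) {F : ℝ → ℝ} (hF : Continuous F) :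
    Continuous (graphPt p e F) :=
  (chartHomeo p e).continuous.comp (by fun_prop)

theorem graphPt_coord (p : Plane) (e : Plane ≃ₗᵢ[ℝ] Plane) (F : ℝ → ℝ) (s : ℝ) :
    e (graphPt p e F s - p) = WithLp.toLp 2 ![s, F s] := chart_coord p e _

theorem graphPt_sub (p : Plane) (e : Plane ≃ₗᵢ[ℝ] Plane) (F : ℝ → ℝ) (s t : ℝ) :
    e (graphPt p e F s - graphPt p e F t) = WithLp.toLp 2 ![s - t, F s - F t] := by
  have : graphPt p e F s - graphPt p e F t = (graphPt p e F s - p) - (graphPt p e F t - p) := by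
    abel
  rw [this, map_sub, graphPt_coord, graphPt_coord]
  ext i
  fin_cases i <;> simp

theorem dist_graphPt_sq (p : Plane) (e : Plane ≃ₗᵢ[ℝ] Plane) (F : ℝ → ℝ) (s t : ℝ) :
    ‖graphPt p e F s - graphPt p e F t‖ ^ 2 = (s - t) ^ 2 + (F s - F t) ^ 2 := by
  rw [← e.norm_map, graphPt_sub, EuclideanSpace.norm_sq_eq]
  simp [Fin.sum_univ_two]

theorem abs_sub_le_norm_graphPt_sub (p : Plane) (e : Plane ≃ₗᵢ[ℝ] Plane) (F : ℝ → ℝ) (s t : ℝ) :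
    |s - t| ≤ ‖graphPt p e F s - graphPt p e F t‖ := by
  refine abs_le_of_sq_le_sq ?_ (norm_nonneg _)
  rw [dist_graphPt_sq]
  nlinarith [sq_nonneg (F s - F t)]

theorem abs_coord_le_norm (x : Plane) (i : Fin 2) : |x i| ≤ ‖x‖ := by
  simpa using PiLp.norm_apply_le x i

theorem norm_graphPt_sub_le (p : Plane) (e : Plane ≃ₗᵢ[ℝ] Plane) (F : ℝ → ℝ) {L s t : ℝ}
    (h : |F s - F t| ≤ L * |s - t|) :
    ‖graphPt p e F s - graphPt p e F t‖ ≤ (1 + L) * |s - t| := by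
  have h0 : 0 ≤ |s - t| + |F s - F t| := by positivity
  refine le_trans (b := |s - t| + |F s - F t|) ?_ (by linarith)
  refine abs_le_of_sq_le_sq' ?_ h0 |>.2
  rw [dist_graphPt_sq, ← sq_abs (s - t), ← sq_abs (F s - F t)]
  nlinarith [abs_nonneg (s - t), abs_nonneg (F s - F t)]

theorem IsCornerChart.isLegPair {Ω : Set Plane} {p : Plane} {e : Plane ≃ₗᵢ[ℝ] Plane}
    {fneg fpos : ℝ → ℝ} {r : ℝ} (hc : IsCornerChart Ω p e fneg fpos r) : IsLegPair fneg fpos :=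
  ⟨hc.smooth_neg, hc.smooth_pos, hc.neg_zero, hc.pos_zero⟩

theorem IsLegPair.legFun_zero {fneg fpos : ℝ → ℝ} (h : IsLegPair fneg fpos) :
    legFun fneg fpos 0 = 0 := by simp [legFun, h.pos_zero]

theorem IsLegPair.exists_lipschitz {fneg fpos : ℝ → ℝ} (h : IsLegPair fneg fpos) (R : ℝ) :
    ∃ L, 0 ≤ L ∧ ∀ s ∈ Icc (-R) R, ∀ t ∈ Icc (-R) R,
      |legFun fneg fpos s - legFun fneg fpos t| ≤ L * |s - t| := by
  obtain ⟨L1, hL1⟩ := (isCompact_Icc (a := -R) (b := R)).exists_bound_of_continuousOn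
    (h.smooth_neg.continuous_deriv (by simp)).continuousOn
  obtain ⟨L2, hL2⟩ := (isCompact_Icc (a := -R) (b := R)).exists_bound_of_continuousOn
    (h.smooth_pos.continuous_deriv (by simp)).continuousOn
  have k1 : ∀ s ∈ Icc (-R) R, ∀ t ∈ Icc (-R) R, |fneg s - fneg t| ≤ L1 * |s - t| := by
    intro s hs t ht
    exact (convex_Icc (-R) R).norm_image_sub_le_of_norm_deriv_le
      (fun x _ => (h.smooth_neg.differentiable (by simp) x)) hL1 ht hs
  have k2 : ∀ s ∈ Icc (-R) R, ∀ t ∈ Icc (-R) R, |fpos s - fpos t| ≤ L2 * |s - t| := by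
    intro s hs t ht
    exact (convex_Icc (-R) R).norm_image_sub_le_of_norm_deriv_le
      (fun x _ => (h.smooth_pos.differentiable (by simp) x)) hL2 ht hs
  refine ⟨max 0 (max L1 L2), le_max_left _ _, ?_⟩
  set L := max 0 (max L1 L2)
  have l1 : L1 ≤ L := (le_max_left _ _).trans (le_max_right _ _)
  have l2 : L2 ≤ L := (le_max_right _ _).trans (le_max_right _ _)
  -- for parameters on the two sides of the corner, the estimate is split at the corner
  have mix : ∀ s ∈ Icc (-R) R, ∀ t ∈ Icc (-R) R, s < 0 → 0 ≤ t →
      |fneg s - fpos t| ≤ L * |s - t| := by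
    intro s hs t ht hs0 ht0
    have h0 : (0 : ℝ) ∈ Icc (-R) R := ⟨by linarith [hs.1], by linarith [ht.2]⟩
    have a1 := k1 s hs 0 h0
    have a2 := k2 0 h0 t ht
    rw [h.neg_zero] at a1
    rw [h.pos_zero] at a2
    have e1 : |s - 0| = -s := by rw [sub_zero, abs_of_neg hs0]
    have e2 : |0 - t| = t := by rw [zero_sub, abs_neg, abs_of_nonneg ht0]
    have e3 : |s - t| = t - s := by rw [abs_of_nonpos (by linarith)]; ring
    rw [e1] at a1
    rw [e2] at a2
    rw [e3]
    have : |fneg s - fpos t| ≤ |fneg s - 0| + |0 - fpos t| := abs_sub_le _ _ _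
    nlinarith
  intro s hs t ht
  unfold legFun
  split_ifs with hs0 ht0 ht0
  · exact (k1 s hs t ht).trans (by gcongr)
  · exact mix s hs t ht hs0 (not_lt.1 ht0)
  · rw [abs_sub_comm, abs_sub_comm s t]
    exact mix t ht s hs ht0 (not_lt.1 hs0)
  · exact (k2 s hs t ht).trans (by gcongr)

/-- The point of the graph in the chart lies in the chart ball only for small parameters. -/
theorem IsLegPair.abs_lt_of_graphPt_mem {fneg fpos : ℝ → ℝ} (h : IsLegPair fneg fpos) {p : Plane}
    {e : Plane ≃ₗᵢ[ℝ] Plane} {s r : ℝ}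
    (hs : graphPt p e (legFun fneg fpos) s ∈ Metric.ball p r) : |s| < r := by
  have : graphPt p e (legFun fneg fpos) 0 = p := by
    simp [graphPt, chartHomeo_apply, h.legFun_zero]
  have h2 := abs_sub_le_norm_graphPt_sub p e (legFun fneg fpos) s 0
  rw [this, sub_zero] at h2
  rw [mem_ball_iff_norm] at hs
  exact h2.trans_lt hs

namespace IsCornerChart

variable {Ω : Set Plane} {p : Plane} {e : Plane ≃ₗᵢ[ℝ] Plane} {fneg fpos : ℝ → ℝ} {r : ℝ}

theorem mem_iff' (hc : IsCornerChart Ω p e fneg fpos r) {x : Plane} (hx : x ∈ Metric.ball p r) :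
    x ∈ Ω ↔ legFun fneg fpos (e (x - p) 0) < e (x - p) 1 := hc.mem_iff x hx

theorem mem_frontier_iff (hc : IsCornerChart Ω p e fneg fpos r) {x : Plane}
    (hx : x ∈ Metric.ball p r) :
    x ∈ frontier Ω ↔ e (x - p) 1 = legFun fneg fpos (e (x - p) 0) := by
  set F := legFun fneg fpos with hF
  have hFc : Continuous F := hc.isLegPair.continuous_legFun
  set A := chartHomeo p e
  have hAx : ∀ x, A.symm x = (e (x - p) 0, e (x - p) 1) := by
    intro x
    rw [A.symm_apply_eq, chartHomeo_apply]
    have : (WithLp.toLp 2 ![(e (x - p) 0, e (x - p) 1).1, (e (x - p) 0, e (x - p) 1).2] : Plane)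
        = e (x - p) := by
      ext i; fin_cases i <;> simp
    rw [this]
    simp
  have c0 : Continuous fun x : Plane => e (x - p) 0 := by fun_prop
  have c1 : Continuous fun x : Plane => e (x - p) 1 := by fun_prop
  have hball : Metric.ball p r ∈ 𝓝 x := Metric.isOpen_ball.mem_nhds hx
  constructor
  · intro hxf
    rcases lt_trichotomy (e (x - p) 1) (F (e (x - p) 0)) with hlt | heq | hgt
    · exfalso
      have hn : ∀ᶠ y in 𝓝 x, y ∉ Ω := by
        filter_upwards [hball, (isOpen_lt c1 (hFc.comp c0)).mem_nhds hlt] with y hy hy2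
        rw [hc.mem_iff' hy]
        exact not_lt.2 (le_of_lt hy2)
      obtain ⟨y, hy1, hy2⟩ := mem_closure_iff_nhds.1 hxf.1 _ hn
      exact hy1 hy2
    · exact heq
    · exfalso
      refine hxf.2 (mem_interior_iff_mem_nhds.2 ?_)
      filter_upwards [hball, (isOpen_lt (hFc.comp c0) c1).mem_nhds hgt] with y hy hy2
      exact (hc.mem_iff' hy).2 hy2
  · intro heq
    refine ⟨?_, fun hin => ?_⟩
    · -- the point is the limit of the points directly above it
      have ht : Tendsto (fun n : ℕ => A ((A.symm x).1, (A.symm x).2 + 1 / ((n : ℝ) + 1))) atTop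
          (𝓝 x) := by
        have : Tendsto (fun n : ℕ => ((A.symm x).1, (A.symm x).2 + 1 / ((n : ℝ) + 1))) atTop
            (𝓝 ((A.symm x).1, (A.symm x).2 + 0)) :=
          tendsto_const_nhds.prodMk_nhds
            (tendsto_const_nhds.add tendsto_one_div_add_atTop_nhds_zero_nat)
        have h2 := (A.continuous.tendsto _).comp this
        rw [add_zero, Prod.mk.eta, A.apply_symm_apply] at h2
        exact h2
      refine mem_closure_of_tendsto ht ?_
      filter_upwards [ht.eventually hball] with n hn
      rw [hc.mem_iff' hn, chart_coord]
      simp only [hAx]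
      simp only [Matrix.cons_val_zero, Matrix.cons_val_one]
      rw [heq]
      have : (0 : ℝ) < 1 / ((n : ℝ) + 1) := by positivity
      simp only [← hF]
      linarith
    · have := (hc.mem_iff' hx).1 (interior_subset hin)
      rw [heq] at this
      exact lt_irrefl _ this

theorem graphPt_mem_frontier (hc : IsCornerChart Ω p e fneg fpos r) {s : ℝ}
    (hs : graphPt p e (legFun fneg fpos) s ∈ Metric.ball p r) :
    graphPt p e (legFun fneg fpos) s ∈ frontier Ω := by
  rw [hc.mem_frontier_iff hs, graphPt_coord]
  simp

theorem eq_graphPt (hc : IsCornerChart Ω p e fneg fpos r) {x : Plane}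
    (hx : x ∈ Metric.ball p r) (hxf : x ∈ frontier Ω) :
    x = graphPt p e (legFun fneg fpos) (e (x - p) 0) := by
  have h := (hc.mem_frontier_iff hx).1 hxf
  have h2 : e (x - p) = e (graphPt p e (legFun fneg fpos) (e (x - p) 0) - p) := by
    rw [graphPt_coord, ← h]
    ext i; fin_cases i <;> rfl
  have := e.injective h2
  simpa using this

/-- The local form of the divergence theorem. The vector `(F', -1)` is the outward normal to the
graph, normalized so that the surface measure becomes Lebesgue measure on the axis. -/
theorem integral_fderiv (hc : IsCornerChart Ω p e fneg fpos r) (hΩ : IsOpen Ω) {u : Plane → ℂ}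
    (hu : ContDiff ℝ 1 u) (hcs : HasCompactSupport u) (hsup : tsupport u ⊆ Metric.ball p r)
    (w : Plane) :
    ∫ x in Ω, fderiv ℝ u x w = ∫ s, ((legDeriv fneg fpos s * e w 0 - e w 1 : ℝ) : ℂ)
      * u (graphPt p e (legFun fneg fpos) s) := by
  have hl := hc.isLegPair
  set F := legFun fneg fpos with hF
  have hFc : Continuous F := hl.continuous_legFun
  set A := chartHomeo p e with hA
  set g : ℝ × ℝ → ℂ := fun z => u (A z) with hg
  -- the chart is an affine map
  have hAd : ∀ z v : ℝ × ℝ, HasFDerivAt (fun z : ℝ × ℝ => A z)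
      ((e.symm.toContinuousLinearEquiv : Plane →L[ℝ] Plane).comp
        ((PiLp.continuousLinearEquiv 2 ℝ (fun _ : Fin 2 => ℝ)).symm.toContinuousLinearMap.comp
          ((ContinuousLinearEquiv.finTwoArrow ℝ ℝ).symm.toContinuousLinearMap))) z := by
    intro z v
    have := (((e.symm.toContinuousLinearEquiv : Plane →L[ℝ] Plane).comp
        ((PiLp.continuousLinearEquiv 2 ℝ (fun _ : Fin 2 => ℝ)).symm.toContinuousLinearMap.comp
          ((ContinuousLinearEquiv.finTwoArrow ℝ ℝ).symm.toContinuousLinearMap))).hasFDerivAt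
            (x := z)).const_add p
    exact this
  have hAs : ContDiff ℝ 1 (fun z : ℝ × ℝ => A z) := by
    have := (((e.symm.toContinuousLinearEquiv : Plane →L[ℝ] Plane).comp
        ((PiLp.continuousLinearEquiv 2 ℝ (fun _ : Fin 2 => ℝ)).symm.toContinuousLinearMap.comp
          ((ContinuousLinearEquiv.finTwoArrow ℝ ℝ).symm.toContinuousLinearMap))).contDiff
            (n := 1))
    exact contDiff_const.add this
  have hgs : ContDiff ℝ 1 g := hu.comp hAs
  have hgc : HasCompactSupport g := hcs.comp_homeomorph A
  have hgd : ∀ z v : ℝ × ℝ, fderiv ℝ g z v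
      = fderiv ℝ u (A z) (e.symm (WithLp.toLp 2 ![v.1, v.2])) := by
    intro z v
    have h1 := ((hu.differentiable (by simp)) (A z)).hasFDerivAt.comp z (hAd z v)
    rw [show g = u ∘ fun z => A z from rfl, h1.fderiv]
    rfl
  have hdecomp : ∀ z, fderiv ℝ u (A z) w
      = (e w 0 : ℂ) * fderiv ℝ g z (1, 0) + (e w 1 : ℂ) * fderiv ℝ g z (0, 1) := by
    intro z
    rw [hgd, hgd]
    have : w = (e w 0) • e.symm (WithLp.toLp 2 ![1, 0]) +
        (e w 1) • e.symm (WithLp.toLp 2 ![0, 1]) := by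
      apply e.injective
      rw [map_add, map_smul, map_smul]
      ext i; fin_cases i <;> simp
    conv_lhs => rw [this, map_add, map_smul, map_smul]
    simp
  have hzero : ∀ x, x ∉ Metric.ball p r → fderiv ℝ u x w = 0 := by
    intro x hx
    rw [image_eq_zero_of_notMem_tsupport (f := fderiv ℝ u)
      (fun h' => hx (hsup (tsupport_fderiv_subset ℝ h')))]
    simp
  set Ω' : Set Plane := {x | F (e (x - p) 0) < e (x - p) 1} with hΩ'
  have hΩ'o : IsOpen Ω' := isOpen_lt (hFc.comp (by fun_prop)) (by fun_prop)
  have e1 : ∫ x in Ω, fderiv ℝ u x w = ∫ x in Ω', fderiv ℝ u x w := by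
    rw [← integral_indicator hΩ.measurableSet, ← integral_indicator hΩ'o.measurableSet]
    congr 1
    funext x
    by_cases hx : x ∈ Metric.ball p r
    · have : x ∈ Ω ↔ x ∈ Ω' := hc.mem_iff' hx
      by_cases hxΩ : x ∈ Ω
      · rw [indicator_of_mem hxΩ, indicator_of_mem (this.1 hxΩ)]
      · rw [indicator_of_notMem hxΩ, indicator_of_notMem (fun h => hxΩ (this.2 h))]
    · simp [indicator, hzero x hx]
  have e2 : ∫ x in Ω', fderiv ℝ u x w
      = ∫ z in {z : ℝ × ℝ | F z.1 < z.2}, fderiv ℝ u (A z) w := by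
    rw [← (measurePreserving_chartHomeo p e).setIntegral_preimage_emb A.measurableEmbedding]
    congr 2
    ext z
    simp only [hΩ', mem_preimage, mem_ofPred_eq, chart_coord]
    rfl
  rw [e1, e2]
  simp only [hdecomp]
  have hint : ∀ v : ℝ × ℝ, Integrable (fun z => fderiv ℝ g z v) := fun v =>
    ((hgs.continuous_fderiv (by simp)).clm_apply continuous_const).integrable_of_hasCompactSupport
      (hgc.fderiv_apply ℝ v)
  rw [integral_add ((hint (1, 0)).const_mul _).integrableOn
    ((hint (0, 1)).const_mul _).integrableOn, integral_const_mul, integral_const_mul,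
    integral_above_graph_horizontal hl hgs hgc, integral_above_graph_vertical hFc hgs hgc,
    ← integral_neg, ← integral_const_mul, ← integral_const_mul]
  have hgraph : HasCompactSupport fun s => g (s, F s) := by
    obtain ⟨R, hR⟩ := hgc.isCompact.isBounded.subset_closedBall (0 : ℝ × ℝ)
    refine HasCompactSupport.of_support_subset_isCompact (isCompact_Icc (a := -R) (b := R)) ?_
    intro s hs
    have h1 := hR (subset_tsupport g hs)
    rw [mem_closedBall_zero_iff] at h1
    exact abs_le.1 ((norm_fst_le (s, F s)).trans h1)
  have hgi : Integrable fun s => g (s, F s) :=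
    (hgs.continuous.comp (by fun_prop)).integrable_of_hasCompactSupport hgraph
  have hgi' : Integrable fun s => (legDeriv fneg fpos s : ℂ) * g (s, F s) := by
    obtain ⟨R, hR⟩ := hgraph.isCompact.isBounded.subset_closedBall (0 : ℝ)
    obtain ⟨C, hC0, hC⟩ := hl.exists_bound_legDeriv R
    refine (hgi.const_mul (C : ℂ)).mono
      ((Complex.measurable_ofReal.comp hl.measurable_legDeriv).aestronglyMeasurable.mul
        hgi.aestronglyMeasurable) (Eventually.of_forall fun s => ?_)
    by_cases hs : g (s, F s) = 0
    · simp [hs]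
    · have h1 := hR (subset_tsupport (fun s => g (s, F s)) hs)
      rw [mem_closedBall_zero_iff] at h1
      simp only [norm_mul, Complex.norm_real, Real.norm_eq_abs, abs_of_nonneg hC0]
      gcongr
      exact hC _ (abs_le.1 h1)
  refine (integral_add (hgi'.const_mul _) (hgi.neg.const_mul _)).symm.trans ?_
  congr 1
  funext s
  simp only [hg, graphPt, Pi.neg_apply]
  push_cast
  ring

end IsCornerChart

/-! ### Arc length and the graph measure -/

/-- The image of Lebesgue measure under the graph map, inside the chart ball. -/
def chartMeasure (p : Plane) (e : Plane ≃ₗᵢ[ℝ] Plane) (F : ℝ → ℝ) (r : ℝ) : Measure Plane :=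
  (volume.restrict {s | graphPt p e F s ∈ Metric.ball p r}).map (graphPt p e F)

theorem hausdorffMeasure_graphPt_image_le (p : Plane) (e : Plane ≃ₗᵢ[ℝ] Plane) {F : ℝ → ℝ}
    {a b L : ℝ} (hL : 0 ≤ L) (h : ∀ s ∈ Icc a b, ∀ t ∈ Icc a b, |F s - F t| ≤ L * |s - t|) :
    μH[1] (graphPt p e F '' Icc a b) ≤ ENNReal.ofReal ((1 + L) * (b - a)) := by
  have hlip : LipschitzOnWith (Real.toNNReal (1 + L)) (graphPt p e F) (Icc a b) := by
    refine LipschitzOnWith.of_dist_le_mul fun s hs t ht => ?_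
    rw [Real.coe_toNNReal _ (by linarith), dist_eq_norm, Real.dist_eq]
    exact norm_graphPt_sub_le p e F (h s hs t ht)
  refine (hlip.hausdorffMeasure_image_le zero_le_one).trans ?_
  rw [hausdorffMeasure_real, Real.volume_Icc, ENNReal.rpow_one,
    ENNReal.ofReal_mul (by linarith)]
  rfl

namespace IsCornerChart

variable {Ω : Set Plane} {p : Plane} {e : Plane ≃ₗᵢ[ℝ] Plane} {fneg fpos : ℝ → ℝ} {r : ℝ}

/-- Projection to the axis of the chart is `1`-Lipschitz, hence does not increase length. -/
theorem chartMeasure_le (hc : IsCornerChart Ω p e fneg fpos r) :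
    chartMeasure p e (legFun fneg fpos) r ≤ arcMeasure (frontier Ω) := by
  have hcont := continuous_graphPt p e hc.isLegPair.continuous_legFun
  refine Measure.le_iff.2 fun A hA => ?_
  rw [chartMeasure, Measure.map_apply hcont.measurable hA,
    Measure.restrict_apply (hcont.measurable hA), arcMeasure, Measure.restrict_apply hA,
    ← hausdorffMeasure_real]
  have hlip : LipschitzWith 1 fun x : Plane => e (x - p) 0 := by
    refine LipschitzWith.of_dist_le_mul fun x y => ?_
    rw [NNReal.coe_one, one_mul, Real.dist_eq, dist_eq_norm, ← e.norm_map (x - y)]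
    have : e (x - p) 0 - e (y - p) 0 = e (x - y) 0 := by simp
    rw [this]
    exact abs_coord_le_norm _ _
  have hsub : graphPt p e (legFun fneg fpos) ⁻¹' A
      ∩ {s | graphPt p e (legFun fneg fpos) s ∈ Metric.ball p r}
      ⊆ (fun x : Plane => e (x - p) 0) '' (A ∩ frontier Ω) := by
    rintro s ⟨hs1, hs2⟩
    refine ⟨_, ⟨hs1, hc.graphPt_mem_frontier hs2⟩, ?_⟩
    simp only [graphPt_coord]
    rfl
  refine (measure_mono hsub).trans ?_
  simpa using hlip.hausdorffMeasure_image_le zero_le_one (A ∩ frontier Ω)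

theorem frontier_inter_subset (hc : IsCornerChart Ω p e fneg fpos r) {c : Plane} {ρ : ℝ}
    (hsub : Metric.ball c ρ ⊆ Metric.ball p r) :
    frontier Ω ∩ Metric.ball c ρ ⊆ graphPt p e (legFun fneg fpos) ''
      Icc (e (c - p) 0 - ρ) (e (c - p) 0 + ρ) := by
  rintro x ⟨hx1, hx2⟩
  refine ⟨e (x - p) 0, ?_, (hc.eq_graphPt (hsub hx2) hx1).symm⟩
  have h1 : |e (x - c) 0| ≤ ρ := by
    refine (abs_coord_le_norm _ _).trans ?_
    rw [e.norm_map]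
    exact (mem_ball_iff_norm.1 hx2).le
  have h2 : e (x - p) 0 = e (c - p) 0 + e (x - c) 0 := by simp
  rw [h2]
  constructor <;> linarith [(abs_le.1 h1).1, (abs_le.1 h1).2]

theorem hausdorffMeasure_frontier_inter_ball_lt_top (hc : IsCornerChart Ω p e fneg fpos r) :
    μH[1] (frontier Ω ∩ Metric.ball p r) < ⊤ := by
  obtain ⟨L, hL0, hL⟩ := hc.isLegPair.exists_lipschitz r
  have h1 := hc.frontier_inter_subset (c := p) (ρ := r) subset_rfl
  refine (measure_mono h1).trans_lt ?_
  refine (hausdorffMeasure_graphPt_image_le p e hL0 ?_).trans_lt ENNReal.ofReal_lt_top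
  simpa using hL

end IsCornerChart

namespace IsCurvilinearPolygon

variable {Ω : Set Plane}

theorem isCompact_frontier (h : IsCurvilinearPolygon Ω) : IsCompact (frontier Ω) :=
  Metric.isCompact_of_isClosed_isBounded isClosed_frontier
    (h.isBounded.closure.subset frontier_subset_closure)

theorem hausdorffMeasure_frontier_lt_top (h : IsCurvilinearPolygon Ω) :
    μH[1] (frontier Ω) < ⊤ := by
  refine h.isCompact_frontier.measure_lt_top_of_nhdsWithin fun p hp => ?_
  obtain ⟨e, fneg, fpos, r, hc⟩ := h.chart p hp
  exact ⟨frontier Ω ∩ Metric.ball p r,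
    inter_mem_nhdsWithin _ (Metric.ball_mem_nhds p hc.radius_pos),
    hc.hausdorffMeasure_frontier_inter_ball_lt_top⟩

theorem isFiniteMeasure_arcMeasure (h : IsCurvilinearPolygon Ω) :
    IsFiniteMeasure (arcMeasure (frontier Ω)) :=
  ⟨by simpa [arcMeasure] using h.hausdorffMeasure_frontier_lt_top⟩

theorem volume_frontier (h : IsCurvilinearPolygon Ω) :
    (volume : Measure Plane) (frontier Ω) = 0 := by
  have h1 : μH[2] (frontier Ω) = 0 :=
    (Measure.hausdorffMeasure_zero_or_top one_lt_two (frontier Ω)).resolve_right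
      h.hausdorffMeasure_frontier_lt_top.ne
  have h2 : (Measure.hausdorffMeasure (X := Plane)
      (Module.finrank ℝ Plane : ℝ)).IsAddHaarMeasure := inferInstance
  have h3 : (Module.finrank ℝ Plane : ℝ) = 2 := by simp
  rw [h3] at h2
  exact Measure.absolutelyContinuous_isAddHaarMeasure (volume : Measure Plane) μH[2] h1

end IsCurvilinearPolygon

theorem integrable_arcMeasure {Γ : Set Plane} [IsFiniteMeasure (arcMeasure Γ)] {u : Plane → ℂ}
    (hu : Continuous u) (hc : HasCompactSupport u) : Integrable u (arcMeasure Γ) := by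
  obtain ⟨C, hC⟩ := hu.bounded_above_of_compact_support hc
  exact Integrable.of_bound hu.aestronglyMeasurable C (Eventually.of_forall hC)

theorem memLp_arcMeasure {Γ : Set Plane} [IsFiniteMeasure (arcMeasure Γ)] {u : Plane → ℂ}
    (hu : Continuous u) (hc : HasCompactSupport u) : MemLp u 2 (arcMeasure Γ) := by
  obtain ⟨C, hC⟩ := hu.bounded_above_of_compact_support hc
  exact MemLp.of_bound hu.aestronglyMeasurable C (Eventually.of_forall hC)

namespace IsCornerChart

variable {Ω : Set Plane} {p : Plane} {e : Plane ≃ₗᵢ[ℝ] Plane} {fneg fpos : ℝ → ℝ} {r : ℝ}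

/-- An integral over the axis of a function vanishing off the chart ball. -/
theorem integral_chartMeasure (hc : IsCornerChart Ω p e fneg fpos r) {E : Type*}
    [NormedAddCommGroup E] [NormedSpace ℝ E] {g : Plane → E} (hg : Continuous g)
    (hsup : tsupport g ⊆ Metric.ball p r) :
    ∫ x, g x ∂(chartMeasure p e (legFun fneg fpos) r)
      = ∫ s, g (graphPt p e (legFun fneg fpos) s) := by
  have hcont := continuous_graphPt p e hc.isLegPair.continuous_legFun
  rw [chartMeasure, integral_map hcont.aemeasurable]
  · refine setIntegral_eq_integral_of_forall_compl_eq_zero fun s hs => ?_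
    exact image_eq_zero_of_notMem_tsupport fun h => hs (hsup h)
  · exact (hg.stronglyMeasurable_of_hasCompactSupport (HasCompactSupport.of_support_subset_isCompact
      (isCompact_closedBall p r) ((subset_tsupport g).trans
        (hsup.trans Metric.ball_subset_closedBall)))).aestronglyMeasurable

/-- Near a boundary point, the boundary integral in the divergence theorem is bounded by the integral
over the arc length, since the graph measure is at most the arc length. -/
theorem exists_boundary_bound (hc : IsCornerChart Ω p e fneg fpos r) (hΩ : IsOpen Ω)
    [IsFiniteMeasure (arcMeasure (frontier Ω))] :
    ∃ C, 0 ≤ C ∧ ∀ u : Plane → ℂ, ContDiff ℝ 1 u → HasCompactSupport u →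
      tsupport u ⊆ Metric.ball p r → ∀ w : Plane,
      ‖∫ x in Ω, fderiv ℝ u x w‖ ≤ C * ‖w‖ * ∫ x, ‖u x‖ ∂(arcMeasure (frontier Ω)) := by
  obtain ⟨C, hC0, hC⟩ := hc.isLegPair.exists_bound_legDeriv r
  refine ⟨C + 1, by linarith, fun u hu hcs hsup w => ?_⟩
  have hcont := continuous_graphPt p e hc.isLegPair.continuous_legFun
  have hsn : tsupport (fun x => ‖u x‖) ⊆ Metric.ball p r := by
    rw [show (fun x => ‖u x‖) = norm ∘ u from rfl]
    exact (tsupport_comp_subset norm_zero u).trans hsup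
  have hin : Integrable (fun x => ‖u x‖) (arcMeasure (frontier Ω)) :=
    (integrable_arcMeasure hu.continuous hcs).norm
  have hint : Integrable fun s => ‖u (graphPt p e (legFun fneg fpos) s)‖ := by
    refine (hu.continuous.norm.comp hcont).integrable_of_hasCompactSupport ?_
    refine HasCompactSupport.of_support_subset_isCompact (isCompact_Icc (a := -r) (b := r)) ?_
    intro s hs
    have h1 := hc.isLegPair.abs_lt_of_graphPt_mem (hsn (subset_tsupport _ hs))
    exact abs_le.1 h1.le
  rw [hc.integral_fderiv hΩ hu hcs hsup w]
  calc ‖∫ s, ((legDeriv fneg fpos s * e w 0 - e w 1 : ℝ) : ℂ)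
        * u (graphPt p e (legFun fneg fpos) s)‖
      ≤ ∫ s, (C + 1) * ‖w‖ * ‖u (graphPt p e (legFun fneg fpos) s)‖ := by
        refine norm_integral_le_of_norm_le (hint.const_mul _) (Eventually.of_forall fun s => ?_)
        by_cases hs : u (graphPt p e (legFun fneg fpos) s) = 0
        · simp [hs]
        · rw [norm_mul, Complex.norm_real, Real.norm_eq_abs]
          gcongr
          have h1 := hc.isLegPair.abs_lt_of_graphPt_mem (hsup (subset_tsupport _ hs))
          have h2 := hC s (abs_le.1 h1.le)
          have h3 := abs_coord_le_norm (e w) 0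
          have h4 := abs_coord_le_norm (e w) 1
          rw [e.norm_map] at h3 h4
          calc |legDeriv fneg fpos s * e w 0 - e w 1|
              ≤ |legDeriv fneg fpos s| * |e w 0| + |e w 1| := by
                rw [← abs_mul]; exact abs_sub _ _
            _ ≤ C * ‖w‖ + ‖w‖ := by gcongr
            _ = (C + 1) * ‖w‖ := by ring
    _ = (C + 1) * ‖w‖ * ∫ x, ‖u x‖ ∂(chartMeasure p e (legFun fneg fpos) r) := by
        rw [integral_const_mul, hc.integral_chartMeasure hu.continuous.norm hsn]
    _ ≤ (C + 1) * ‖w‖ * ∫ x, ‖u x‖ ∂(arcMeasure (frontier Ω)) := by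
        refine mul_le_mul_of_nonneg_left ?_ (by positivity)
        exact integral_mono_measure hc.chartMeasure_le
          (Eventually.of_forall fun _ => norm_nonneg _) hin

end IsCornerChart

/-- The integral over the whole plane of a derivative of a compactly supported function. -/
theorem integral_fderiv_eq_zero {u : Plane → ℂ} (hu : ContDiff ℝ 1 u) (hc : HasCompactSupport u)
    (w : Plane) : ∫ x, fderiv ℝ u x w = 0 := by
  have hi : Integrable fun x => fderiv ℝ u x w :=
    ((hu.continuous_fderiv (by simp)).clm_apply continuous_const).integrable_of_hasCompactSupport
      (hc.fderiv_apply ℝ w)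
  have := integral_bilinear_hasFDerivAt_right_eq_neg_left_of_integrable (μ := volume)
    (f := fun _ : Plane => (1 : ℝ)) (f' := fun _ => 0) (g := u) (g' := fderiv ℝ u) (v := w)
    (B := ContinuousLinearMap.lsmul ℝ ℝ) (by simp) (by simpa using hi)
    (by simpa using hu.continuous.integrable_of_hasCompactSupport hc)
    (fun x _ => hasFDerivAt_const _ _)
    (fun x _ => ((hu.differentiable (by simp)) x).hasFDerivAt)
  simpa using this

/-- Away from the boundary there is no boundary term. -/
theorem setIntegral_fderiv_eq_zero {Ω : Set Plane} (hΩ : IsOpen Ω) {u : Plane → ℂ}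
    (hu : ContDiff ℝ 1 u) (hc : HasCompactSupport u) (hsup : tsupport u ⊆ (frontier Ω)ᶜ)
    (w : Plane) : ∫ x in Ω, fderiv ℝ u x w = 0 := by
  have hloc : ∀ x, (indicator Ω u =ᶠ[𝓝 x] u ∧ x ∈ Ω) ∨
      (indicator Ω u =ᶠ[𝓝 x] 0 ∧ (x ∉ Ω ∨ u =ᶠ[𝓝 x] 0)) := by
    intro x
    by_cases hx : x ∈ Ω
    · left
      refine ⟨?_, hx⟩
      filter_upwards [hΩ.mem_nhds hx] with y hy
      exact indicator_of_mem hy u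
    · right
      by_cases hxs : x ∈ tsupport u
      · refine ⟨?_, Or.inl hx⟩
        have hxc : x ∉ closure Ω := fun h => hsup hxs ⟨h, by rwa [hΩ.interior_eq]⟩
        filter_upwards [isClosed_closure.isOpen_compl.mem_nhds hxc] with y hy
        exact indicator_of_notMem (fun h => hy (subset_closure h)) u
      · have h0 : u =ᶠ[𝓝 x] 0 := by
          filter_upwards [(isClosed_tsupport u).isOpen_compl.mem_nhds hxs] with y hy
          exact image_eq_zero_of_notMem_tsupport hy
        refine ⟨?_, Or.inr h0⟩
        filter_upwards [h0] with y hy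
        by_cases hyΩ : y ∈ Ω
        · rw [indicator_of_mem hyΩ, hy]
        · rw [indicator_of_notMem hyΩ]; rfl
  have hcd : ContDiff ℝ 1 (indicator Ω u) := contDiff_iff_contDiffAt.2 fun x => by
    rcases hloc x with ⟨h, -⟩ | ⟨h, -⟩
    · exact hu.contDiffAt.congr_of_eventuallyEq h
    · exact contDiffAt_const.congr_of_eventuallyEq h
  have hcc : HasCompactSupport (indicator Ω u) :=
    hc.mono (by rw [support_indicator]; exact inter_subset_right)
  rw [← integral_fderiv_eq_zero hcd hcc w, ← integral_indicator hΩ.measurableSet]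
  congr 1
  funext x
  rcases hloc x with ⟨h, hx⟩ | ⟨h, hx⟩
  · rw [indicator_of_mem hx, h.fderiv_eq]
  · rw [h.fderiv_eq]
    rcases hx with hx | hx
    · rw [indicator_of_notMem hx]; simp
    · by_cases hxΩ : x ∈ Ω
      · rw [indicator_of_mem hxΩ, hx.fderiv_eq]
      · rw [indicator_of_notMem hxΩ]; simp

theorem exists_smooth_partition {ι : Type} [Fintype ι] (U : ι → Set Plane)
    (ho : ∀ i, IsOpen (U i)) (hcov : ∀ x, ∃ i, x ∈ U i) :
    ∃ f : ι → Plane → ℝ, (∀ i, ContDiff ℝ 1 (f i)) ∧ (∀ i, tsupport (f i) ⊆ U i) ∧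
      (∀ x, ∑ i, f i x = 1) ∧ ∀ i x, 0 ≤ f i x ∧ f i x ≤ 1 := by
  obtain ⟨f, hf⟩ := SmoothPartitionOfUnity.exists_isSubordinate (modelWithCornersSelf ℝ Plane)
    (s := univ) isClosed_univ U ho (fun x _ => mem_iUnion.2 (hcov x))
  refine ⟨fun i => f i, fun i => ((f i).contMDiff.contDiff).of_le (by exact_mod_cast le_top), hf,
    fun x => ?_, fun i x => ⟨f.nonneg i x, f.le_one i x⟩⟩
  rw [← finsum_eq_sum_of_fintype]
  exact f.sum_eq_one (mem_univ x)

theorem norm_setIntegral_fderiv_le_sum {Ω : Set Plane} {ι : Type} [Fintype ι]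
    {f : ι → Plane → ℝ} (hfs : ∀ i, ContDiff ℝ 1 (f i)) (hsum : ∀ x, ∑ i, f i x = 1)
    {u : Plane → ℂ} (hu : ContDiff ℝ 1 u) (hcs : HasCompactSupport u) (w : Plane) {B : ι → ℝ}
    (hB : ∀ i, ‖∫ x in Ω, fderiv ℝ (fun x => f i x • u x) x w‖ ≤ B i) :
    ‖∫ x in Ω, fderiv ℝ u x w‖ ≤ ∑ i, B i := by
  have hvs : ∀ i, ContDiff ℝ 1 (fun x => f i x • u x) := fun i => (hfs i).smul hu
  have hvc : ∀ i, HasCompactSupport (fun x => f i x • u x) := fun i =>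
    hcs.mono fun x hx h => hx (by simp [h])
  have huv : u = fun x => ∑ i, f i x • u x := by
    funext x
    rw [← Finset.sum_smul, hsum, one_smul]
  have hder : ∀ x, fderiv ℝ u x w = ∑ i, fderiv ℝ (fun x => f i x • u x) x w := by
    intro x
    conv_lhs => rw [huv]
    rw [fderiv_fun_sum fun i _ => ((hvs i).differentiable (by simp)) x]
    simp
  have hint : ∀ i, IntegrableOn (fun x => fderiv ℝ (fun x => f i x • u x) x w) Ω := fun i =>
    ((((hvs i).continuous_fderiv (by simp)).clm_apply
      continuous_const).integrable_of_hasCompactSupport ((hvc i).fderiv_apply ℝ w)).integrableOn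
  simp only [hder]
  rw [integral_finsetSum _ fun i _ => hint i]
  exact (norm_sum_le _ _).trans (Finset.sum_le_sum fun i _ => hB i)

/-- The distributional gradient of the characteristic function of a curvilinear polygon is controlled
by arc length. -/
theorem IsCurvilinearPolygon.exists_boundary_bound {Ω : Set Plane} (h : IsCurvilinearPolygon Ω) :
    ∃ C, 0 ≤ C ∧ ∀ u : Plane → ℂ, ContDiff ℝ 1 u → HasCompactSupport u → ∀ w : Plane,
      ‖∫ x in Ω, fderiv ℝ u x w‖ ≤ C * ‖w‖ * ∫ x, ‖u x‖ ∂(arcMeasure (frontier Ω)) := by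
  have := h.isFiniteMeasure_arcMeasure
  have hch : ∀ p : frontier Ω, ∃ r C, 0 < r ∧ 0 ≤ C ∧ ∀ u : Plane → ℂ, ContDiff ℝ 1 u →
      HasCompactSupport u → tsupport u ⊆ Metric.ball (p : Plane) r → ∀ w : Plane,
      ‖∫ x in Ω, fderiv ℝ u x w‖ ≤ C * ‖w‖ * ∫ x, ‖u x‖ ∂(arcMeasure (frontier Ω)) := by
    intro p
    obtain ⟨e, fneg, fpos, r, hc⟩ := h.chart p p.2
    obtain ⟨C, hC0, hC⟩ := hc.exists_boundary_bound h.isOpen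
    exact ⟨r, C, hc.radius_pos, hC0, hC⟩
  choose r C hr hC0 hC using hch
  obtain ⟨T, hT⟩ := h.isCompact_frontier.elim_finite_subcover
    (fun p : frontier Ω => Metric.ball (p : Plane) (r p)) (fun p => Metric.isOpen_ball)
    (fun x hx => mem_iUnion.2 ⟨⟨x, hx⟩, Metric.mem_ball_self (hr _)⟩)
  -- a partition of unity subordinate to the chart balls and the complement of the boundary
  obtain ⟨f, hfs, hf, hsum, hf01⟩ := exists_smooth_partition
    (fun i : Option T => i.elim (frontier Ω)ᶜ
      fun p => Metric.ball ((p : frontier Ω) : Plane) (r p))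
    (by
      rintro (_ | p)
      · exact isClosed_frontier.isOpen_compl
      · exact Metric.isOpen_ball)
    (by
      intro x
      by_cases hx : x ∈ frontier Ω
      · obtain ⟨p, hp, hxp⟩ := mem_iUnion₂.1 (hT hx)
        exact ⟨some ⟨p, hp⟩, hxp⟩
      · exact ⟨none, hx⟩)
  refine ⟨∑ p : T, C p, Finset.sum_nonneg fun p _ => hC0 p, fun u hu hcs w => ?_⟩
  set S := ∫ x, ‖u x‖ ∂(arcMeasure (frontier Ω))
  have hvs : ∀ i, ContDiff ℝ 1 (fun x => f i x • u x) := fun i => (hfs i).smul hu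
  have hvc : ∀ i, HasCompactSupport (fun x => f i x • u x) := fun i =>
    hcs.mono fun x hx h => hx (by simp [h])
  have hvt : ∀ i, tsupport (fun x => f i x • u x) ⊆ tsupport (f i) := fun i =>
    tsupport_smul_subset_left _ _
  have key := norm_setIntegral_fderiv_le_sum hfs hsum hu hcs w
    (B := fun i => i.elim 0 fun p : T => C p * ‖w‖ * S) (by
      rintro (_ | p)
      · rw [setIntegral_fderiv_eq_zero h.isOpen (hvs none) (hvc none)
          ((hvt none).trans (hf none)) w]
        simp
      · refine (hC p _ (hvs _) (hvc _) ((hvt _).trans (hf (some p))) w).trans ?_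
        refine mul_le_mul_of_nonneg_left ?_ (mul_nonneg (hC0 p) (norm_nonneg _))
        refine integral_mono (integrable_arcMeasure (hvs _).continuous (hvc _)).norm
          (integrable_arcMeasure hu.continuous hcs).norm fun x => ?_
        simp only [norm_smul, Real.norm_eq_abs, abs_of_nonneg (hf01 (some p) x).1]
        exact mul_le_of_le_one_left (norm_nonneg _) (hf01 _ x).2)
  refine key.trans (le_of_eq ?_)
  rw [Fintype.sum_option, Finset.sum_mul, Finset.sum_mul]
  simp

/-! ### The heat kernel and the fundamental solution -/

/-- The kernel of `exp (-t (a - Δ))` on the plane. -/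
def heatK (a t : ℝ) (z : Plane) : ℝ :=
  Real.exp (-(a * t)) * (4 * Real.pi * t)⁻¹ * Real.exp (-(‖z‖ ^ 2 / (4 * t)))

/-- The fundamental solution of `a - Δ`, as a superposition of heat kernels. -/
def greenK (a : ℝ) (z : Plane) : ℝ := ∫ t in Ioi (0 : ℝ), heatK a t z

/-- The gradient of `greenK a` at `z` is `- greenSlope a z • z`. -/
def greenSlope (a : ℝ) (z : Plane) : ℝ := ∫ t in Ioi (0 : ℝ), heatK a t z / (2 * t)

/-- A common majorant, up to constants, of the fundamental solution and of its gradient: integrable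
over the plane, and square integrable with the weight `‖z‖ ^ (1 / 2)`. -/
def domK (z : Plane) : ℝ := min ‖z‖⁻¹ (‖z‖⁻¹ ^ 3)

theorem heatK_nonneg (a : ℝ) {t : ℝ} (ht : 0 < t) (z : Plane) : 0 ≤ heatK a t z := by
  unfold heatK; positivity

theorem measurable_heatK (a : ℝ) : Measurable fun q : ℝ × Plane => heatK a q.1 q.2 := by
  unfold heatK; fun_prop

theorem measurable_heatK_left (a : ℝ) (z : Plane) : Measurable fun t => heatK a t z := by
  unfold heatK; fun_prop

theorem domK_nonneg (z : Plane) : 0 ≤ domK z := le_min (by positivity) (by positivity)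

theorem measurable_domK : Measurable domK := by
  unfold domK; fun_prop

theorem rpow_half_sq {t : ℝ} (ht : 0 < t) : t ^ (1 / 2 : ℝ) * t ^ (1 / 2 : ℝ) = t := by
  rw [← Real.rpow_add ht]; norm_num

theorem exp_neg_sq_le_inv {s : ℝ} (hs : 0 < s) : Real.exp (-s ^ 2) ≤ s⁻¹ := by
  rw [Real.exp_neg]
  refine inv_anti₀ hs ?_
  nlinarith [Real.add_one_le_exp (s ^ 2), sq_nonneg (s - 1)]

theorem exp_neg_sq_le_inv_pow_three {s : ℝ} (hs : 0 < s) : Real.exp (-s ^ 2) ≤ (s ^ 3)⁻¹ := by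
  rw [Real.exp_neg]
  refine inv_anti₀ (by positivity) ?_
  have := Real.quadratic_le_exp_of_nonneg (sq_nonneg s)
  nlinarith [sq_nonneg (s ^ 2 - s), sq_nonneg (s - 1), sq_nonneg s]

theorem exp_neg_sq_le_inv_pow_four {s : ℝ} (hs : 0 < s) :
    Real.exp (-s ^ 2) ≤ 2 * (s ^ 4)⁻¹ := by
  rw [Real.exp_neg, ← inv_inv (2 : ℝ), ← mul_inv]
  refine inv_anti₀ (by positivity) ?_
  have := Real.quadratic_le_exp_of_nonneg (sq_nonneg s)
  nlinarith [sq_nonneg s]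

theorem exp_gauss_eq {t ρ : ℝ} (ht : 0 < t) :
    -(ρ ^ 2 / (4 * t)) = -(ρ / (2 * t ^ (1 / 2 : ℝ))) ^ 2 := by
  rw [div_pow, mul_pow, pow_two (t ^ (1 / 2 : ℝ)), rpow_half_sq ht]
  norm_num

theorem heatK_le_inv (a : ℝ) {t : ℝ} (ht : 0 < t) {z : Plane} (hz : z ≠ 0) :
    heatK a t z ≤ ‖z‖⁻¹ * (t ^ (-(1 / 2) : ℝ) * Real.exp (-a * t)) := by
  have hn : 0 < ‖z‖ := norm_pos_iff.2 hz
  have hh : 0 < t ^ (1 / 2 : ℝ) := Real.rpow_pos_of_pos ht _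
  have h1 := exp_neg_sq_le_inv (s := ‖z‖ / (2 * t ^ (1 / 2 : ℝ))) (by positivity)
  rw [← exp_gauss_eq ht, inv_div] at h1
  unfold heatK
  have e1 : t ^ (-(1 / 2) : ℝ) = t⁻¹ * t ^ (1 / 2 : ℝ) := by
    rw [← Real.rpow_neg_one, ← Real.rpow_add ht]; norm_num
  have e2 : (4 * Real.pi * t)⁻¹ ≤ t⁻¹ * (1 / 2) := by
    rw [mul_inv, mul_comm]
    have : (4 * Real.pi)⁻¹ ≤ 1 / 2 := by
      rw [one_div]; apply inv_anti₀ (by norm_num); nlinarith [Real.pi_gt_three]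
    gcongr
  calc Real.exp (-(a * t)) * (4 * Real.pi * t)⁻¹ * Real.exp (-(‖z‖ ^ 2 / (4 * t)))
      ≤ Real.exp (-(a * t)) * (t⁻¹ * (1 / 2)) * (2 * t ^ (1 / 2 : ℝ) / ‖z‖) := by gcongr
    _ = ‖z‖⁻¹ * (t ^ (-(1 / 2) : ℝ) * Real.exp (-a * t)) := by
        rw [e1, neg_mul]; field_simp

theorem heatK_le_inv_pow_three (a : ℝ) {t : ℝ} (ht : 0 < t) {z : Plane} (hz : z ≠ 0) :
    heatK a t z ≤ ‖z‖⁻¹ ^ 3 * (t ^ (1 / 2 : ℝ) * Real.exp (-a * t)) := by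
  have hn : 0 < ‖z‖ := norm_pos_iff.2 hz
  have hh : 0 < t ^ (1 / 2 : ℝ) := Real.rpow_pos_of_pos ht _
  have h1 := exp_neg_sq_le_inv_pow_three (s := ‖z‖ / (2 * t ^ (1 / 2 : ℝ))) (by positivity)
  rw [← exp_gauss_eq ht, ← inv_pow, inv_div] at h1
  unfold heatK
  have e0 := rpow_half_sq ht
  have e2 : (4 * Real.pi * t)⁻¹ ≤ t⁻¹ * (1 / 8) := by
    rw [mul_inv, mul_comm]
    have : (4 * Real.pi)⁻¹ ≤ 1 / 8 := by
      rw [one_div]; apply inv_anti₀ (by norm_num); nlinarith [Real.pi_gt_three]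
    gcongr
  calc Real.exp (-(a * t)) * (4 * Real.pi * t)⁻¹ * Real.exp (-(‖z‖ ^ 2 / (4 * t)))
      ≤ Real.exp (-(a * t)) * (t⁻¹ * (1 / 8)) * (2 * t ^ (1 / 2 : ℝ) / ‖z‖) ^ 3 := by gcongr
    _ = ‖z‖⁻¹ ^ 3 * ((t⁻¹ * (t ^ (1 / 2 : ℝ) * t ^ (1 / 2 : ℝ))) * t ^ (1 / 2 : ℝ)
          * Real.exp (-a * t)) := by
        rw [neg_mul]; field_simp; norm_num
    _ = _ := by rw [e0, inv_mul_cancel₀ ht.ne', one_mul]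

theorem heatK_div_le (a : ℝ) {t : ℝ} (ht : 0 < t) {z : Plane} (hz : z ≠ 0) :
    heatK a t z / (2 * t) ≤ 2 * ‖z‖⁻¹ ^ 4 * Real.exp (-a * t) := by
  have hn : 0 < ‖z‖ := norm_pos_iff.2 hz
  have hh : 0 < t ^ (1 / 2 : ℝ) := Real.rpow_pos_of_pos ht _
  have h1 := exp_neg_sq_le_inv_pow_four (s := ‖z‖ / (2 * t ^ (1 / 2 : ℝ))) (by positivity)
  rw [← exp_gauss_eq ht, ← inv_pow, inv_div] at h1
  unfold heatK
  have e0 := rpow_half_sq ht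
  have e2 : (4 * Real.pi * t)⁻¹ ≤ t⁻¹ * (1 / 8) := by
    rw [mul_inv, mul_comm]
    have : (4 * Real.pi)⁻¹ ≤ 1 / 8 := by
      rw [one_div]; apply inv_anti₀ (by norm_num); nlinarith [Real.pi_gt_three]
    gcongr
  calc Real.exp (-(a * t)) * (4 * Real.pi * t)⁻¹ * Real.exp (-(‖z‖ ^ 2 / (4 * t))) / (2 * t)
      ≤ Real.exp (-(a * t)) * (t⁻¹ * (1 / 8)) * (2 * (2 * t ^ (1 / 2 : ℝ) / ‖z‖) ^ 4)
          / (2 * t) := by gcongr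
    _ = 2 * ‖z‖⁻¹ ^ 4 * Real.exp (-a * t) * ((t⁻¹ * (t ^ (1 / 2 : ℝ) * t ^ (1 / 2 : ℝ)))
          * (t⁻¹ * (t ^ (1 / 2 : ℝ) * t ^ (1 / 2 : ℝ)))) := by
        rw [neg_mul]; field_simp; norm_num
    _ = _ := by rw [e0, inv_mul_cancel₀ ht.ne', one_mul, mul_one]

theorem integrableOn_rpow_mul_exp {a k : ℝ} (ha : 0 < a) (hk : -1 < k) :
    IntegrableOn (fun t : ℝ => t ^ k * Real.exp (-a * t)) (Ioi 0) := by
  have := integrableOn_rpow_mul_exp_neg_mul_rpow (s := k) (p := 1) (b := a) hk one_pos ha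
  simpa using this

theorem integrableOn_exp_neg {a : ℝ} (ha : 0 < a) :
    IntegrableOn (fun t : ℝ => Real.exp (-a * t)) (Ioi 0) := by
  simpa using integrableOn_rpow_mul_exp ha (k := 0) (by norm_num)

theorem integrableOn_heatK {a : ℝ} (ha : 0 < a) {z : Plane} (hz : z ≠ 0) :
    IntegrableOn (fun t => heatK a t z) (Ioi 0) := by
  refine ((integrableOn_rpow_mul_exp ha (k := -(1 / 2)) (by norm_num)).const_mul ‖z‖⁻¹).mono'
    (measurable_heatK_left a z).aestronglyMeasurable ?_
  refine (ae_restrict_iff' measurableSet_Ioi).2 (Eventually.of_forall fun t ht => ?_)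
  rw [Real.norm_eq_abs, abs_of_nonneg (heatK_nonneg a ht z)]
  exact heatK_le_inv a ht hz

theorem integrableOn_heatK_div {a : ℝ} (ha : 0 < a) {z : Plane} (hz : z ≠ 0) :
    IntegrableOn (fun t => heatK a t z / (2 * t)) (Ioi 0) := by
  refine ((integrableOn_exp_neg ha).const_mul (2 * ‖z‖⁻¹ ^ 4)).mono'
    ((measurable_heatK_left a z).div (by fun_prop)).aestronglyMeasurable ?_
  refine (ae_restrict_iff' measurableSet_Ioi).2 (Eventually.of_forall fun t ht => ?_)
  have ht' : (0 : ℝ) < t := ht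
  rw [Real.norm_eq_abs, abs_of_nonneg (div_nonneg (heatK_nonneg a ht z) (by positivity))]
  exact heatK_div_le a ht hz

theorem greenK_nonneg (a : ℝ) (z : Plane) : 0 ≤ greenK a z :=
  setIntegral_nonneg measurableSet_Ioi fun _ ht => heatK_nonneg a ht z

theorem greenSlope_nonneg (a : ℝ) (z : Plane) : 0 ≤ greenSlope a z :=
  setIntegral_nonneg measurableSet_Ioi fun _ ht =>
    div_nonneg (heatK_nonneg a ht z) (mul_nonneg zero_le_two (le_of_lt ht))

theorem integral_exp_neg_div {c : ℝ} (hc : 0 < c) :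
    IntegrableOn (fun t : ℝ => Real.exp (-(c / t)) * (t ^ 2)⁻¹) (Ioi 0) ∧
      ∫ t in Ioi (0 : ℝ), Real.exp (-(c / t)) * (t ^ 2)⁻¹ = c⁻¹ := by
  have hd : ∀ t ∈ Ioi (0 : ℝ), HasDerivAt (fun t : ℝ => c⁻¹ * Real.exp (-(c / t)))
      (Real.exp (-(c / t)) * (t ^ 2)⁻¹) t := by
    intro t ht
    have ht' : (t : ℝ) ≠ 0 := ne_of_gt ht
    have h1 : HasDerivAt (fun t : ℝ => -(c / t)) (c * (t ^ 2)⁻¹) t := by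
      have := ((hasDerivAt_inv ht').const_mul c).neg
      rw [mul_neg, neg_neg] at this
      exact this
    have := (h1.exp).const_mul c⁻¹
    rwa [show c⁻¹ * (Real.exp (-(c / t)) * (c * (t ^ 2)⁻¹))
      = (c⁻¹ * c) * (Real.exp (-(c / t)) * (t ^ 2)⁻¹) by ring, inv_mul_cancel₀ hc.ne',
      one_mul] at this
  have hnn : ∀ t ∈ Ioi (0 : ℝ), 0 ≤ Real.exp (-(c / t)) * (t ^ 2)⁻¹ := fun _ _ => by positivity
  have ht1 : Tendsto (fun t : ℝ => c⁻¹ * Real.exp (-(c / t))) atTop (𝓝 c⁻¹) := by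
    have : Tendsto (fun t : ℝ => -(c / t)) atTop (𝓝 0) := by
      simpa using (tendsto_const_nhds (x := c)).div_atTop tendsto_id |>.neg
    have h2 := (Real.continuous_exp.tendsto _).comp this
    simpa using h2.const_mul c⁻¹
  have ht0 : Tendsto (fun t : ℝ => c⁻¹ * Real.exp (-(c / t))) (𝓝[>] 0) (𝓝 0) := by
    have : Tendsto (fun t : ℝ => -(c / t)) (𝓝[>] 0) atBot := by
      refine tendsto_neg_atTop_atBot.comp ?_
      exact tendsto_inv_nhdsGT_zero.const_mul_atTop hc
    have h2 := Real.tendsto_exp_atBot.comp this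
    simpa using h2.const_mul c⁻¹
  have e := integral_Ioi_of_hasDerivAt_of_tendsto (a := (0 : ℝ)) (f := fun t => if t ≤ 0 then 0
      else c⁻¹ * Real.exp (-(c / t))) (f' := fun t =>
      Real.exp (-(c / t)) * (t ^ 2)⁻¹) (m := c⁻¹)
  have hcw : ContinuousWithinAt (fun t : ℝ => if t ≤ 0 then (0 : ℝ)
      else c⁻¹ * Real.exp (-(c / t))) (Ici 0) 0 := by
    rw [← continuousWithinAt_Ioi_iff_Ici]
    unfold ContinuousWithinAt
    simp only [le_refl, if_true]
    refine ht0.congr' ?_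
    filter_upwards [self_mem_nhdsWithin] with t ht
    rw [if_neg (not_le.2 ht)]
  have hdd : ∀ t ∈ Ioi (0 : ℝ), HasDerivAt (fun t : ℝ => if t ≤ 0 then (0 : ℝ)
      else c⁻¹ * Real.exp (-(c / t))) (Real.exp (-(c / t)) * (t ^ 2)⁻¹) t := by
    intro t ht
    refine (hd t ht).congr_of_eventuallyEq ?_
    filter_upwards [Ioi_mem_nhds ht] with x hx
    rw [if_neg (not_le.2 hx)]
  have htt : Tendsto (fun t : ℝ => if t ≤ 0 then (0 : ℝ)
      else c⁻¹ * Real.exp (-(c / t))) atTop (𝓝 c⁻¹) := by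
    refine ht1.congr' ?_
    filter_upwards [Ioi_mem_atTop 0] with x hx
    rw [if_neg (not_le.2 hx)]
  have hint : IntegrableOn (fun t : ℝ => Real.exp (-(c / t)) * (t ^ 2)⁻¹) (Ioi 0) :=
    integrableOn_Ioi_deriv_of_nonneg hcw hdd hnn htt
  refine ⟨hint, ?_⟩
  rw [e hcw hdd hint htt]
  simp

/-- The gradient of the fundamental solution is bounded by `1 / (2 π ‖z‖)`, the gradient of the
logarithmic potential. -/
theorem norm_sq_mul_greenSlope_le {a : ℝ} (ha : 0 < a) (z : Plane) :
    ‖z‖ ^ 2 * greenSlope a z ≤ (2 * Real.pi)⁻¹ := by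
  by_cases hz : z = 0
  · simp [hz]; positivity
  have hn : 0 < ‖z‖ := norm_pos_iff.2 hz
  obtain ⟨hi, he⟩ := integral_exp_neg_div (c := ‖z‖ ^ 2 / 4) (by positivity)
  have : greenSlope a z ≤ ∫ t in Ioi (0 : ℝ),
      (8 * Real.pi)⁻¹ * (Real.exp (-(‖z‖ ^ 2 / 4 / t)) * (t ^ 2)⁻¹) := by
    refine setIntegral_mono_on (integrableOn_heatK_div ha hz) (hi.const_mul _) measurableSet_Ioi
      fun t ht => ?_
    have ht' : (0 : ℝ) < t := ht
    have h1 : Real.exp (-(a * t)) ≤ 1 := Real.exp_le_one_iff.2 (by nlinarith)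
    unfold heatK
    calc Real.exp (-(a * t)) * (4 * Real.pi * t)⁻¹ * Real.exp (-(‖z‖ ^ 2 / (4 * t))) / (2 * t)
        ≤ 1 * (4 * Real.pi * t)⁻¹ * Real.exp (-(‖z‖ ^ 2 / (4 * t))) / (2 * t) := by gcongr
      _ = _ := by
        rw [div_div (‖z‖ ^ 2) 4 t]; field_simp; norm_num
  rw [integral_const_mul, he] at this
  calc ‖z‖ ^ 2 * greenSlope a z ≤ ‖z‖ ^ 2 * ((8 * Real.pi)⁻¹ * (‖z‖ ^ 2 / 4)⁻¹) := by gcongr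
    _ = (2 * Real.pi)⁻¹ := by field_simp; norm_num

/-- At the origin the defining integral diverges, and the fundamental solution takes the value
`0` there by convention. -/
theorem greenK_zero {a : ℝ} (ha : 0 < a) : greenK a 0 = 0 := by
  refine integral_undef fun h => ?_
  have h2 : IntegrableOn (fun t : ℝ => t⁻¹) (Ioc 0 1) := by
    refine (IntegrableOn.mono_set h Ioc_subset_Ioi_self).const_mul
      (4 * Real.pi * Real.exp a) |>.mono' measurable_inv.aestronglyMeasurable ?_
    refine (ae_restrict_iff' measurableSet_Ioc).2 (Eventually.of_forall fun t ht => ?_)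
    have ht0 : 0 < t := ht.1
    rw [Real.norm_eq_abs, abs_of_nonneg (by positivity)]
    unfold heatK
    have e1 : 1 ≤ Real.exp a * Real.exp (-(a * t)) := by
      rw [← Real.exp_add]
      exact Real.one_le_exp (by nlinarith [ht.2])
    simp only [norm_zero, ne_eq, OfNat.ofNat_ne_zero, not_false_eq_true, zero_pow,
      zero_div, neg_zero, Real.exp_zero, mul_one]
    calc t⁻¹ = 1 * t⁻¹ := (one_mul _).symm
      _ ≤ (Real.exp a * Real.exp (-(a * t))) * t⁻¹ := by gcongr
      _ = _ := by field_simp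
  have h3 : IntervalIntegrable (fun t : ℝ => t⁻¹) volume 0 1 :=
    (intervalIntegrable_iff_integrableOn_Ioc_of_le zero_le_one).2 h2
  simp at h3

/-- The fundamental solution has a logarithmic singularity, and its gradient one of order `‖z‖⁻¹`;
both decay exponentially. The powers in `domK` are weaker but suffice for integrability. -/
theorem exists_kernel_bound {a : ℝ} (ha : 0 < a) :
    ∃ C, 0 ≤ C ∧ (∀ z, greenK a z ≤ C * domK z) ∧ ∀ z, ‖z‖ * greenSlope a z ≤ C * domK z := by
  set C1 := ∫ t in Ioi (0 : ℝ), t ^ (-(1 / 2) : ℝ) * Real.exp (-a * t)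
  set C2 := ∫ t in Ioi (0 : ℝ), t ^ (1 / 2 : ℝ) * Real.exp (-a * t)
  set C3 := ∫ t in Ioi (0 : ℝ), Real.exp (-a * t)
  have n1 : 0 ≤ C1 := setIntegral_nonneg measurableSet_Ioi fun t ht => by
    have : (0 : ℝ) < t := ht
    positivity
  have n2 : 0 ≤ C2 := setIntegral_nonneg measurableSet_Ioi fun t ht => by
    have : (0 : ℝ) < t := ht
    positivity
  have n3 : 0 ≤ C3 := setIntegral_nonneg measurableSet_Ioi fun t ht => by positivity
  have hpi : (2 * Real.pi)⁻¹ ≤ 1 := inv_le_one_of_one_le₀ (by nlinarith [Real.pi_gt_three])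
  refine ⟨C1 + C2 + 2 * C3 + 1, by positivity, fun z => ?_, fun z => ?_⟩
  · by_cases hz : z = 0
    · subst hz
      rw [greenK_zero ha]
      have := domK_nonneg (0 : Plane)
      positivity
    · have h1 : greenK a z ≤ ‖z‖⁻¹ * C1 := by
        rw [← integral_const_mul]
        exact setIntegral_mono_on (integrableOn_heatK ha hz)
          ((integrableOn_rpow_mul_exp ha (by norm_num)).const_mul _) measurableSet_Ioi
          fun t ht => heatK_le_inv a ht hz
      have h2 : greenK a z ≤ ‖z‖⁻¹ ^ 3 * C2 := by
        rw [← integral_const_mul]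
        exact setIntegral_mono_on (integrableOn_heatK ha hz)
          ((integrableOn_rpow_mul_exp ha (by norm_num)).const_mul _) measurableSet_Ioi
          fun t ht => heatK_le_inv_pow_three a ht hz
      have p1 : 0 ≤ ‖z‖⁻¹ := by positivity
      have p3 : 0 ≤ ‖z‖⁻¹ ^ 3 := by positivity
      unfold domK
      rcases min_choice ‖z‖⁻¹ (‖z‖⁻¹ ^ 3) with h | h <;> rw [h] <;> nlinarith
  · by_cases hz : z = 0
    · subst hz
      have := domK_nonneg (0 : Plane)
      simp only [norm_zero, zero_mul]
      positivity
    · have hn : 0 < ‖z‖ := norm_pos_iff.2 hz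
      have h1 : ‖z‖ * greenSlope a z ≤ ‖z‖⁻¹ := by
        have := (norm_sq_mul_greenSlope_le ha z).trans hpi
        rw [← one_div, le_div_iff₀ hn]
        nlinarith
      have h2 : greenSlope a z ≤ 2 * ‖z‖⁻¹ ^ 4 * C3 := by
        rw [← integral_const_mul]
        exact setIntegral_mono_on (integrableOn_heatK_div ha hz)
          ((integrableOn_exp_neg ha).const_mul _) measurableSet_Ioi
          fun t ht => heatK_div_le a ht hz
      have h3 : ‖z‖ * greenSlope a z ≤ ‖z‖⁻¹ ^ 3 * (2 * C3) := by
        calc ‖z‖ * greenSlope a z ≤ ‖z‖ * (2 * ‖z‖⁻¹ ^ 4 * C3) := by gcongr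
          _ = _ := by field_simp
      have p1 : 0 ≤ ‖z‖⁻¹ := by positivity
      have p3 : 0 ≤ ‖z‖⁻¹ ^ 3 := by positivity
      unfold domK
      rcases min_choice ‖z‖⁻¹ (‖z‖⁻¹ ^ 3) with h | h <;> rw [h] <;> nlinarith

/-- Integrability over the plane of a radial function dominated by `‖z‖ ^ (-3/2)` near the origin
and by `‖z‖ ^ (-3)` at infinity. -/
theorem integrable_radial {f : ℝ → ℝ} (hf : Measurable f)
    (h0 : ∀ y, 0 < y → y ≤ 1 → |f y| ≤ y ^ (-(3 / 2) : ℝ)) (h1 : ∀ y, 1 < y → |f y| ≤ y ^ (-3 : ℝ)) :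
    Integrable fun z : Plane => f ‖z‖ := by
  rw [integrable_fun_norm_addHaar]
  have hdim : Module.finrank ℝ Plane - 1 = 1 := by simp
  rw [hdim, ← Ioc_union_Ioi_eq_Ioi zero_le_one]
  refine IntegrableOn.union ?_ ?_
  · have hi : IntegrableOn (fun y : ℝ => y ^ (-(1 / 2) : ℝ)) (Ioc 0 1) :=
      (intervalIntegrable_iff_integrableOn_Ioc_of_le zero_le_one).1
        (intervalIntegral.intervalIntegrable_rpow' (by norm_num))
    refine hi.mono' (by fun_prop) ?_
    refine (ae_restrict_iff' measurableSet_Ioc).2 (Eventually.of_forall fun y hy => ?_)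
    have hy0 : 0 < y := hy.1
    rw [pow_one, smul_eq_mul, Real.norm_eq_abs, abs_mul, abs_of_pos hy0]
    calc y * |f y| ≤ y ^ (1 : ℝ) * y ^ (-(3 / 2) : ℝ) := by
          rw [Real.rpow_one]; gcongr; exact h0 y hy.1 hy.2
      _ = _ := by rw [← Real.rpow_add hy0]; norm_num
  · have hi : IntegrableOn (fun y : ℝ => y ^ (-2 : ℝ)) (Ioi 1) :=
      integrableOn_Ioi_rpow_of_lt (by norm_num) one_pos
    refine hi.mono' (by fun_prop) ?_
    refine (ae_restrict_iff' measurableSet_Ioi).2 (Eventually.of_forall fun y hy => ?_)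
    have hy0 : 0 < y := one_pos.trans hy
    rw [pow_one, smul_eq_mul, Real.norm_eq_abs, abs_mul, abs_of_pos hy0]
    calc y * |f y| ≤ y ^ (1 : ℝ) * y ^ (-3 : ℝ) := by
          rw [Real.rpow_one]; gcongr; exact h1 y hy
      _ = _ := by rw [← Real.rpow_add hy0]; norm_num

theorem inv_pow_eq_rpow {y : ℝ} (hy : 0 < y) (n : ℕ) : y⁻¹ ^ n = y ^ (-(n : ℝ)) := by
  rw [Real.rpow_neg hy.le, Real.rpow_natCast, inv_pow]

theorem integrable_domK : Integrable domK := by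
  refine integrable_radial (f := fun y => min y⁻¹ (y⁻¹ ^ 3)) (by fun_prop) ?_ ?_
  · intro y hy hy1
    rw [abs_of_nonneg (le_min (by positivity) (by positivity))]
    refine (min_le_left _ _).trans ?_
    rw [← pow_one y⁻¹, inv_pow_eq_rpow hy]
    exact Real.rpow_le_rpow_of_exponent_ge hy hy1 (by norm_num)
  · intro y hy
    have hy0 : 0 < y := one_pos.trans hy
    rw [abs_of_nonneg (le_min (by positivity) (by positivity))]
    refine (min_le_right _ _).trans ?_
    rw [inv_pow_eq_rpow hy0]
    norm_num

theorem integrable_domK_sq_weight :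
    Integrable fun z : Plane => domK z ^ 2 * ‖z‖ ^ (1 / 2 : ℝ) := by
  refine integrable_radial (f := fun y => (min y⁻¹ (y⁻¹ ^ 3)) ^ 2 * y ^ (1 / 2 : ℝ))
    (by fun_prop) ?_ ?_
  · intro y hy hy1
    have hm : 0 ≤ min y⁻¹ (y⁻¹ ^ 3) := le_min (by positivity) (by positivity)
    rw [abs_of_nonneg (by positivity)]
    calc (min y⁻¹ (y⁻¹ ^ 3)) ^ 2 * y ^ (1 / 2 : ℝ) ≤ y⁻¹ ^ 2 * y ^ (1 / 2 : ℝ) := by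
          gcongr; exact min_le_left _ _
      _ = _ := by rw [inv_pow_eq_rpow hy, ← Real.rpow_add hy]; norm_num
  · intro y hy
    have hy0 : 0 < y := one_pos.trans hy
    have hm : 0 ≤ min y⁻¹ (y⁻¹ ^ 3) := le_min (by positivity) (by positivity)
    rw [abs_of_nonneg (by positivity)]
    calc (min y⁻¹ (y⁻¹ ^ 3)) ^ 2 * y ^ (1 / 2 : ℝ) ≤ (y⁻¹ ^ 3) ^ 2 * y ^ (1 / 2 : ℝ) := by
          gcongr; exact min_le_right _ _
      _ = y ^ (-(11 / 2) : ℝ) := by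
          rw [← pow_mul, inv_pow_eq_rpow hy0, ← Real.rpow_add hy0]; norm_num
      _ ≤ _ := Real.rpow_le_rpow_of_exponent_le hy.le (by norm_num)

/-- The fundamental solution as a superposition of heat kernels: in the variable `τ` with
`t = (γ ‖z‖ / 2) exp τ` the two exponents combine to `-(‖z‖ / γ) cosh τ`. -/
theorem greenK_eq_greenFn {γ : ℝ} (hγ : 0 < γ) {z : Plane} (hz : z ≠ 0) :
    greenK (γ⁻¹ ^ 2) z = greenFn γ z := by
  have hn : 0 < ‖z‖ := norm_pos_iff.2 hz
  set c := ‖z‖ * γ / 2 with hc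
  have hc0 : 0 < c := by positivity
  have himg : (fun τ : ℝ => c * Real.exp τ) '' univ = Ioi 0 := by
    ext t
    simp only [image_univ, mem_range, mem_Ioi]
    constructor
    · rintro ⟨τ, rfl⟩; positivity
    · intro ht
      exact ⟨Real.log (t / c), by rw [Real.exp_log (by positivity)]; field_simp⟩
  have hinj : InjOn (fun τ : ℝ => c * Real.exp τ) univ := fun x _ y _ h =>
    Real.exp_injective (mul_left_cancel₀ hc0.ne' h)
  unfold greenK
  rw [← himg, integral_image_eq_integral_abs_deriv_smul MeasurableSet.univ
    (fun τ _ => ((Real.hasDerivAt_exp τ).const_mul c).hasDerivWithinAt) hinj, setIntegral_univ]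
  have : ∀ τ : ℝ, |c * Real.exp τ| • heatK (γ⁻¹ ^ 2) (c * Real.exp τ) z
      = (4 * Real.pi)⁻¹ * (fun r => Real.exp (-(‖z‖ / γ) * Real.cosh r)) |τ| := by
    intro τ
    simp only [Real.cosh_abs]
    rw [abs_of_pos (by positivity), smul_eq_mul, heatK, Real.cosh_eq]
    have e1 : Real.exp (-(‖z‖ / γ) * ((Real.exp τ + Real.exp (-τ)) / 2))
        = Real.exp (-(γ⁻¹ ^ 2 * (c * Real.exp τ)))
          * Real.exp (-(‖z‖ ^ 2 / (4 * (c * Real.exp τ)))) := by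
      rw [← Real.exp_add]
      congr 1
      rw [hc, Real.exp_neg]
      field_simp
      ring
    rw [e1]
    field_simp
  simp only [this]
  rw [integral_const_mul, integral_comp_abs (f := fun r => Real.exp (-(‖z‖ / γ) * Real.cosh r)),
    greenFn, besselK0]
  field_simp
  norm_num

theorem self_le_cosh {t : ℝ} : t ≤ Real.cosh t := by
  rw [← Real.cosh_abs]
  have h2 := Real.self_le_sinh_iff.2 (abs_nonneg t)
  exact (le_abs_self t).trans (h2.trans (Real.sinh_lt_cosh _).le)

/-- The Macdonald function extends holomorphically to the right half-plane. -/
theorem differentiableAt_bessel {z₀ : ℂ} (hz : 0 < z₀.re) :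
    DifferentiableAt ℂ (fun z : ℂ => ∫ t in Ioi (0 : ℝ), Complex.exp (-z * (Real.cosh t : ℂ))) z₀ := by
  set δ := z₀.re / 2 with hδ
  have hδ0 : 0 < δ := by positivity
  have hre : ∀ z ∈ Metric.ball z₀ δ, δ ≤ z.re := by
    intro z hz
    have h1 := Complex.abs_re_le_norm (z - z₀)
    have h2 : ‖z - z₀‖ < δ := by simpa [dist_eq_norm] using hz
    rw [Complex.sub_re] at h1
    have := (abs_le.1 (h1.trans h2.le)).1
    linarith
  have hnorm : ∀ z : ℂ, ∀ t : ℝ, ‖Complex.exp (-z * (Real.cosh t : ℂ))‖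
      = Real.exp (-z.re * Real.cosh t) := by
    intro z t
    rw [Complex.norm_exp, Complex.re_mul_ofReal, Complex.neg_re]
  have hexp : ∀ z ∈ Metric.ball z₀ δ, ∀ t : ℝ, Real.exp (-z.re * Real.cosh t)
      ≤ Real.exp (-δ * Real.cosh t) := by
    intro z hz t
    apply Real.exp_le_exp.2
    have := hre z hz
    have := (Real.cosh_pos t).le
    nlinarith
  have hcm : ∀ z : ℂ, AEStronglyMeasurable (fun t : ℝ => Complex.exp (-z * (Real.cosh t : ℂ)))
      (volume.restrict (Ioi 0)) := by
    intro z
    exact (Continuous.aestronglyMeasurable (by fun_prop))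
  have key := hasDerivAt_integral_of_dominated_loc_of_deriv_le
    (μ := volume.restrict (Ioi (0 : ℝ))) (𝕜 := ℂ)
    (F := fun (z : ℂ) (t : ℝ) => Complex.exp (-z * (Real.cosh t : ℂ)))
    (F' := fun (z : ℂ) (t : ℝ) => Complex.exp (-z * (Real.cosh t : ℂ)) * (-1 * (Real.cosh t : ℂ)))
    (x₀ := z₀) (s := Metric.ball z₀ δ)
    (bound := fun t => (2 / δ) * Real.exp (-(δ / 2) * t)) (Metric.ball_mem_nhds _ hδ0)
    (Eventually.of_forall fun z => hcm z) ?_ ?_ ?_ ?_ ?_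
  · exact key.2.differentiableAt
  · refine (integrableOn_exp_neg hδ0).mono' (hcm z₀) (Eventually.of_forall fun t => ?_)
    rw [hnorm]
    refine (hexp z₀ (Metric.mem_ball_self hδ0) t).trans (Real.exp_le_exp.2 ?_)
    have := self_le_cosh (t := t)
    nlinarith
  · exact (Continuous.aestronglyMeasurable (by fun_prop))
  · refine Eventually.of_forall fun t z hz => ?_
    have h1 := hexp z hz t
    have hc := Real.cosh_pos t
    have hc2 := self_le_cosh (t := t)
    rw [norm_mul, hnorm, norm_mul, norm_neg, norm_one, one_mul, Complex.norm_real,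
      Real.norm_eq_abs, abs_of_pos hc]
    have h3 : Real.cosh t ≤ (2 / δ) * Real.exp (δ / 2 * Real.cosh t) := by
      have := Real.add_one_le_exp (δ / 2 * Real.cosh t)
      rw [div_mul_eq_mul_div, le_div_iff₀ hδ0]
      nlinarith
    calc Real.exp (-z.re * Real.cosh t) * Real.cosh t
        ≤ Real.exp (-δ * Real.cosh t) * ((2 / δ) * Real.exp (δ / 2 * Real.cosh t)) := by gcongr
      _ = (2 / δ) * Real.exp (-(δ / 2) * Real.cosh t) := by
          rw [mul_left_comm, ← Real.exp_add]; ring_nf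
      _ ≤ (2 / δ) * Real.exp (-(δ / 2) * t) := by
          gcongr (2 / δ) * Real.exp ?_
          nlinarith
  · exact (integrableOn_exp_neg (a := δ / 2) (by positivity)).const_mul _
  · refine Eventually.of_forall fun t z _ => ?_
    have h1 : HasDerivAt (fun z : ℂ => -z * (Real.cosh t : ℂ)) (-1 * (Real.cosh t : ℂ)) z :=
      ((hasDerivAt_id z).neg).mul_const _
    exact h1.cexp

/-- Smoothness of `K₀`, as the restriction to the real axis of a holomorphic function. -/
theorem contDiffAt_besselK0 {r : ℝ} (hr : 0 < r) : ContDiffAt ℝ ∞ besselK0 r := by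
  set K : ℂ → ℂ := fun z : ℂ => ∫ t in Ioi (0 : ℝ), Complex.exp (-z * (Real.cosh t : ℂ)) with hK
  have ho : IsOpen {z : ℂ | 0 < z.re} := isOpen_lt continuous_const Complex.continuous_re
  have hd : DifferentiableOn ℂ K {z : ℂ | 0 < z.re} := fun z hz =>
    (differentiableAt_bessel hz).differentiableWithinAt
  have hA : AnalyticAt ℂ K (r : ℂ) := hd.analyticAt (ho.mem_nhds (by simpa using hr))
  have h1 : ContDiffAt ℝ ∞ K (r : ℂ) := (hA.contDiffAt (n := ∞)).restrict_scalars ℝ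
  have h2 : ContDiffAt ℝ ∞ (fun s : ℝ => (K (s : ℂ)).re) r :=
    Complex.reCLM.contDiff.contDiffAt.comp r
      (h1.comp r (Complex.ofRealCLM.contDiff (n := ∞)).contDiffAt)
  refine h2.congr_of_eventuallyEq (Eventually.of_forall fun s => ?_)
  simp only [hK, besselK0]
  rw [← Complex.ofReal_re (∫ t in Ioi (0 : ℝ), Real.exp (-s * Real.cosh t)),
    ← integral_complex_ofReal]
  congr 2
  funext t
  push_cast
  rfl

theorem contDiffAt_greenFn {γ : ℝ} (hγ : 0 < γ) {z : Plane} (hz : z ≠ 0) :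
    ContDiffAt ℝ ∞ (greenFn γ) z := by
  have h1 : ContDiffAt ℝ ∞ (fun x : Plane => ‖x‖ / γ) z :=
    (contDiffAt_norm ℝ hz).div_const γ
  have h2 : ContDiffAt ℝ ∞ (fun x : Plane => besselK0 (‖x‖ / γ)) z :=
    ContDiffAt.comp (g := besselK0) z (contDiffAt_besselK0 (div_pos (norm_pos_iff.2 hz) hγ)) h1
  exact contDiffAt_const.mul h2

/-! ### Green's identity for the heat kernel -/

/-- The `i`-th partial derivative. -/
abbrev partialD (i : Fin 2) (u : Plane → ℂ) (x : Plane) : ℂ :=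
  fderiv ℝ u x (EuclideanSpace.single i 1)

/-- The `i`-th partial derivative of the heat kernel. -/
def dHeat (a t : ℝ) (i : Fin 2) (z : Plane) : ℝ := -(z i) / (2 * t) * heatK a t z

/-- The time derivative of the heat kernel, which also equals `Δ - a` applied to it. -/
def heatDot (a t : ℝ) (z : Plane) : ℝ := (‖z‖ ^ 2 / (4 * t ^ 2) - t⁻¹ - a) * heatK a t z

/-- The `i`-th partial derivative of the fundamental solution. -/
def dGreen (a : ℝ) (i : Fin 2) (z : Plane) : ℝ := -(z i) * greenSlope a z

theorem contDiff_heatK (a t : ℝ) : ContDiff ℝ ∞ (heatK a t) := by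
  unfold heatK
  exact contDiff_const.mul (((contDiff_norm_sq ℝ).div_const _).neg.exp)

theorem contDiff_coord (i : Fin 2) : ContDiff ℝ ∞ fun z : Plane => z i :=
  (EuclideanSpace.proj (𝕜 := ℝ) i).contDiff

theorem contDiff_dHeat (a t : ℝ) (i : Fin 2) : ContDiff ℝ ∞ (dHeat a t i) := by
  unfold dHeat
  exact ((contDiff_coord i).neg.div_const _).mul (contDiff_heatK a t)

theorem hasFDerivAt_heatK (a : ℝ) {t : ℝ} (ht : 0 < t) (z : Plane) :
    HasFDerivAt (heatK a t) ((-(heatK a t z / (2 * t))) • innerSL ℝ z) z := by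
  have h1 := (hasStrictFDerivAt_norm_sq z).hasFDerivAt
  have h2 := ((h1.mul_const (4 * t)⁻¹).neg).exp.const_mul (Real.exp (-(a * t)) * (4 * Real.pi * t)⁻¹)
  have h3 : HasFDerivAt (heatK a t) _ z := h2
  refine h3.congr_fderiv ?_
  ext w
  simp [heatK, div_eq_mul_inv]
  field_simp
  ring

theorem partial_dHeat (a : ℝ) {t : ℝ} (ht : 0 < t) (i : Fin 2) (z : Plane) :
    fderiv ℝ (dHeat a t i) z (EuclideanSpace.single i 1)
      = ((z i) ^ 2 / (4 * t ^ 2) - (2 * t)⁻¹) * heatK a t z := by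
  have h1 : HasFDerivAt (fun z : Plane => -(z i) / (2 * t))
      ((-(2 * t)⁻¹ : ℝ) • (EuclideanSpace.proj (𝕜 := ℝ) i : Plane →L[ℝ] ℝ)) z := by
    have := ((EuclideanSpace.proj (𝕜 := ℝ) i : Plane →L[ℝ] ℝ).hasFDerivAt (x := z)).const_mul
      (-(2 * t)⁻¹)
    refine this.congr_of_eventuallyEq (Eventually.of_forall fun x => ?_)
    simp [div_eq_mul_inv]
    ring
  have h2 : HasFDerivAt (dHeat a t i) _ z := h1.mul (hasFDerivAt_heatK a ht z)
  have h5 : inner ℝ z (EuclideanSpace.single i (1 : ℝ)) = z i := by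
    simp [EuclideanSpace.inner_single_right]
  rw [h2.fderiv]
  simp [h5]
  field_simp
  ring

theorem hasDerivAt_heatK (a : ℝ) {t : ℝ} (ht : 0 < t) (z : Plane) :
    HasDerivAt (fun t => heatK a t z) (heatDot a t z) t := by
  have h1 : HasDerivAt (fun t : ℝ => Real.exp (-(a * t))) (Real.exp (-(a * t)) * (-(a * 1))) t :=
    (((hasDerivAt_id t).const_mul a).neg).exp
  have h2 : HasDerivAt (fun t : ℝ => (4 * Real.pi * t)⁻¹)
      (-(4 * Real.pi * 1) / (4 * Real.pi * t) ^ 2) t :=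
    ((hasDerivAt_id t).const_mul (4 * Real.pi)).fun_inv (by simp only [id]; positivity)
  have h3 : HasDerivAt (fun t : ℝ => Real.exp (-(‖z‖ ^ 2 / (4 * t))))
      (Real.exp (-(‖z‖ ^ 2 / (4 * t))) * -((0 * (4 * t) - ‖z‖ ^ 2 * (4 * 1)) / (4 * t) ^ 2)) t :=
    (((hasDerivAt_const t (‖z‖ ^ 2)).fun_div ((hasDerivAt_id t).const_mul 4)
      (by simp only [id]; positivity)).neg).exp
  have h4 : HasDerivAt (fun t => heatK a t z) _ t := (h1.fun_mul h2).fun_mul h3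
  convert h4 using 1
  unfold heatDot heatK
  field_simp
  ring

/-- The divergence of `u ∇ q` for the heat kernel `q`. -/
theorem sum_partial_dHeat_mul (a : ℝ) {t : ℝ} (ht : 0 < t) {u : Plane → ℂ} (hu : ContDiff ℝ 1 u)
    (y x : Plane) :
    ∑ i, partialD i (fun x => (dHeat a t i (x - y) : ℂ) * u x) x
      = (∑ i, (dHeat a t i (x - y) : ℂ) * partialD i u x + (a * heatK a t (x - y) : ℝ) * u x)
        + (heatDot a t (x - y) : ℝ) * u x := by
  have h1 : ∀ i, HasFDerivAt (fun x => (dHeat a t i (x - y) : ℂ))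
      (Complex.ofRealCLM.comp (fderiv ℝ (dHeat a t i) (x - y))) x := by
    intro i
    have := (((contDiff_dHeat a t i).differentiable (by simp)) (x - y)).hasFDerivAt
    have h2 := this.comp x ((hasFDerivAt_id x).sub_const y)
    exact Complex.ofRealCLM.hasFDerivAt.comp x h2
  have h2 : ∀ i, partialD i (fun x => (dHeat a t i (x - y) : ℂ) * u x) x
      = (dHeat a t i (x - y) : ℂ) * partialD i u x
        + ((((x - y) i) ^ 2 / (4 * t ^ 2) - (2 * t)⁻¹) * heatK a t (x - y) : ℝ) * u x := by
    intro i
    have := (h1 i).fun_mul ((hu.differentiable (by simp)) x).hasFDerivAt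
    rw [partialD, this.fderiv, ← partial_dHeat a ht i]
    simp [partialD]
    ring
  simp only [h2, Fin.sum_univ_two, heatDot]
  rw [EuclideanSpace.norm_sq_eq]
  simp only [Fin.sum_univ_two, Real.norm_eq_abs, sq_abs]
  push_cast
  field_simp
  ring

/-- The density `∇ q · ∇ u + a q u` of the energy form, for the heat kernel `q` centred at `y`. -/
def heatEnergy (a t : ℝ) (u : Plane → ℂ) (y x : Plane) : ℂ :=
  ∑ i, (dHeat a t i (x - y) : ℂ) * partialD i u x + (a * heatK a t (x - y) : ℝ) * u x

/-- The density `∇ G · ∇ u + a G u` of the energy form, for the fundamental solution `G` centred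
at `y`. -/
def greenEnergy (a : ℝ) (u : Plane → ℂ) (y x : Plane) : ℂ :=
  ∑ i, (dGreen a i (x - y) : ℂ) * partialD i u x + (a * greenK a (x - y) : ℝ) * u x

/-- The boundary term `∫_Ω div (u ∇ q)`, for the heat kernel `q` centred at `y`. -/
def boundaryTerm (a : ℝ) (Ω : Set Plane) (u : Plane → ℂ) (y : Plane) (t : ℝ) : ℂ :=
  ∑ i, ∫ x in Ω, partialD i (fun x => (dHeat a t i (x - y) : ℂ) * u x) x

theorem measurable_dHeat (a : ℝ) (i : Fin 2) : Measurable fun q : ℝ × Plane => dHeat a q.1 i q.2 := by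
  unfold dHeat
  exact (((contDiff_coord i).continuous.measurable.comp measurable_snd).neg.div
    (measurable_fst.const_mul 2)).mul (measurable_heatK a)

theorem measurable_heatDot (a : ℝ) : Measurable fun q : ℝ × Plane => heatDot a q.1 q.2 := by
  unfold heatDot
  have := measurable_heatK a
  fun_prop

theorem continuous_partialD {u : Plane → ℂ} (hu : ContDiff ℝ 1 u) (i : Fin 2) :
    Continuous (partialD i u) :=
  (hu.continuous_fderiv (by simp)).clm_apply continuous_const

theorem exists_bound_of_compact {u : Plane → ℂ} (hu : ContDiff ℝ 1 u) (hc : HasCompactSupport u) :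
    ∃ M, 0 ≤ M ∧ (∀ x, ‖u x‖ ≤ M) ∧ ∀ i x, ‖partialD i u x‖ ≤ M := by
  obtain ⟨M0, h0⟩ := hu.continuous.bounded_above_of_compact_support hc
  obtain ⟨M1, h1⟩ := (continuous_partialD hu 0).bounded_above_of_compact_support
    (hc.fderiv_apply ℝ _)
  obtain ⟨M2, h2⟩ := (continuous_partialD hu 1).bounded_above_of_compact_support
    (hc.fderiv_apply ℝ _)
  refine ⟨max M0 (max M1 M2), (norm_nonneg _).trans ((h0 0).trans (le_max_left _ _)),
    fun x => (h0 x).trans (le_max_left _ _), fun i x => ?_⟩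
  fin_cases i
  · exact (h1 x).trans ((le_max_left _ _).trans (le_max_right _ _))
  · exact (h2 x).trans ((le_max_right _ _).trans (le_max_right _ _))

theorem measurable_heatEnergy (a : ℝ) {u : Plane → ℂ} (hu : ContDiff ℝ 1 u) (y : Plane) :
    Measurable fun q : Plane × ℝ => heatEnergy a q.2 u y q.1 := by
  have hsw : Measurable fun q : Plane × ℝ => (q.2, q.1 - y) :=
    measurable_snd.prodMk (measurable_fst.sub_const y)
  unfold heatEnergy
  refine Measurable.add ?_ ?_
  · refine Finset.measurable_sum _ fun i _ => ?_
    exact (Complex.measurable_ofReal.comp ((measurable_dHeat a i).comp hsw)).mul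
      ((continuous_partialD hu i).measurable.comp measurable_fst)
  · exact (Complex.measurable_ofReal.comp (((measurable_heatK a).comp hsw).const_mul a)).mul
      (hu.continuous.measurable.comp measurable_fst)

theorem abs_dHeat_le (a : ℝ) {t : ℝ} (ht : 0 < t) (i : Fin 2) (z : Plane) :
    |dHeat a t i z| ≤ ‖z‖ * (heatK a t z / (2 * t)) := by
  have h0 := heatK_nonneg a ht z
  unfold dHeat
  rw [abs_mul, abs_of_nonneg h0, abs_div, abs_neg, abs_of_pos (by positivity : 0 < 2 * t),
    mul_div_assoc', div_mul_eq_mul_div]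
  gcongr
  exact abs_coord_le_norm z i

theorem norm_heatEnergy_le {a : ℝ} (ha : 0 < a) {t : ℝ} (ht : 0 < t) {u : Plane → ℂ} {M : ℝ}
    (h0 : ∀ x, ‖u x‖ ≤ M) (h1 : ∀ i x, ‖partialD i u x‖ ≤ M) (y x : Plane) :
    ‖heatEnergy a t u y x‖ ≤ (2 * M * ‖x - y‖) * (heatK a t (x - y) / (2 * t))
      + (a * M) * heatK a t (x - y) := by
  have hq := heatK_nonneg a ht (x - y)
  have hb : ∀ i, ‖(dHeat a t i (x - y) : ℂ) * partialD i u x‖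
      ≤ ‖x - y‖ * (heatK a t (x - y) / (2 * t)) * M := by
    intro i
    rw [norm_mul, Complex.norm_real, Real.norm_eq_abs]
    have := abs_dHeat_le a ht i (x - y)
    have := h1 i x
    gcongr
  unfold heatEnergy
  refine (norm_add_le _ _).trans (add_le_add ?_ ?_)
  · rw [Fin.sum_univ_two]
    refine (norm_add_le _ _).trans ((add_le_add (hb 0) (hb 1)).trans (le_of_eq (by ring)))
  · rw [norm_mul, Complex.norm_real, Real.norm_eq_abs, abs_of_nonneg (by positivity)]
    have := h0 x
    calc a * heatK a t (x - y) * ‖u x‖ ≤ a * heatK a t (x - y) * M := by gcongr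
      _ = _ := by ring

theorem ae_ne (y : Plane) : ∀ᵐ x : Plane, x ≠ y := by
  simp [ae_iff]

theorem integrable_domK_sub (y : Plane) : Integrable fun x => domK (x - y) :=
  integrable_domK.comp_sub_right y

theorem integrable_heatEnergy_left {a : ℝ} (ha : 0 < a) {u : Plane → ℂ} (hu : ContDiff ℝ 1 u)
    (hc : HasCompactSupport u) {x y : Plane} (hxy : x ≠ y) :
    IntegrableOn (fun t => heatEnergy a t u y x) (Ioi 0) := by
  obtain ⟨M, hM, h0, h1⟩ := exists_bound_of_compact hu hc
  have hz : x - y ≠ 0 := sub_ne_zero.2 hxy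
  refine (((integrableOn_heatK_div ha hz).const_mul (2 * M * ‖x - y‖)).add
    ((integrableOn_heatK ha hz).const_mul (a * M))).mono' ?_ ?_
  · exact ((measurable_heatEnergy a hu y).comp
      (measurable_const.prodMk measurable_id)).aestronglyMeasurable
  · refine (ae_restrict_iff' measurableSet_Ioi).2 (Eventually.of_forall fun t ht => ?_)
    exact norm_heatEnergy_le ha ht h0 h1 y x

theorem integral_heatEnergy_left {a : ℝ} (ha : 0 < a) (u : Plane → ℂ) {x y : Plane}
    (hxy : x ≠ y) : ∫ t in Ioi (0 : ℝ), heatEnergy a t u y x = greenEnergy a u y x := by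
  have hz : x - y ≠ 0 := sub_ne_zero.2 hxy
  have i1 : ∀ i, IntegrableOn (fun t => dHeat a t i (x - y)) (Ioi 0) := by
    intro i
    refine ((integrableOn_heatK_div ha hz).const_mul (-((x - y) i))).congr
      (Eventually.of_forall fun t => ?_)
    simp only [dHeat]
    ring
  have e1 : ∀ i, ∫ t in Ioi (0 : ℝ), dHeat a t i (x - y) = dGreen a i (x - y) := by
    intro i
    rw [dGreen, greenSlope, ← integral_const_mul]
    congr 1
    funext t
    simp only [dHeat]
    ring
  have i2 : ∀ i, IntegrableOn (fun t => (dHeat a t i (x - y) : ℂ) * partialD i u x) (Ioi 0) :=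
    fun i => (i1 i).ofReal.mul_const _
  have i3 : IntegrableOn (fun t => ((a * heatK a t (x - y) : ℝ) : ℂ) * u x) (Ioi 0) :=
    ((integrableOn_heatK ha hz).const_mul a).ofReal.mul_const _
  unfold heatEnergy greenEnergy
  rw [integral_add (integrable_finsetSum _ fun i _ => i2 i) i3,
    integral_finsetSum _ fun i _ => i2 i]
  congr 1
  · refine Finset.sum_congr rfl fun i _ => ?_
    rw [integral_mul_const, integral_complex_ofReal, e1]
  · rw [integral_mul_const, integral_complex_ofReal, integral_const_mul, greenK]

theorem integrable_heatEnergy_prod {a : ℝ} (ha : 0 < a) {u : Plane → ℂ} (hu : ContDiff ℝ 1 u)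
    (hc : HasCompactSupport u) (y : Plane) (Ω : Set Plane) :
    Integrable (fun q : Plane × ℝ => heatEnergy a q.2 u y q.1)
      ((volume.restrict Ω).prod (volume.restrict (Ioi 0))) := by
  obtain ⟨M, hM, h0, h1⟩ := exists_bound_of_compact hu hc
  obtain ⟨C, hC, c1, c2⟩ := exists_kernel_bound ha
  have hmeas := measurable_heatEnergy a hu y
  refine (integrable_prod_iff hmeas.aestronglyMeasurable).2 ⟨?_, ?_⟩
  · filter_upwards [ae_restrict_of_ae (ae_ne y)] with x hx
    exact integrable_heatEnergy_left ha hu hc hx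
  · refine ((integrable_domK_sub y).const_mul ((2 * M + a * M) * C)).restrict.mono' ?_ ?_
    · exact (hmeas.norm.stronglyMeasurable.integral_prod_right
        (ν := volume.restrict (Ioi (0 : ℝ)))).aestronglyMeasurable
    · filter_upwards [ae_restrict_of_ae (ae_ne y)] with x hx
      have hz : x - y ≠ 0 := sub_ne_zero.2 hx
      rw [Real.norm_eq_abs, abs_of_nonneg (integral_nonneg fun _ => norm_nonneg _)]
      have i1 := (integrableOn_heatK_div ha hz).const_mul (2 * M * ‖x - y‖)
      have i2 := (integrableOn_heatK ha hz).const_mul (a * M)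
      calc ∫ t in Ioi (0 : ℝ), ‖heatEnergy a t u y x‖
          ≤ ∫ t in Ioi (0 : ℝ), ((2 * M * ‖x - y‖) * (heatK a t (x - y) / (2 * t))
            + (a * M) * heatK a t (x - y)) :=
            setIntegral_mono_on (integrable_heatEnergy_left ha hu hc hx).norm (i1.add i2)
              measurableSet_Ioi fun t ht => norm_heatEnergy_le ha ht h0 h1 y x
        _ = 2 * M * (‖x - y‖ * greenSlope a (x - y)) + a * M * greenK a (x - y) := by
            rw [integral_add i1 i2, integral_const_mul, integral_const_mul, greenSlope, greenK]
            ring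
        _ ≤ 2 * M * (C * domK (x - y)) + a * M * (C * domK (x - y)) := by
            have := c1 (x - y)
            have := c2 (x - y)
            gcongr
        _ = _ := by ring

theorem integral_greenEnergy {a : ℝ} (ha : 0 < a) {u : Plane → ℂ} (hu : ContDiff ℝ 1 u)
    (hc : HasCompactSupport u) (y : Plane) (Ω : Set Plane) :
    IntegrableOn (fun t => ∫ x in Ω, heatEnergy a t u y x) (Ioi 0) ∧
      ∫ t in Ioi (0 : ℝ), ∫ x in Ω, heatEnergy a t u y x = ∫ x in Ω, greenEnergy a u y x := by
  have h := integrable_heatEnergy_prod ha hu hc y Ω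
  refine ⟨h.integral_prod_right, ?_⟩
  rw [← integral_integral_swap h]
  refine integral_congr_ae ?_
  filter_upwards [ae_restrict_of_ae (ae_ne y)] with x hx
  exact integral_heatEnergy_left ha u hx

theorem integral_gaussian_plane :
    ∫ z : Plane, Real.exp (-(1 / 4) * ‖z‖ ^ 2) * (4 * Real.pi)⁻¹ = 1 := by
  rw [integral_mul_const, GaussianFourier.integral_rexp_neg_mul_sq_norm (by norm_num)]
  have : (Module.finrank ℝ Plane : ℝ) / 2 = 1 := by simp
  rw [this, Real.rpow_one]
  field_simp

theorem heatK_sub_comm (a t : ℝ) (x y : Plane) : heatK a t (x - y) = heatK a t (y - x) := by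
  unfold heatK; rw [norm_sub_rev]

/-- The heat kernel is an approximate identity as the time tends to zero. -/
theorem tendsto_integral_heatK (a : ℝ) {E : Type*} [NormedAddCommGroup E] [NormedSpace ℝ E]
    [CompleteSpace E] {g : Plane → E} (hg : Continuous g)
    (hc : HasCompactSupport g) (y : Plane) :
    Tendsto (fun ε : ℝ => ∫ x, heatK a ε (x - y) • g x) (𝓝[>] 0) (𝓝 (g y)) := by
  set φ : Plane → ℝ := fun z => Real.exp (-(1 / 4) * ‖z‖ ^ 2) * (4 * Real.pi)⁻¹ with hφ
  have hdim : Module.finrank ℝ Plane = 2 := by simp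
  have hdecay : Tendsto (fun x : Plane => ‖x‖ ^ Module.finrank ℝ Plane * φ x)
      (Bornology.cobounded Plane) (𝓝 0) := by
    rw [hdim]
    have h1 : Tendsto (fun r : ℝ => (r ^ 2) * Real.exp (-(1 / 4) * r ^ 2) * (4 * Real.pi)⁻¹) atTop
        (𝓝 0) := by
      have h2 : Tendsto (fun s : ℝ => s ^ (1 : ℝ) * Real.exp (-(1 / 4) * s)) atTop (𝓝 0) :=
        tendsto_rpow_mul_exp_neg_mul_atTop_nhds_zero 1 (1 / 4) (by norm_num)
      have h3 := (h2.comp (tendsto_pow_atTop (α := ℝ) two_ne_zero)).mul_const (4 * Real.pi)⁻¹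
      simpa [Function.comp_def] using h3
    refine (h1.comp tendsto_norm_cobounded_atTop).congr fun x => ?_
    simp only [Function.comp, hφ]
    ring
  have key := tendsto_integral_comp_smul_smul_of_integrable' (μ := (volume : Measure Plane))
    (φ := φ) (fun x => by positivity) integral_gaussian_plane hdecay
    (hg.integrable_of_hasCompactSupport hc) hg.continuousAt (x₀ := y)
  have hc1 : Tendsto (fun ε : ℝ => ε ^ (-(1 / 2) : ℝ)) (𝓝[>] 0) atTop :=
    tendsto_rpow_neg_nhdsGT_zero (by norm_num)
  have hexp : Tendsto (fun ε : ℝ => Real.exp (-(a * ε))) (𝓝[>] 0) (𝓝 1) := by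
    have : Tendsto (fun ε : ℝ => Real.exp (-(a * ε))) (𝓝 0) (𝓝 (Real.exp (-(a * 0)))) :=
      Continuous.tendsto (by fun_prop) 0
    rw [mul_zero, neg_zero, Real.exp_zero] at this
    exact this.mono_left nhdsWithin_le_nhds
  have := hexp.smul (key.comp hc1)
  rw [one_smul] at this
  refine this.congr' ?_
  filter_upwards [self_mem_nhdsWithin] with ε hε
  have hε0 : (0 : ℝ) < ε := hε
  simp only [Function.comp]
  rw [← integral_smul]
  congr 1
  funext x
  rw [smul_smul]
  congr 1
  rw [heatK_sub_comm, heatK, hφ, hdim]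
  simp only [norm_smul, Real.norm_eq_abs]
  have e1 : (ε ^ (-(1 / 2) : ℝ)) ^ 2 = ε⁻¹ := by
    rw [← Real.rpow_natCast, ← Real.rpow_mul hε0.le, ← Real.rpow_neg_one]; norm_num
  rw [mul_pow, sq_abs, e1]
  have e2 : -(1 / 4) * (ε⁻¹ * ‖y - x‖ ^ 2) = -(‖y - x‖ ^ 2 / (4 * ε)) := by field_simp
  rw [e2]
  field_simp

theorem abs_heatDot_le {a : ℝ} (ha : 0 < a) {ε t : ℝ} (hε : 0 < ε) (ht : ε < t) (z : Plane) :
    |heatDot a t z| ≤ ((2 * ε⁻¹ + a) * ε⁻¹) * Real.exp (-a * t) := by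
  have ht0 : 0 < t := hε.trans ht
  have hti : t⁻¹ ≤ ε⁻¹ := inv_anti₀ hε ht.le
  set s := ‖z‖ ^ 2 / (4 * t) with hs
  have hs0 : 0 ≤ s := by positivity
  have h1 : s * Real.exp (-s) ≤ 1 := by
    rw [Real.exp_neg, ← div_eq_mul_inv, div_le_one (Real.exp_pos _)]
    linarith [Real.add_one_le_exp s]
  have h2 : Real.exp (-s) ≤ 1 := Real.exp_le_one_iff.2 (by linarith)
  have h3 : (4 * Real.pi * t)⁻¹ ≤ t⁻¹ := inv_anti₀ ht0 (by nlinarith [Real.pi_gt_three])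
  have e : heatDot a t z = (t⁻¹ * (s * Real.exp (-s)) - t⁻¹ * Real.exp (-s) - a * Real.exp (-s))
      * (4 * Real.pi * t)⁻¹ * Real.exp (-a * t) := by
    unfold heatDot heatK
    rw [← hs, neg_mul]
    have : ‖z‖ ^ 2 / (4 * t ^ 2) = t⁻¹ * s := by rw [hs]; field_simp
    rw [this]
    ring
  rw [e, abs_mul, abs_mul, abs_of_pos (Real.exp_pos _), abs_of_pos (by positivity : 0 < (4 * Real.pi * t)⁻¹)]
  have h4 : |t⁻¹ * (s * Real.exp (-s)) - t⁻¹ * Real.exp (-s) - a * Real.exp (-s)|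
      ≤ 2 * ε⁻¹ + a := by
    have p1 : 0 ≤ s * Real.exp (-s) := by positivity
    have p2 := (Real.exp_pos (-s)).le
    have p3 : 0 < t⁻¹ := by positivity
    have q1 : t⁻¹ * (s * Real.exp (-s)) ≤ ε⁻¹ := by nlinarith
    have q2 : t⁻¹ * Real.exp (-s) ≤ ε⁻¹ := by nlinarith
    have q3 : a * Real.exp (-s) ≤ a := by nlinarith
    have q4 : 0 ≤ t⁻¹ * (s * Real.exp (-s)) := by positivity
    have q5 : 0 ≤ t⁻¹ * Real.exp (-s) := by positivity
    have q6 : 0 ≤ a * Real.exp (-s) := by positivity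
    rw [abs_le]
    constructor <;> linarith
  have h5 := h3.trans hti
  gcongr

theorem integral_heatDot {a : ℝ} (ha : 0 < a) {ε : ℝ} (hε : 0 < ε) (z : Plane) :
    ∫ t in Ioi ε, heatDot a t z = - heatK a ε z := by
  have hi : IntegrableOn (fun t => heatDot a t z) (Ioi ε) := by
    refine (((integrableOn_exp_neg ha).mono_set (Ioi_subset_Ioi hε.le)).const_mul
      ((2 * ε⁻¹ + a) * ε⁻¹)).mono' ?_ ?_
    · exact ((measurable_heatDot a).comp (measurable_id.prodMk measurable_const)).aestronglyMeasurable
    · exact (ae_restrict_iff' measurableSet_Ioi).2 (Eventually.of_forall fun t ht =>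
        abs_heatDot_le ha hε ht z)
  have hlim : Tendsto (fun t => heatK a t z) atTop (𝓝 0) := by
    have h1 : Tendsto (fun t : ℝ => t⁻¹) atTop (𝓝 0) := tendsto_inv_atTop_zero
    refine squeeze_zero' ?_ ?_ h1
    · filter_upwards [Ioi_mem_atTop 0] with t ht using heatK_nonneg a ht z
    · filter_upwards [Ioi_mem_atTop 0] with t ht
      have ht0 : (0 : ℝ) < t := ht
      have h2 : Real.exp (-(a * t)) ≤ 1 := Real.exp_le_one_iff.2 (by nlinarith)
      have h3 : Real.exp (-(‖z‖ ^ 2 / (4 * t))) ≤ 1 :=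
        Real.exp_le_one_iff.2 (by have : 0 ≤ ‖z‖ ^ 2 / (4 * t) := by positivity
                                  linarith)
      have h4 : (4 * Real.pi * t)⁻¹ ≤ t⁻¹ := inv_anti₀ ht0 (by nlinarith [Real.pi_gt_three])
      unfold heatK
      calc _ ≤ 1 * t⁻¹ * 1 := by gcongr
        _ = t⁻¹ := by ring
  rw [integral_Ioi_of_hasDerivAt_of_tendsto' (f := fun t => heatK a t z)
    (fun t ht => hasDerivAt_heatK a (hε.trans_le ht) z) hi hlim]
  simp

theorem integrable_heatDot_prod {a : ℝ} (ha : 0 < a) {u : Plane → ℂ} (hu : Continuous u)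
    (hc : HasCompactSupport u) (y : Plane) (Ω : Set Plane) {ε : ℝ} (hε : 0 < ε) :
    Integrable (fun q : Plane × ℝ => ((heatDot a q.2 (q.1 - y) : ℝ) : ℂ) * u q.1)
      ((volume.restrict Ω).prod (volume.restrict (Ioi ε))) := by
  have h1 : Integrable (fun q : Plane × ℝ => u q.1
      * ((((2 * ε⁻¹ + a) * ε⁻¹) * Real.exp (-a * q.2) : ℝ) : ℂ))
      ((volume.restrict Ω).prod (volume.restrict (Ioi ε))) :=
    Integrable.mul_prod (f := u) (g := fun t => ((((2 * ε⁻¹ + a) * ε⁻¹) * Real.exp (-a * t) : ℝ) : ℂ))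
      (hu.integrable_of_hasCompactSupport hc).restrict
      (((integrableOn_exp_neg ha).mono_set (Ioi_subset_Ioi hε.le)).const_mul _).ofReal
  have hsw : Measurable fun q : Plane × ℝ => (q.2, q.1 - y) :=
    measurable_snd.prodMk (measurable_fst.sub_const y)
  refine h1.mono ((Complex.measurable_ofReal.comp ((measurable_heatDot a).comp hsw)).mul
    (hu.measurable.comp measurable_fst)).aestronglyMeasurable ?_
  have hae : ∀ᵐ q ∂((volume.restrict Ω).prod (volume.restrict (Ioi ε))), q.2 ∈ Ioi ε :=
    Measure.quasiMeasurePreserving_snd.ae (ae_restrict_mem measurableSet_Ioi)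
  filter_upwards [hae] with q hq
  rw [norm_mul, norm_mul, mul_comm]
  gcongr
  rw [Complex.norm_real, Complex.norm_real]
  exact (abs_heatDot_le ha hε hq _).trans (le_abs_self _)

theorem boundaryTerm_eq {a : ℝ} {u : Plane → ℂ} (hu : ContDiff ℝ 1 u)
    (hc : HasCompactSupport u) (y : Plane) (Ω : Set Plane) {t : ℝ} (ht : 0 < t) :
    boundaryTerm a Ω u y t = ∫ x in Ω, (heatEnergy a t u y x
      + ((heatDot a t (x - y) : ℝ) : ℂ) * u x) := by
  unfold boundaryTerm
  rw [← integral_finsetSum]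
  · congr 1
    funext x
    exact sum_partial_dHeat_mul a ht hu y x
  · intro i _
    have hs : ContDiff ℝ 1 fun x => (dHeat a t i (x - y) : ℂ) * u x := by
      refine ContDiff.mul ?_ hu
      exact Complex.ofRealCLM.contDiff.comp (((contDiff_dHeat a t i).of_le (by simp)).comp
        (contDiff_id.sub contDiff_const))
    exact ((continuous_partialD hs i).integrable_of_hasCompactSupport
      ((hc.mul_left).fderiv_apply ℝ _)).integrableOn

/-- Green's representation: the energy form of the fundamental solution is the limit of the
boundary terms integrated over time and of the heat semigroup acting on `u`. -/
theorem tendsto_boundaryTerm {a : ℝ} (ha : 0 < a) {u : Plane → ℂ} (hu : ContDiff ℝ 1 u)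
    (hc : HasCompactSupport u) (y : Plane) (Ω : Set Plane) :
    Tendsto (fun ε => (∫ t in Ioi ε, boundaryTerm a Ω u y t)
      + ∫ x in Ω, ((heatK a ε (x - y) : ℝ) : ℂ) * u x) (𝓝[>] 0)
      (𝓝 (∫ x in Ω, greenEnergy a u y x)) := by
  obtain ⟨hi, he⟩ := integral_greenEnergy ha hu hc y Ω
  have hlim : Tendsto (fun ε => ∫ t in Ioi ε, ∫ x in Ω, heatEnergy a t u y x) (𝓝[>] 0)
      (𝓝 (∫ x in Ω, greenEnergy a u y x)) := by
    rw [← he]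
    have hcov : AECover (volume.restrict (Ioi (0 : ℝ))) (𝓝[>] (0 : ℝ)) fun ε => Ioi ε :=
      aecover_Ioi_of_Ioi (tendsto_id.mono_left nhdsWithin_le_nhds)
    have := hcov.integral_tendsto_of_countably_generated hi
    refine this.congr' ?_
    filter_upwards [self_mem_nhdsWithin] with ε hε
    rw [Measure.restrict_restrict measurableSet_Ioi,
      inter_eq_left.2 (Ioi_subset_Ioi (le_of_lt hε))]
  refine hlim.congr' ?_
  filter_upwards [self_mem_nhdsWithin] with ε hε
  have hε0 : (0 : ℝ) < ε := hε
  have hp := integrable_heatDot_prod ha hu.continuous hc y Ω hε0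
  have hE := integrable_heatEnergy_prod ha hu hc y Ω
  have h1 : ∫ t in Ioi ε, boundaryTerm a Ω u y t
      = (∫ t in Ioi ε, ∫ x in Ω, heatEnergy a t u y x)
        + ∫ t in Ioi ε, ∫ x in Ω, ((heatDot a t (x - y) : ℝ) : ℂ) * u x := by
    rw [← integral_add (hi.mono_set (Ioi_subset_Ioi hε0.le)) hp.integral_prod_right]
    have ae1 : ∀ᵐ t ∂(volume.restrict (Ioi ε)),
        Integrable (fun x => heatEnergy a t u y x) (volume.restrict Ω) := by
      have := hE.prod_left_ae
      exact ae_restrict_of_ae_restrict_of_subset (Ioi_subset_Ioi hε0.le) this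
    have ae2 := hp.prod_left_ae
    refine integral_congr_ae ?_
    filter_upwards [ae1, ae2, ae_restrict_mem measurableSet_Ioi] with t h1 h2 ht
    rw [boundaryTerm_eq hu hc y Ω (hε0.trans ht)]
    exact integral_add h1 h2
  have h2 : ∫ t in Ioi ε, ∫ x in Ω, ((heatDot a t (x - y) : ℝ) : ℂ) * u x
      = - ∫ x in Ω, ((heatK a ε (x - y) : ℝ) : ℂ) * u x := by
    rw [← integral_integral_swap hp, ← integral_neg]
    congr 1
    funext x
    rw [integral_mul_const, integral_complex_ofReal, integral_heatDot ha hε0]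
    simp
  rw [h1, h2]
  ring

/-- Green's representation in the whole plane, where there is no boundary. -/
theorem integral_greenEnergy_univ {a : ℝ} (ha : 0 < a) {u : Plane → ℂ} (hu : ContDiff ℝ 1 u)
    (hc : HasCompactSupport u) (y : Plane) : ∫ x, greenEnergy a u y x = u y := by
  have h1 := tendsto_boundaryTerm ha hu hc y univ
  have h2 := tendsto_integral_heatK a hu.continuous hc y
  simp only [Measure.restrict_univ] at h1
  refine tendsto_nhds_unique h1 (h2.congr' ?_)
  filter_upwards [self_mem_nhdsWithin] with ε hε
  have hb : ∀ t, boundaryTerm a univ u y t = 0 := by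
    intro t
    unfold boundaryTerm
    simp only [Measure.restrict_univ]
    refine Finset.sum_eq_zero fun i _ => ?_
    have hs : ContDiff ℝ 1 fun x => (dHeat a t i (x - y) : ℂ) * u x := by
      refine ContDiff.mul ?_ hu
      exact Complex.ofRealCLM.contDiff.comp (((contDiff_dHeat a t i).of_le (by simp)).comp
        (contDiff_id.sub contDiff_const))
    exact integral_fderiv_eq_zero hs hc.mul_left _
  simp only [hb, integral_zero, zero_add]
  rfl

/-! ### The potential of a measure -/

/-- The potential of the measure `ν`. -/
def potential (a : ℝ) (ν : Measure Plane) (x : Plane) : ℝ := ∫ y, greenK a (x - y) ∂ν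

/-- The `i`-th partial derivative of the potential of `ν`. -/
def dPotential (a : ℝ) (ν : Measure Plane) (i : Fin 2) (x : Plane) : ℝ :=
  ∫ y, dGreen a i (x - y) ∂ν

/-- The gradient of the potential of `ν`. -/
def gradPotential (a : ℝ) (ν : Measure Plane) (x : Plane) : EuclideanSpace ℂ (Fin 2) :=
  WithLp.toLp 2 fun i => (dPotential a ν i x : ℂ)

/-- `ν` has a bounded Riesz potential of order `1 / 2`; this holds for bounded densities on a
curve. -/
def HasBoundedRiesz (ν : Measure Plane) : Prop :=
  ∃ K : ℝ≥0∞, K < ⊤ ∧ ∀ x, ∫⁻ y, ENNReal.ofReal (‖x - y‖ ^ (-(1 / 2) : ℝ)) ∂ν ≤ K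

theorem measurable_greenK (a : ℝ) : Measurable (greenK a) := by
  have : StronglyMeasurable fun z : Plane => ∫ t in Ioi (0 : ℝ), heatK a t z :=
    ((measurable_heatK a).comp measurable_swap).stronglyMeasurable.integral_prod_right'
  exact this.measurable

theorem measurable_greenSlope (a : ℝ) : Measurable (greenSlope a) := by
  have h : Measurable fun q : Plane × ℝ => heatK a q.2 q.1 / (2 * q.2) :=
    ((measurable_heatK a).comp measurable_swap).div (measurable_snd.const_mul 2)
  have : StronglyMeasurable fun z : Plane => ∫ t in Ioi (0 : ℝ), heatK a t z / (2 * t) :=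
    h.stronglyMeasurable.integral_prod_right'
  exact this.measurable

theorem measurable_dGreen (a : ℝ) (i : Fin 2) : Measurable (dGreen a i) := by
  unfold dGreen
  exact (contDiff_coord i).continuous.measurable.neg.mul (measurable_greenSlope a)

theorem abs_dGreen_le (a : ℝ) (i : Fin 2) (z : Plane) : |dGreen a i z| ≤ ‖z‖ * greenSlope a z := by
  unfold dGreen
  rw [abs_mul, abs_neg, abs_of_nonneg (greenSlope_nonneg a z)]
  exact mul_le_mul_of_nonneg_right (abs_coord_le_norm z i) (greenSlope_nonneg a z)

theorem measurable_sub_prod : Measurable fun q : Plane × Plane => q.1 - q.2 :=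
  measurable_fst.sub measurable_snd

theorem integrable_domK_prod (ν : Measure Plane) [IsFiniteMeasure ν] :
    Integrable (fun q : Plane × Plane => domK (q.1 - q.2)) ((volume : Measure Plane).prod ν) := by
  refine (integrable_prod_iff' (measurable_domK.comp measurable_sub_prod).aestronglyMeasurable).2
    ⟨Eventually.of_forall fun y => integrable_domK_sub y, ?_⟩
  have : ∀ y : Plane, ∫ x, ‖domK (x - y)‖ = ∫ x, ‖domK x‖ := fun y =>
    integral_sub_right_eq_self (fun x => ‖domK x‖) y
  simp only [Function.comp, this]
  exact integrable_const _

theorem ae_integrable_domK (ν : Measure Plane) [IsFiniteMeasure ν] :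
    ∀ᵐ x : Plane, Integrable (fun y => domK (x - y)) ν :=
  (integrable_domK_prod ν).prod_right_ae

/-- Convolution of a measure with bounded Riesz potential with a kernel dominated by `domK` is
square integrable: by the Cauchy-Schwarz inequality, with the weight `‖x - y‖ ^ (1 / 2)`. -/
theorem memLp_convolution {ν : Measure Plane} [IsFiniteMeasure ν] (hν : HasBoundedRiesz ν)
    {k : Plane → ℝ} (hk : Measurable k) {C : ℝ} (hC : 0 ≤ C) (hkC : ∀ z, |k z| ≤ C * domK z) :
    MemLp (fun x => ∫ y, k (x - y) ∂ν) 2 volume := by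
  obtain ⟨K, hK, hKb⟩ := hν
  have hmeas : StronglyMeasurable fun x : Plane => ∫ y, k (x - y) ∂ν :=
    (hk.comp measurable_sub_prod).stronglyMeasurable.integral_prod_right'
  refine ⟨hmeas.aestronglyMeasurable, ?_⟩
  set w : Plane → ℝ≥0∞ := fun z => ENNReal.ofReal (C ^ 2 * (domK z ^ 2 * ‖z‖ ^ (1 / 2 : ℝ)))
    with hw
  have hwm : Measurable w := by
    have := measurable_domK
    fun_prop
  have hwfin : ∫⁻ z, w z < ⊤ := by
    have := (integrable_domK_sq_weight.const_mul (C ^ 2)).lintegral_lt_top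
    exact this
  -- the factors to which the Cauchy-Schwarz inequality is applied
  have hpt : ∀ z, ‖k z‖ₑ ≤ ENNReal.ofReal (‖z‖ ^ (-(1 / 4) : ℝ))
      * ENNReal.ofReal (C * domK z * ‖z‖ ^ (1 / 4 : ℝ)) := by
    intro z
    rw [← ENNReal.ofReal_mul (by positivity), ← ofReal_norm]
    apply ENNReal.ofReal_le_ofReal
    refine (hkC z).trans ?_
    by_cases hz : z = 0
    · simp [hz, domK]
    · have hn : 0 < ‖z‖ := norm_pos_iff.2 hz
      have : ‖z‖ ^ (-(1 / 4) : ℝ) * ‖z‖ ^ (1 / 4 : ℝ) = 1 := by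
        rw [← Real.rpow_add hn]; norm_num
      calc C * domK z = C * domK z * (‖z‖ ^ (-(1 / 4) : ℝ) * ‖z‖ ^ (1 / 4 : ℝ)) := by
            rw [this, mul_one]
        _ ≤ _ := le_of_eq (by ring)
  have hcs : ∀ x, ‖∫ y, k (x - y) ∂ν‖ₑ ^ 2 ≤ K * ∫⁻ y, w (x - y) ∂ν := by
    intro x
    have hs : Measurable fun y : Plane => x - y := measurable_const.sub measurable_id
    have h1 := ENNReal.lintegral_mul_le_Lp_mul_Lq ν Real.HolderConjugate.two_two
      (f := fun y => ENNReal.ofReal (‖x - y‖ ^ (-(1 / 4) : ℝ)))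
      (g := fun y => ENNReal.ofReal (C * domK (x - y) * ‖x - y‖ ^ (1 / 4 : ℝ)))
      (by fun_prop) (by have := measurable_domK.comp hs; fun_prop)
    have h2 : ‖∫ y, k (x - y) ∂ν‖ₑ ≤ _ :=
      (enorm_integral_le_lintegral_enorm _).trans ((lintegral_mono fun y => hpt (x - y)).trans h1)
    have e1 : ∀ y, (ENNReal.ofReal (‖x - y‖ ^ (-(1 / 4) : ℝ))) ^ (2 : ℝ)
        = ENNReal.ofReal (‖x - y‖ ^ (-(1 / 2) : ℝ)) := by
      intro y
      rw [ENNReal.ofReal_rpow_of_nonneg (by positivity) (by norm_num), ← Real.rpow_mul (norm_nonneg _)]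
      norm_num
    have e2 : ∀ y, (ENNReal.ofReal (C * domK (x - y) * ‖x - y‖ ^ (1 / 4 : ℝ))) ^ (2 : ℝ)
        = w (x - y) := by
      intro y
      have := domK_nonneg (x - y)
      rw [ENNReal.ofReal_rpow_of_nonneg (by positivity) (by norm_num), hw]
      congr 1
      rw [Real.mul_rpow (by positivity) (by positivity), ← Real.rpow_mul (norm_nonneg _),
        Real.rpow_two]
      norm_num
      ring
    simp only [e1, e2] at h2
    calc ‖∫ y, k (x - y) ∂ν‖ₑ ^ 2
        ≤ ((∫⁻ y, ENNReal.ofReal (‖x - y‖ ^ (-(1 / 2) : ℝ)) ∂ν) ^ (1 / 2 : ℝ)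
          * (∫⁻ y, w (x - y) ∂ν) ^ (1 / 2 : ℝ)) ^ 2 := by gcongr
      _ = (∫⁻ y, ENNReal.ofReal (‖x - y‖ ^ (-(1 / 2) : ℝ)) ∂ν) * ∫⁻ y, w (x - y) ∂ν := by
          rw [mul_pow, ← ENNReal.rpow_natCast, ← ENNReal.rpow_natCast, ← ENNReal.rpow_mul,
            ← ENNReal.rpow_mul]
          norm_num
      _ ≤ _ := by gcongr; exact hKb x
  rw [eLpNorm_lt_top_iff_lintegral_rpow_enorm_lt_top (by norm_num) (by norm_num)]
  have hfin : ∫⁻ x, K * ∫⁻ y, w (x - y) ∂ν < ⊤ := by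
    rw [lintegral_const_mul' _ _ hK.ne, lintegral_lintegral_swap
      (f := fun x y => w (x - y)) (hwm.comp measurable_sub_prod).aemeasurable]
    have : ∀ y : Plane, ∫⁻ x, w (x - y) = ∫⁻ x, w x := fun y => lintegral_sub_right_eq_self w y
    simp only [this, lintegral_const]
    exact ENNReal.mul_lt_top hK (ENNReal.mul_lt_top hwfin (measure_lt_top ν _))
  refine lt_of_le_of_lt (lintegral_mono fun x => ?_) hfin
  have := hcs x
  simpa using this

theorem memLp_potential {a : ℝ} (ha : 0 < a) {ν : Measure Plane} [IsFiniteMeasure ν]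
    (hν : HasBoundedRiesz ν) : MemLp (fun x => (potential a ν x : ℂ)) 2 volume := by
  obtain ⟨C, hC, c1, c2⟩ := exists_kernel_bound ha
  exact (memLp_convolution hν (measurable_greenK a) hC
    fun z => (abs_of_nonneg (greenK_nonneg a z)).le.trans (c1 z)).ofReal

theorem memLp_gradPotential {a : ℝ} (ha : 0 < a) {ν : Measure Plane} [IsFiniteMeasure ν]
    (hν : HasBoundedRiesz ν) : MemLp (gradPotential a ν) 2 volume := by
  obtain ⟨C, hC, c1, c2⟩ := exists_kernel_bound ha
  have h : ∀ i, MemLp (fun x => (dPotential a ν i x : ℂ)) 2 volume := fun i =>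
    (memLp_convolution hν (measurable_dGreen a i) hC
      fun z => (abs_dGreen_le a i z).trans (c2 z)).ofReal
  have h2 : MemLp (fun x => (fun i => (dPotential a ν i x : ℂ) : Fin 2 → ℂ)) 2 volume :=
    memLp_pi_iff.2 h
  exact (PiLp.continuousLinearEquiv 2 ℂ (fun _ : Fin 2 => ℂ)).symm.toContinuousLinearMap.comp_memLp'
    h2

theorem norm_greenEnergy_le {a : ℝ} (ha : 0 < a) {C : ℝ}
    (c1 : ∀ z, greenK a z ≤ C * domK z) (c2 : ∀ z, ‖z‖ * greenSlope a z ≤ C * domK z)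
    {u : Plane → ℂ} {M : ℝ} (h0 : ∀ x, ‖u x‖ ≤ M) (h1 : ∀ i x, ‖partialD i u x‖ ≤ M)
    (y x : Plane) : ‖greenEnergy a u y x‖ ≤ ((2 + a) * M * C) * domK (x - y) := by
  have hM : 0 ≤ M := (norm_nonneg _).trans (h0 0)
  have g0 := greenK_nonneg a (x - y)
  have g1 := greenSlope_nonneg a (x - y)
  have hb : ∀ i, ‖(dGreen a i (x - y) : ℂ) * partialD i u x‖ ≤ C * domK (x - y) * M := by
    intro i
    rw [norm_mul, Complex.norm_real, Real.norm_eq_abs]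
    have e1 := (abs_dGreen_le a i (x - y)).trans (c2 (x - y))
    have e2 := h1 i x
    have e3 : 0 ≤ C * domK (x - y) := (abs_nonneg _).trans e1
    gcongr
  unfold greenEnergy
  rw [Fin.sum_univ_two]
  refine (norm_add_le _ _).trans ((add_le_add ((norm_add_le _ _).trans
    (add_le_add (hb 0) (hb 1))) (b := _) (d := a * (C * domK (x - y)) * M) ?_).trans
    (le_of_eq (by ring)))
  rw [norm_mul, Complex.norm_real, Real.norm_eq_abs, abs_of_nonneg (by positivity)]
  have e1 := c1 (x - y)
  have e2 := h0 x
  have e3 : 0 ≤ C * domK (x - y) := g0.trans e1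
  gcongr

theorem measurable_greenEnergy (a : ℝ) {u : Plane → ℂ} (hu : ContDiff ℝ 1 u) :
    Measurable fun q : Plane × Plane => greenEnergy a u q.2 q.1 := by
  unfold greenEnergy
  refine Measurable.add (Finset.measurable_sum _ fun i _ => ?_) ?_
  · exact (Complex.measurable_ofReal.comp ((measurable_dGreen a i).comp measurable_sub_prod)).mul
      ((continuous_partialD hu i).measurable.comp measurable_fst)
  · exact (Complex.measurable_ofReal.comp
      (((measurable_greenK a).comp measurable_sub_prod).const_mul a)).mul
      (hu.continuous.measurable.comp measurable_fst)

theorem integrable_greenEnergy_prod {a : ℝ} (ha : 0 < a) (ν : Measure Plane) [IsFiniteMeasure ν]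
    {u : Plane → ℂ} (hu : ContDiff ℝ 1 u) (hc : HasCompactSupport u) (Ω : Set Plane) :
    Integrable (fun q : Plane × Plane => greenEnergy a u q.2 q.1)
      ((volume.restrict Ω).prod ν) := by
  obtain ⟨C, hC, c1, c2⟩ := exists_kernel_bound ha
  obtain ⟨M, hM, h0, h1⟩ := exists_bound_of_compact hu hc
  have h : Integrable (fun q : Plane × Plane => greenEnergy a u q.2 q.1)
      ((volume : Measure Plane).prod ν) :=
    ((integrable_domK_prod ν).const_mul ((2 + a) * M * C)).mono'
      (measurable_greenEnergy a hu).aestronglyMeasurable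
      (Eventually.of_forall fun q => norm_greenEnergy_le ha c1 c2 h0 h1 q.2 q.1)
  refine h.mono_measure ?_
  exact Measure.prod_mono Measure.restrict_le_self le_rfl

theorem ae_integrable_kernels {a : ℝ} (ha : 0 < a) (ν : Measure Plane) [IsFiniteMeasure ν] :
    ∀ᵐ x : Plane, Integrable (fun y => greenK a (x - y)) ν ∧
      ∀ i, Integrable (fun y => dGreen a i (x - y)) ν := by
  obtain ⟨C, hC, c1, c2⟩ := exists_kernel_bound ha
  filter_upwards [ae_integrable_domK ν] with x hx
  have hs : Measurable fun y : Plane => x - y := measurable_const.sub measurable_id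
  refine ⟨(hx.const_mul C).mono' ((measurable_greenK a).comp hs).aestronglyMeasurable
    (Eventually.of_forall fun y => ?_), fun i => (hx.const_mul C).mono'
    ((measurable_dGreen a i).comp hs).aestronglyMeasurable (Eventually.of_forall fun y => ?_)⟩
  · rw [Real.norm_eq_abs, abs_of_nonneg (greenK_nonneg a _)]
    exact c1 _
  · exact (abs_dGreen_le a i _).trans (c2 _)

/-- The energy form of the potential of `ν` is the `ν`-average of the energy forms of the
fundamental solutions. -/
theorem integral_energy_potential {a : ℝ} (ha : 0 < a) (ν : Measure Plane) [IsFiniteMeasure ν]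
    {u : Plane → ℂ} (hu : ContDiff ℝ 1 u) (hc : HasCompactSupport u) (Ω : Set Plane) :
    ∫ x in Ω, (∑ i, gradPotential a ν x i * partialD i u x + (a : ℂ) * potential a ν x * u x)
      = ∫ y, (∫ x in Ω, greenEnergy a u y x) ∂ν := by
  rw [← integral_integral_swap (integrable_greenEnergy_prod ha ν hu hc Ω)]
  refine integral_congr_ae ?_
  filter_upwards [ae_restrict_of_ae (ae_integrable_kernels ha ν)] with x ⟨hx0, hx1⟩
  unfold greenEnergy
  rw [integral_add (integrable_finsetSum _ fun i _ => (hx1 i).ofReal.mul_const _)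
    ((hx0.const_mul a).ofReal.mul_const _), integral_finsetSum _ fun i _ =>
    (hx1 i).ofReal.mul_const _]
  congr 1
  · refine Finset.sum_congr rfl fun i _ => ?_
    rw [integral_mul_const, integral_complex_ofReal]
    rfl
  · rw [integral_mul_const, integral_complex_ofReal, integral_const_mul]
    simp [potential]

/-- Interchange of a space integral with the time integral defining a kernel. -/
theorem integral_kernel_swap {k : ℝ → Plane → ℝ} (hk : Measurable fun q : ℝ × Plane => k q.1 q.2)
    {C : ℝ} (hi : ∀ z : Plane, z ≠ 0 → IntegrableOn (fun t => k t z) (Ioi 0))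
    (hb : ∀ z : Plane, z ≠ 0 → ∫ t in Ioi (0 : ℝ), |k t z| ≤ C * domK z) {g : Plane → ℂ}
    (hg : Continuous g) (hc : HasCompactSupport g) (y : Plane) :
    ∫ x, ((∫ t in Ioi (0 : ℝ), k t (x - y) : ℝ) : ℂ) * g x
      = ∫ t in Ioi (0 : ℝ), ∫ x, (k t (x - y) : ℂ) * g x := by
  obtain ⟨M, hM⟩ := hg.bounded_above_of_compact_support hc
  have hsw : Measurable fun q : Plane × ℝ => (q.2, q.1 - y) :=
    measurable_snd.prodMk (measurable_fst.sub_const y)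
  have hmeas : Measurable fun q : Plane × ℝ => (k q.2 (q.1 - y) : ℂ) * g q.1 :=
    (Complex.measurable_ofReal.comp (hk.comp hsw)).mul (hg.measurable.comp measurable_fst)
  have hint : Integrable (fun q : Plane × ℝ => (k q.2 (q.1 - y) : ℂ) * g q.1)
      ((volume : Measure Plane).prod (volume.restrict (Ioi 0))) := by
    refine (integrable_prod_iff hmeas.aestronglyMeasurable).2 ⟨?_, ?_⟩
    · filter_upwards [ae_ne y] with x hx
      exact (hi _ (sub_ne_zero.2 hx)).ofReal.mul_const _
    · refine ((integrable_domK_sub y).const_mul (C * M)).mono' ?_ ?_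
      · exact (hmeas.norm.stronglyMeasurable.integral_prod_right
          (ν := volume.restrict (Ioi (0 : ℝ)))).aestronglyMeasurable
      · filter_upwards [ae_ne y] with x hx
        have hb' := hb _ (sub_ne_zero.2 hx)
        rw [Real.norm_eq_abs, abs_of_nonneg (integral_nonneg fun _ => norm_nonneg _)]
        simp only [norm_mul, Complex.norm_real, Real.norm_eq_abs]
        rw [integral_mul_const]
        have hMx := hM x
        have h0 : 0 ≤ C * domK (x - y) := (integral_nonneg fun _ => abs_nonneg _).trans hb'
        calc (∫ t in Ioi (0 : ℝ), |k t (x - y)|) * ‖g x‖ ≤ (C * domK (x - y)) * M := by gcongr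
          _ = _ := by ring
  rw [← integral_integral_swap hint]
  congr 1
  funext x
  rw [integral_mul_const, integral_complex_ofReal]

theorem partialD_heatK (a : ℝ) {t : ℝ} (ht : 0 < t) (i : Fin 2) (y x : Plane) :
    fderiv ℝ (fun x => heatK a t (x - y)) x (EuclideanSpace.single i 1) = dHeat a t i (x - y) := by
  have h := (hasFDerivAt_heatK a ht (x - y)).comp x ((hasFDerivAt_id x).sub_const y)
  have h2 : HasFDerivAt (fun x => heatK a t (x - y)) _ x := h
  rw [h2.fderiv]
  simp [dHeat, EuclideanSpace.inner_single_right]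
  ring

/-- The weak derivative of the fundamental solution. -/
theorem integral_greenK_partial {a : ℝ} (ha : 0 < a) {u : Plane → ℂ} (hu : ContDiff ℝ 1 u)
    (hc : HasCompactSupport u) (i : Fin 2) (y : Plane) :
    ∫ x, (greenK a (x - y) : ℂ) * partialD i u x = - ∫ x, (dGreen a i (x - y) : ℂ) * u x := by
  obtain ⟨C, hC, c1, c2⟩ := exists_kernel_bound ha
  have e1 := integral_kernel_swap (C := C) (measurable_heatK a) (fun z hz => integrableOn_heatK ha hz)
    (fun z hz => by
      refine le_trans (le_of_eq ?_) (c1 z)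
      exact setIntegral_congr_fun measurableSet_Ioi fun t ht => abs_of_nonneg (heatK_nonneg a ht z))
    (continuous_partialD hu i) (hc.fderiv_apply ℝ _) y
  have hid : ∀ z : Plane, z ≠ 0 → IntegrableOn (fun t => dHeat a t i z) (Ioi 0) := by
    intro z hz
    refine ((integrableOn_heatK_div ha hz).const_mul (-(z i))).congr
      (Eventually.of_forall fun t => ?_)
    simp only [dHeat]
    ring
  have e2 := integral_kernel_swap (C := C) (measurable_dHeat a i) hid
    (fun z hz => by
      refine le_trans ?_ (c2 z)
      rw [greenSlope, ← integral_const_mul]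
      exact setIntegral_mono_on (hid z hz).norm ((integrableOn_heatK_div ha hz).const_mul _)
        measurableSet_Ioi fun t ht => abs_dHeat_le a ht i z)
    hu.continuous hc y
  have e3 : ∀ z : Plane, ∫ t in Ioi (0 : ℝ), dHeat a t i z = dGreen a i z := by
    intro z
    rw [dGreen, greenSlope, ← integral_const_mul]
    congr 1
    funext t
    simp only [dHeat]
    ring
  simp only [e3] at e2
  rw [e2]
  refine e1.trans ?_
  rw [← integral_neg]
  refine setIntegral_congr_fun measurableSet_Ioi fun t ht => ?_
  have ht0 : (0 : ℝ) < t := ht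
  have hh : ContDiff ℝ 1 fun x => (heatK a t (x - y) : ℂ) :=
    Complex.ofRealCLM.contDiff.comp (((contDiff_heatK a t).of_le (by simp)).comp
        (contDiff_id.sub contDiff_const))
  have h0 := integral_fderiv_eq_zero (hh.mul hu) hc.mul_left (EuclideanSpace.single i 1)
  have hd : ∀ x, fderiv ℝ (fun x => (heatK a t (x - y) : ℂ) * u x) x (EuclideanSpace.single i 1)
      = (heatK a t (x - y) : ℂ) * partialD i u x + (dHeat a t i (x - y) : ℂ) * u x := by
    intro x
    rw [fderiv_fun_mul (hh.differentiable (by simp) x) (hu.differentiable (by simp) x)]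
    have : fderiv ℝ (fun x => (heatK a t (x - y) : ℂ)) x (EuclideanSpace.single i 1)
        = (dHeat a t i (x - y) : ℂ) := by
      rw [← partialD_heatK a ht0 i y x]
      have h1 : DifferentiableAt ℝ (fun x => heatK a t (x - y)) x :=
        (((contDiff_heatK a t).comp (contDiff_id.sub contDiff_const)).differentiable (by simp)) x
      have := (Complex.ofRealCLM.hasFDerivAt.comp x h1.hasFDerivAt).fderiv
      exact congrArg (fun L => L (EuclideanSpace.single i 1)) this
    simp [this, partialD]
    ring
  have i1 : Integrable fun x => (heatK a t (x - y) : ℂ) * partialD i u x :=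
    (hh.continuous.mul (continuous_partialD hu i)).integrable_of_hasCompactSupport
      ((hc.fderiv_apply ℝ _).mul_left)
  have i2 : Integrable fun x => (dHeat a t i (x - y) : ℂ) * u x :=
    ((Complex.continuous_ofReal.comp ((contDiff_dHeat a t i).continuous.comp
      (continuous_id.sub continuous_const))).mul hu.continuous).integrable_of_hasCompactSupport
      hc.mul_left
  simp only [hd] at h0
  rw [integral_add i1 i2] at h0
  exact eq_neg_of_add_eq_zero_left h0

/-- The weak derivative of a potential. -/
theorem integral_potential_partial {a : ℝ} (ha : 0 < a) (ν : Measure Plane) [IsFiniteMeasure ν]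
    {u : Plane → ℂ} (hu : ContDiff ℝ 1 u) (hc : HasCompactSupport u) (i : Fin 2) :
    ∫ x, (potential a ν x : ℂ) * partialD i u x = - ∫ x, gradPotential a ν x i * u x := by
  obtain ⟨C, hC, c1, c2⟩ := exists_kernel_bound ha
  obtain ⟨M, hM, h0, h1⟩ := exists_bound_of_compact hu hc
  -- both sides are turned into averages over `ν` by Fubini's theorem
  have swap : ∀ (k : Plane → ℝ) (g : Plane → ℂ), Measurable k → (∀ z, |k z| ≤ C * domK z) →
      Continuous g → (∀ x, ‖g x‖ ≤ M) →
      ∫ x, ((∫ y, k (x - y) ∂ν : ℝ) : ℂ) * g x = ∫ y, (∫ x, (k (x - y) : ℂ) * g x) ∂ν := by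
    intro k g hk hkC hg hgM
    have hint : Integrable (fun q : Plane × Plane => (k (q.1 - q.2) : ℂ) * g q.1)
        ((volume : Measure Plane).prod ν) := by
      refine ((integrable_domK_prod ν).const_mul (C * M)).mono'
        ((Complex.measurable_ofReal.comp (hk.comp measurable_sub_prod)).mul
          (hg.measurable.comp measurable_fst)).aestronglyMeasurable
        (Eventually.of_forall fun q => ?_)
      rw [norm_mul, Complex.norm_real, Real.norm_eq_abs]
      have e1 := hkC (q.1 - q.2)
      have e2 := hgM q.1
      have e3 : 0 ≤ C * domK (q.1 - q.2) := (abs_nonneg _).trans e1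
      calc |k (q.1 - q.2)| * ‖g q.1‖ ≤ (C * domK (q.1 - q.2)) * M := by gcongr
        _ = _ := by ring
    rw [← integral_integral_swap hint]
    congr 1
    funext x
    rw [integral_mul_const, integral_complex_ofReal]
  have s1 := swap (greenK a) (partialD i u) (measurable_greenK a)
    (fun z => (abs_of_nonneg (greenK_nonneg a z)).le.trans (c1 z)) (continuous_partialD hu i) (h1 i)
  have s2 := swap (dGreen a i) u (measurable_dGreen a i)
    (fun z => (abs_dGreen_le a i z).trans (c2 z)) hu.continuous h0
  change ∫ x, ((∫ y, greenK a (x - y) ∂ν : ℝ) : ℂ) * partialD i u x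
    = - ∫ x, ((∫ y, dGreen a i (x - y) ∂ν : ℝ) : ℂ) * u x
  rw [s1, s2, ← integral_neg]
  congr 1
  funext y
  exact integral_greenK_partial ha hu hc i y

/-! ### Boundary terms near a corner -/

/-- The scalar product of the normal `(F', -1)` at the parameter `s` with the chord from the
parameter `t₀` to the parameter `s`. -/
def normalChord (fneg fpos : ℝ → ℝ) (s t₀ : ℝ) : ℝ :=
  legDeriv fneg fpos s * (s - t₀) - (legFun fneg fpos s - legFun fneg fpos t₀)

/-- A chord of a smooth arc is tangent to the second order; this is what makes the double layer
kernel bounded. Across the corner there is no such cancellation, and the distance of the parameters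
is bounded below instead. -/
theorem IsLegPair.exists_normalChord_bound {fneg fpos : ℝ → ℝ} (h : IsLegPair fneg fpos)
    {r t₁ : ℝ} (ht₁ : 0 < t₁) :
    ∃ C, 0 ≤ C ∧ ∀ s ∈ Icc (-r) r, ∀ t₀ ∈ Icc t₁ r,
      |normalChord fneg fpos s t₀| ≤ C * (s - t₀) ^ 2 := by
  have hd1 : ContDiff ℝ ∞ (deriv fpos) := (contDiff_infty_iff_deriv.1 h.smooth_pos).2
  obtain ⟨M, hM⟩ := (isCompact_Icc (a := -r) (b := r)).exists_bound_of_continuousOn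
    (hd1.continuous_deriv (by simp)).continuousOn
  obtain ⟨D, hD0, hD⟩ := h.exists_bound_legDeriv r
  obtain ⟨L, hL0, hL⟩ := h.exists_lipschitz r
  refine ⟨max M ((D + L) / t₁), le_max_of_le_right (by positivity), fun s hs t₀ ht₀ => ?_⟩
  have ht₀' : t₀ ∈ Icc (-r) r := ⟨by linarith [ht₀.1, ht₀.2], ht₀.2⟩
  by_cases hs0 : s < 0
  · have h1 : |normalChord fneg fpos s t₀| ≤ (D + L) * |s - t₀| := by
      unfold normalChord
      refine (abs_sub _ _).trans ?_
      rw [abs_mul, add_mul]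
      have := hD s hs
      have := hL s hs t₀ ht₀'
      gcongr
    have h2 : t₁ ≤ |s - t₀| := by
      rw [abs_sub_comm, abs_of_nonneg (by linarith [ht₀.1])]
      linarith [ht₀.1]
    have h3 : (D + L) * |s - t₀| ≤ (D + L) / t₁ * (s - t₀) ^ 2 := by
      rw [div_mul_eq_mul_div, le_div_iff₀ ht₁, ← sq_abs, mul_assoc]
      have : |s - t₀| * t₁ ≤ |s - t₀| ^ 2 := by nlinarith [abs_nonneg (s - t₀)]
      gcongr
    refine h1.trans (h3.trans ?_)
    gcongr
    exact le_max_right _ _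
  · have e : normalChord fneg fpos s t₀
        = (fpos t₀ - deriv fpos s * t₀) - (fpos s - deriv fpos s * s) := by
      have : ¬ t₀ < 0 := by linarith [ht₀.1]
      simp only [normalChord, legDeriv, legFun, hs0, this, if_false]
      ring
    have hlip : ∀ x ∈ Icc (-r) r, |deriv fpos x - deriv fpos s| ≤ M * |x - s| := fun x hx =>
      (convex_Icc (-r) r).norm_image_sub_le_of_norm_deriv_le
        (fun x _ => hd1.differentiable (by simp) x) hM hs hx
    have hM0 : 0 ≤ M := (norm_nonneg _).trans (hM s hs)
    have hseg : uIcc s t₀ ⊆ Icc (-r) r := uIcc_subset_Icc hs ht₀'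
    have := (convex_uIcc s t₀).norm_image_sub_le_of_norm_hasDerivWithin_le
      (f := fun x => fpos x - deriv fpos s * x) (f' := fun x => deriv fpos x - deriv fpos s)
      (C := M * |s - t₀|)
      (fun x _ => by
        have h1 := (h.smooth_pos.differentiable (by simp) x).hasDerivAt
        have h2 := (hasDerivAt_id x).const_mul (deriv fpos s)
        rw [mul_one] at h2
        exact (h1.sub h2).hasDerivWithinAt)
      (fun x hx => by
        refine (hlip x (hseg hx)).trans ?_
        exact mul_le_mul_of_nonneg_left
          (by rw [abs_sub_comm s t₀]; exact abs_sub_left_of_mem_uIcc hx) hM0)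
      left_mem_uIcc right_mem_uIcc
    rw [e]
    refine this.trans ?_
    rw [Real.norm_eq_abs, abs_sub_comm t₀ s, mul_assoc, ← pow_two, sq_abs]
    gcongr
    exact le_max_left _ _

theorem measurable_normalChord {fneg fpos : ℝ → ℝ} (h : IsLegPair fneg fpos) (t₀ : ℝ) :
    Measurable fun s => normalChord fneg fpos s t₀ := by
  unfold normalChord
  exact (h.measurable_legDeriv.mul (measurable_id.sub_const _)).sub
    (h.continuous_legFun.measurable.sub_const _)

theorem contDiff_dHeat_mul (a t : ℝ) (i : Fin 2) {u : Plane → ℂ} (hu : ContDiff ℝ 1 u) (y : Plane) :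
    ContDiff ℝ 1 fun x => (dHeat a t i (x - y) : ℂ) * u x := by
  refine ContDiff.mul ?_ hu
  exact Complex.ofRealCLM.contDiff.comp (((contDiff_dHeat a t i).of_le (by simp)).comp
    (contDiff_id.sub contDiff_const))

theorem continuous_heatK (a t : ℝ) : Continuous (heatK a t) := (contDiff_heatK a t).continuous

namespace IsCornerChart

variable {Ω : Set Plane} {p : Plane} {e : Plane ≃ₗᵢ[ℝ] Plane} {fneg fpos : ℝ → ℝ} {r : ℝ}

theorem integrable_comp_graphPt (hc : IsCornerChart Ω p e fneg fpos r) {g : Plane → ℂ}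
    (hg : Continuous g) (hsup : tsupport g ⊆ Metric.ball p r) :
    Integrable (fun s => g (graphPt p e (legFun fneg fpos) s)) ∧
      Integrable (fun s => (legDeriv fneg fpos s : ℂ) * g (graphPt p e (legFun fneg fpos) s)) := by
  have hl := hc.isLegPair
  have hcont := continuous_graphPt p e hl.continuous_legFun
  have hz : ∀ s, g (graphPt p e (legFun fneg fpos) s) ≠ 0 → s ∈ Icc (-r) r := fun s hs =>
    abs_le.1 (hl.abs_lt_of_graphPt_mem (hsup (subset_tsupport _ hs))).le
  have hi : Integrable (fun s => g (graphPt p e (legFun fneg fpos) s)) :=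
    (hg.comp hcont).integrable_of_hasCompactSupport
      (HasCompactSupport.of_support_subset_isCompact (isCompact_Icc (a := -r) (b := r)) hz)
  obtain ⟨C, hC0, hC⟩ := hl.exists_bound_legDeriv r
  refine ⟨hi, (hi.const_mul (C : ℂ)).mono
    ((Complex.measurable_ofReal.comp hl.measurable_legDeriv).aestronglyMeasurable.mul
      hi.aestronglyMeasurable) (Eventually.of_forall fun s => ?_)⟩
  by_cases hs : g (graphPt p e (legFun fneg fpos) s) = 0
  · simp [hs]
  · simp only [norm_mul, Complex.norm_real, Real.norm_eq_abs, abs_of_nonneg hC0]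
    gcongr
    exact hC _ (hz s hs)

/-- The boundary term of a function supported in the chart, as an integral over the graph. -/
theorem boundaryTerm_eq_integral (hc : IsCornerChart Ω p e fneg fpos r) (hΩ : IsOpen Ω) (a : ℝ)
    (t : ℝ) {u : Plane → ℂ} (hu : ContDiff ℝ 1 u) (hcs : HasCompactSupport u)
    (hsup : tsupport u ⊆ Metric.ball p r) (t₀ : ℝ) :
    boundaryTerm a Ω u (graphPt p e (legFun fneg fpos) t₀) t
      = ∫ s, ((-(normalChord fneg fpos s t₀ * (heatK a t (graphPt p e (legFun fneg fpos) s
        - graphPt p e (legFun fneg fpos) t₀) / (2 * t))) : ℝ) : ℂ)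
        * u (graphPt p e (legFun fneg fpos) s) := by
  set F := legFun fneg fpos with hF
  set y := graphPt p e F t₀ with hy
  have hsup' : ∀ i, tsupport (fun x => (dHeat a t i (x - y) : ℂ) * u x) ⊆ Metric.ball p r :=
    fun i => (tsupport_mul_subset_right).trans hsup
  have hsm := fun i => contDiff_dHeat_mul a t i hu y
  have hint := fun i => hc.integrable_comp_graphPt (hsm i).continuous (hsup' i)
  unfold boundaryTerm partialD
  have e1 : ∀ i, ∫ x in Ω, fderiv ℝ (fun x => (dHeat a t i (x - y) : ℂ) * u x) x
      (EuclideanSpace.single i 1) = ∫ s, ((legDeriv fneg fpos s * e (EuclideanSpace.single i 1) 0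
        - e (EuclideanSpace.single i 1) 1 : ℝ) : ℂ)
        * ((dHeat a t i (graphPt p e F s - y) : ℂ) * u (graphPt p e F s)) := fun i =>
    hc.integral_fderiv hΩ (hsm i) hcs.mul_left (hsup' i) _
  simp only [e1]
  rw [← integral_finsetSum]
  · congr 1
    funext s
    set z := graphPt p e F s - y with hz
    have hze : e z = WithLp.toLp 2 ![s - t₀, F s - F t₀] := graphPt_sub p e F s t₀
    have hzsum : z = ∑ i, z i • (EuclideanSpace.single i (1 : ℝ) : Plane) := by
      ext j
      fin_cases j <;> simp [Fin.sum_univ_two]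
    have hz0 : ∑ i, z i * e (EuclideanSpace.single i 1) 0 = s - t₀ := by
      have := congrArg (fun v : Plane => v 0) hze
      rw [hzsum] at this
      simpa [Fin.sum_univ_two] using this
    have hz1 : ∑ i, z i * e (EuclideanSpace.single i 1) 1 = F s - F t₀ := by
      have := congrArg (fun v : Plane => v 1) hze
      rw [hzsum] at this
      simpa [Fin.sum_univ_two] using this
    have hn : normalChord fneg fpos s t₀ = ∑ i, z i * (legDeriv fneg fpos s
        * e (EuclideanSpace.single i 1) 0 - e (EuclideanSpace.single i 1) 1) := by
      rw [normalChord, ← hF, ← hz0, ← hz1]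
      simp only [Fin.sum_univ_two]
      ring
    rw [hn]
    simp only [Fin.sum_univ_two, dHeat]
    push_cast
    ring
  · intro i _
    have h := ((hint i).2.mul_const (e (EuclideanSpace.single i 1) 0 : ℂ)).sub
      ((hint i).1.const_mul (e (EuclideanSpace.single i 1) 1 : ℂ))
    refine h.congr (Eventually.of_forall fun s => ?_)
    simp only [Pi.sub_apply]
    push_cast
    ring

theorem lintegral_chartMeasure (hc : IsCornerChart Ω p e fneg fpos r) {g : Plane → ℝ≥0∞}
    (hg : Measurable g) (hsup : ∀ x ∉ Metric.ball p r, g x = 0) :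
    ∫⁻ s, g (graphPt p e (legFun fneg fpos) s)
      = ∫⁻ x, g x ∂(chartMeasure p e (legFun fneg fpos) r) := by
  have hcont := continuous_graphPt p e hc.isLegPair.continuous_legFun
  rw [chartMeasure, lintegral_map hg hcont.measurable]
  symm
  refine setLIntegral_eq_of_support_subset fun s hs => ?_
  by_contra h
  exact hs (hsup _ h)

end IsCornerChart

/-- Integration over time of a bound by heat kernels produces the gradient of the fundamental
solution. -/
theorem lintegral_time_le {a : ℝ} (ha : 0 < a) {α : Type*} [MeasurableSpace α] {μ : Measure α}
    [SFinite μ] {pt : α → Plane} (hpt : Measurable pt) {k : α → ℝ} (hk : Measurable k)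
    (hk0 : ∀ s, 0 ≤ k s) {w : α → ℝ≥0∞} (hw : Measurable w) {y : Plane}
    (hky : ∀ s, pt s = y → k s = 0) {C : ℝ}
    (hC : ∀ s, w s ≠ 0 → k s * greenSlope a (pt s - y) ≤ C) :
    ∫⁻ t in Ioi (0 : ℝ), ∫⁻ s, ENNReal.ofReal (k s * (heatK a t (pt s - y) / (2 * t))) * w s ∂μ
      ≤ ENNReal.ofReal C * ∫⁻ s, w s ∂μ := by
  have hm : Measurable fun q : ℝ × α => ENNReal.ofReal (k q.2
      * (heatK a q.1 (pt q.2 - y) / (2 * q.1))) * w q.2 := by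
    have h1 : Measurable fun q : ℝ × α => heatK a q.1 (pt q.2 - y) :=
      (measurable_heatK a).comp (measurable_fst.prodMk ((hpt.comp measurable_snd).sub_const y))
    exact (((hk.comp measurable_snd).mul (h1.div (measurable_fst.const_mul 2))).ennreal_ofReal).mul
      (hw.comp measurable_snd)
  rw [lintegral_lintegral_swap (f := fun t s => ENNReal.ofReal (k s
    * (heatK a t (pt s - y) / (2 * t))) * w s) hm.aemeasurable, ← lintegral_const_mul _ hw]
  refine lintegral_mono fun s => ?_
  by_cases hws : w s = 0
  · simp [hws]
  have h1 : Measurable fun t : ℝ => ENNReal.ofReal (k s * (heatK a t (pt s - y) / (2 * t))) :=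
    (((measurable_heatK_left a _).div (measurable_id.const_mul 2)).const_mul _).ennreal_ofReal
  rw [lintegral_mul_const _ h1]
  refine mul_le_mul_left ?_ _
  by_cases hs : pt s = y
  · simp [hky s hs]
  · have hz : pt s - y ≠ 0 := sub_ne_zero.2 hs
    rw [← ofReal_integral_eq_lintegral_ofReal ((integrableOn_heatK_div ha hz).const_mul _)]
    · rw [integral_const_mul]
      exact ENNReal.ofReal_le_ofReal (hC s hws)
    · refine (ae_restrict_iff' measurableSet_Ioi).2 (Eventually.of_forall fun t ht => ?_)
      have ht0 : (0 : ℝ) < t := ht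
      exact mul_nonneg (hk0 s) (div_nonneg (heatK_nonneg a ht _) (by positivity))

theorem norm_setIntegral_heatK_le (a : ℝ) {ε : ℝ} (hε : 0 < ε) {u : Plane → ℂ} (hu : Continuous u)
    (hc : HasCompactSupport u) (y : Plane) (Ω : Set Plane) :
    ‖∫ x in Ω, ((heatK a ε (x - y) : ℝ) : ℂ) * u x‖ ≤ ∫ x, heatK a ε (x - y) • ‖u x‖ := by
  have hi : Integrable fun x => heatK a ε (x - y) • ‖u x‖ :=
    (((continuous_heatK a ε).comp (continuous_id.sub continuous_const)).smul
      hu.norm).integrable_of_hasCompactSupport (hc.mono fun x hx h => hx (by simp [h]))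
  have hnn : ∀ x, 0 ≤ heatK a ε (x - y) • ‖u x‖ := fun x =>
    smul_nonneg (heatK_nonneg a hε _) (norm_nonneg _)
  refine (norm_integral_le_of_norm_le hi.integrableOn (Eventually.of_forall fun x => ?_)).trans
    (setIntegral_le_integral hi (Eventually.of_forall hnn))
  rw [norm_mul, Complex.norm_real, Real.norm_eq_abs, abs_of_nonneg (heatK_nonneg a hε _),
    smul_eq_mul]

/-- Passage to the limit in Green's representation. -/
theorem norm_integral_greenEnergy_le {a : ℝ} (ha : 0 < a) {u : Plane → ℂ} (hu : ContDiff ℝ 1 u)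
    (hc : HasCompactSupport u) (y : Plane) (Ω : Set Plane) {B : ℝ} (hB : 0 ≤ B)
    (h : ∫⁻ t in Ioi (0 : ℝ), ‖boundaryTerm a Ω u y t‖ₑ ≤ ENNReal.ofReal B) :
    ‖∫ x in Ω, greenEnergy a u y x‖ ≤ B + ‖u y‖ := by
  have h1 := (tendsto_boundaryTerm ha hu hc y Ω).norm
  have h2 := (tendsto_integral_heatK a hu.continuous.norm hc.norm y).const_add B
  refine le_of_tendsto_of_tendsto h1 h2 ?_
  filter_upwards [self_mem_nhdsWithin] with ε hε
  have hε0 : (0 : ℝ) < ε := hε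
  refine (norm_add_le _ _).trans (add_le_add ?_ ?_)
  · have h3 : ‖∫ t in Ioi ε, boundaryTerm a Ω u y t‖ₑ ≤ ENNReal.ofReal B :=
      (enorm_integral_le_lintegral_enorm _).trans
        ((lintegral_mono_set (Ioi_subset_Ioi hε0.le)).trans h)
    rw [← ofReal_norm] at h3
    exact (ENNReal.ofReal_le_ofReal_iff hB).1 h3
  · exact norm_setIntegral_heatK_le a hε0 hu.continuous hc y Ω

theorem boundaryTerm_add {a : ℝ} {u v : Plane → ℂ} (hu : ContDiff ℝ 1 u) (hv : ContDiff ℝ 1 v)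
    (hcu : HasCompactSupport u) (hcv : HasCompactSupport v) (Ω : Set Plane) (y : Plane) (t : ℝ) :
    boundaryTerm a Ω (u + v) y t = boundaryTerm a Ω u y t + boundaryTerm a Ω v y t := by
  unfold boundaryTerm
  rw [← Finset.sum_add_distrib]
  refine Finset.sum_congr rfl fun i _ => ?_
  have h1 := contDiff_dHeat_mul a t i hu y
  have h2 := contDiff_dHeat_mul a t i hv y
  rw [← integral_add]
  · congr 1
    funext x
    have : (fun x => (dHeat a t i (x - y) : ℂ) * (u + v) x)
        = (fun x => (dHeat a t i (x - y) : ℂ) * u x) + fun x => (dHeat a t i (x - y) : ℂ) * v x := by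
      funext x; simp [mul_add]
    rw [this, partialD, fderiv_add (h1.differentiable (by simp) x) (h2.differentiable (by simp) x)]
    rfl
  · exact ((continuous_partialD h1 i).integrable_of_hasCompactSupport
      ((hcu.mul_left).fderiv_apply ℝ _)).integrableOn
  · exact ((continuous_partialD h2 i).integrable_of_hasCompactSupport
      ((hcv.mul_left).fderiv_apply ℝ _)).integrableOn

/-- For a pole `y` on a smooth side, the energy form of the fundamental solution extends to a
bounded functional on integrable functions on the boundary, up to the point evaluation at `y`. -/
theorem IsCurvilinearPolygon.exists_greenEnergy_bound {Ω : Set Plane} (h : IsCurvilinearPolygon Ω)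
    {p : Plane} {e : Plane ≃ₗᵢ[ℝ] Plane} {fneg fpos : ℝ → ℝ} {r : ℝ}
    (hc : IsCornerChart Ω p e fneg fpos r) {a : ℝ} (ha : 0 < a) {t₁ : ℝ} (ht₁ : 0 < t₁) :
    ∃ C, 0 ≤ C ∧ ∀ u : Plane → ℂ, ContDiff ℝ 1 u → HasCompactSupport u → ∀ t₀, t₁ ≤ t₀ → t₀ ≤ r →
      graphPt p e (legFun fneg fpos) t₀ ∈ Metric.ball p (r / 4) →
      ‖∫ x in Ω, greenEnergy a u (graphPt p e (legFun fneg fpos) t₀) x‖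
        ≤ C * (∫ x, ‖u x‖ ∂(arcMeasure (frontier Ω)))
          + ‖u (graphPt p e (legFun fneg fpos) t₀)‖ := by
  have hfin := h.isFiniteMeasure_arcMeasure
  have hl := hc.isLegPair
  have hr := hc.radius_pos
  have hcont := continuous_graphPt p e hl.continuous_legFun
  obtain ⟨N, hN0, hN⟩ := hl.exists_normalChord_bound (r := r) ht₁
  obtain ⟨B, hB0, hB⟩ := h.exists_boundary_bound
  set F := legFun fneg fpos with hF
  -- a cutoff separating the chart from the rest of the boundary
  let χ : ContDiffBump p := ⟨r / 2, 3 * r / 4, by linarith, by linarith⟩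
  have hχs : ContDiff ℝ 1 (fun x => χ x) := χ.contDiff
  have hχt : tsupport (fun x => χ x) ⊆ Metric.ball p r := by
    rw [χ.tsupport_eq]
    exact Metric.closedBall_subset_ball (show 3 * r / 4 < r by linarith)
  have hpi : (2 * Real.pi)⁻¹ ≤ 1 := inv_le_one_of_one_le₀ (by nlinarith [Real.pi_gt_three])
  refine ⟨N + 2 * B * (4 / r), by positivity, fun u hu hcs t₀ ht1 ht2 hy => ?_⟩
  set y := graphPt p e F t₀ with hydef
  set S := ∫ x, ‖u x‖ ∂(arcMeasure (frontier Ω)) with hS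
  have hS0 : 0 ≤ S := integral_nonneg fun _ => norm_nonneg _
  have hSl : ∫⁻ x, ‖u x‖ₑ ∂(arcMeasure (frontier Ω)) = ENNReal.ofReal S :=
    (ofReal_integral_norm_eq_lintegral_enorm (integrable_arcMeasure hu.continuous hcs)).symm
  set v : Plane → ℂ := fun x => (χ x : ℂ) * u x with hv
  set w : Plane → ℂ := fun x => ((1 - χ x : ℝ) : ℂ) * u x with hw
  have hvs : ContDiff ℝ 1 v := (Complex.ofRealCLM.contDiff.comp hχs).mul hu
  have hws : ContDiff ℝ 1 w := (Complex.ofRealCLM.contDiff.comp (contDiff_const.sub hχs)).mul hu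
  have hvc : HasCompactSupport v := hcs.mul_left
  have hwc : HasCompactSupport w := hcs.mul_left
  have huv : u = v + w := by
    funext x; simp [hv, hw]; ring
  have hvle : ∀ x, ‖v x‖ₑ ≤ ‖u x‖ₑ := fun x => by
    rw [enorm_le_iff_norm_le, norm_mul, Complex.norm_real, Real.norm_eq_abs,
      abs_of_nonneg χ.nonneg]
    exact mul_le_of_le_one_left (norm_nonneg _) χ.le_one
  have hwle : ∀ x, ‖w x‖ₑ ≤ ‖u x‖ₑ := fun x => by
    rw [enorm_le_iff_norm_le, norm_mul, Complex.norm_real, Real.norm_eq_abs,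
      abs_of_nonneg (by linarith [χ.le_one (x := x)])]
    exact mul_le_of_le_one_left (norm_nonneg _) (by linarith [χ.nonneg (x := x)])
  have hvt : tsupport v ⊆ Metric.ball p r := by
    refine (tsupport_mul_subset_left).trans (subset_trans ?_ hχt)
    exact closure_mono fun x hx h0 => hx (by simp [h0])
  have hwfar : ∀ x, ‖w x‖ₑ ≠ 0 → r / 4 ≤ ‖x - y‖ := by
    intro x hx
    have h1 : χ x ≠ 1 := fun h1 => hx (by simp [hw, h1])
    have h2 : x ∉ Metric.closedBall p (r / 2) := fun h2 => h1 (χ.one_of_mem_closedBall h2)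
    rw [Metric.mem_closedBall, not_le, dist_eq_norm] at h2
    rw [mem_ball_iff_norm] at hy
    have : ‖x - p‖ ≤ ‖x - y‖ + ‖y - p‖ := norm_sub_le_norm_sub_add_norm_sub _ _ _
    linarith
  -- in the chart the second order tangency of the chord cancels the singularity of the kernel
  have near : ∫⁻ t in Ioi (0 : ℝ), ‖boundaryTerm a Ω v y t‖ₑ ≤ ENNReal.ofReal N
      * ∫⁻ x, ‖u x‖ₑ ∂(arcMeasure (frontier Ω)) := by
    have hb : ∀ t ∈ Ioi (0 : ℝ), ‖boundaryTerm a Ω v y t‖ₑ ≤ ∫⁻ s,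
        ENNReal.ofReal (|normalChord fneg fpos s t₀| * (heatK a t (graphPt p e F s - y) / (2 * t)))
          * ‖v (graphPt p e F s)‖ₑ := by
      intro t ht
      have ht0 : (0 : ℝ) < t := ht
      rw [hc.boundaryTerm_eq_integral h.isOpen a t hvs hvc hvt t₀]
      refine (enorm_integral_le_lintegral_enorm _).trans (lintegral_mono fun s => ?_)
      rw [enorm_mul]
      refine mul_le_mul_left (le_of_eq ?_) _
      rw [← ofReal_norm, Complex.norm_real, Real.norm_eq_abs, abs_neg, abs_mul,
        abs_of_nonneg (div_nonneg (heatK_nonneg a ht _) (by positivity) :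
          0 ≤ heatK a t (graphPt p e F s - graphPt p e F t₀) / (2 * t))]
    refine (setLIntegral_mono' measurableSet_Ioi hb).trans ?_
    have hmv : Measurable fun x => ‖v x‖ₑ := hvs.continuous.measurable.enorm
    refine (lintegral_time_le ha (C := N) hcont.measurable (measurable_normalChord hl t₀).abs
      (fun _ => abs_nonneg _) (hmv.comp hcont.measurable) ?_ ?_).trans ?_
    · intro s hs
      have h1 := abs_sub_le_norm_graphPt_sub p e F s t₀
      rw [hs, ← hydef, sub_self, norm_zero] at h1
      have : s = t₀ := sub_eq_zero.1 (abs_eq_zero.1 (le_antisymm h1 (abs_nonneg _)))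
      simp [this, normalChord]
    · intro s hs
      have hmem : graphPt p e F s ∈ Metric.ball p r := hvt (subset_tsupport _ (by simpa using hs))
      have h1 := hN s (abs_le.1 (hl.abs_lt_of_graphPt_mem hmem).le) t₀ ⟨ht1, ht2⟩
      have h2 := abs_sub_le_norm_graphPt_sub p e F s t₀
      have h3 := norm_sq_mul_greenSlope_le ha (graphPt p e F s - y)
      have h4 := greenSlope_nonneg a (graphPt p e F s - y)
      have h5 : (s - t₀) ^ 2 ≤ ‖graphPt p e F s - y‖ ^ 2 := by
        rw [← sq_abs]; gcongr
      calc |normalChord fneg fpos s t₀| * greenSlope a (graphPt p e F s - y)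
          ≤ (N * ‖graphPt p e F s - y‖ ^ 2) * greenSlope a (graphPt p e F s - y) := by
            gcongr; exact h1.trans (by gcongr)
        _ = N * (‖graphPt p e F s - y‖ ^ 2 * greenSlope a (graphPt p e F s - y)) := by ring
        _ ≤ N * 1 := by gcongr; exact h3.trans hpi
        _ = N := mul_one N
    · refine mul_le_mul_right ?_ _
      change ∫⁻ s, ‖v (graphPt p e F s)‖ₑ ≤ _
      rw [hc.lintegral_chartMeasure hmv]
      · exact (lintegral_mono' hc.chartMeasure_le fun x => hvle x)
      · intro x hx
        have : v x = 0 := image_eq_zero_of_notMem_tsupport fun h => hx (hvt h)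
        simp [this]
  -- away from the chart the kernel has no singularity, and the global boundary estimate applies
  have far : ∫⁻ t in Ioi (0 : ℝ), ‖boundaryTerm a Ω w y t‖ₑ ≤ ENNReal.ofReal (2 * B * (4 / r))
      * ∫⁻ x, ‖u x‖ₑ ∂(arcMeasure (frontier Ω)) := by
    have hb : ∀ t ∈ Ioi (0 : ℝ), ‖boundaryTerm a Ω w y t‖ₑ ≤ ∫⁻ x,
        ENNReal.ofReal ((2 * B * ‖x - y‖) * (heatK a t (x - y) / (2 * t)))
          * ‖w x‖ₑ ∂(arcMeasure (frontier Ω)) := by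
      intro t ht
      have ht0 : (0 : ℝ) < t := ht
      have hq : ∀ x, 0 ≤ heatK a t (x - y) / (2 * t) := fun x =>
        div_nonneg (heatK_nonneg a ht _) (by positivity)
      have hterm : ∀ i, ‖∫ x in Ω, partialD i (fun x => (dHeat a t i (x - y) : ℂ) * w x) x‖ₑ
          ≤ ∫⁻ x, ENNReal.ofReal (B * ‖x - y‖ * (heatK a t (x - y) / (2 * t))) * ‖w x‖ₑ
            ∂(arcMeasure (frontier Ω)) := by
        intro i
        have h1 := contDiff_dHeat_mul a t i hws y
        have h2 := hB _ h1 hwc.mul_left (EuclideanSpace.single i 1)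
        rw [PiLp.norm_single, norm_one, mul_one] at h2
        rw [← ofReal_norm]
        refine (ENNReal.ofReal_le_ofReal h2).trans ?_
        rw [ENNReal.ofReal_mul hB0, ofReal_integral_norm_eq_lintegral_enorm
          (integrable_arcMeasure h1.continuous hwc.mul_left),
          ← lintegral_const_mul _ h1.continuous.measurable.enorm]
        refine lintegral_mono fun x => ?_
        rw [enorm_mul, ← mul_assoc, mul_assoc B, ENNReal.ofReal_mul hB0]
        gcongr
        rw [← ofReal_norm, Complex.norm_real]
        exact ENNReal.ofReal_le_ofReal (abs_dHeat_le a ht0 i _)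
      unfold boundaryTerm
      rw [Fin.sum_univ_two]
      refine (enorm_add_le _ _).trans ((add_le_add (hterm 0) (hterm 1)).trans (le_of_eq ?_))
      rw [← two_mul, ← lintegral_const_mul]
      · congr 1
        funext x
        rw [← mul_assoc]
        congr 1
        have h2 : ∀ X : ℝ, (2 : ℝ≥0∞) * ENNReal.ofReal X = ENNReal.ofReal (2 * X) := fun X => by
          rw [ENNReal.ofReal_mul (by norm_num)]; simp
        rw [h2]
        congr 1
        ring
      · have h1 : Measurable fun x => heatK a t (x - y) :=
          ((continuous_heatK a t).comp (continuous_id.sub continuous_const)).measurable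
        have h2 := hws.continuous.measurable
        fun_prop
    refine (setLIntegral_mono' measurableSet_Ioi hb).trans ?_
    refine (lintegral_time_le ha (C := 2 * B * (4 / r)) measurable_id (by fun_prop)
      (fun x => by positivity) hws.continuous.measurable.enorm ?_ ?_).trans ?_
    · intro x hx
      simp only [id] at hx
      simp [hx]
    · intro x hx
      have h1 := hwfar x hx
      have h3 := norm_sq_mul_greenSlope_le ha (x - y)
      have h4 := greenSlope_nonneg a (x - y)
      have h5 : ‖x - y‖ * greenSlope a (x - y) ≤ 4 / r := by
        rw [le_div_iff₀ hr]
        have h6 : r / 4 * (‖x - y‖ * greenSlope a (x - y)) ≤ 1 := by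
          calc r / 4 * (‖x - y‖ * greenSlope a (x - y))
              ≤ ‖x - y‖ * (‖x - y‖ * greenSlope a (x - y)) := by gcongr
            _ = ‖x - y‖ ^ 2 * greenSlope a (x - y) := by ring
            _ ≤ 1 := h3.trans hpi
        linarith
      simp only [id]
      calc 2 * B * ‖x - y‖ * greenSlope a (x - y) = 2 * B * (‖x - y‖ * greenSlope a (x - y)) := by
            ring
        _ ≤ _ := by gcongr
    · exact mul_le_mul_right (lintegral_mono hwle) _
  refine norm_integral_greenEnergy_le ha hu hcs y Ω (by positivity) ?_
  calc ∫⁻ t in Ioi (0 : ℝ), ‖boundaryTerm a Ω u y t‖ₑ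
      ≤ ∫⁻ t in Ioi (0 : ℝ), (‖boundaryTerm a Ω v y t‖ₑ + ‖boundaryTerm a Ω w y t‖ₑ) := by
        refine lintegral_mono fun t => ?_
        conv_lhs => rw [huv, boundaryTerm_add hvs hws hvc hwc]
        exact enorm_add_le _ _
    _ = (∫⁻ t in Ioi (0 : ℝ), ‖boundaryTerm a Ω v y t‖ₑ)
        + ∫⁻ t in Ioi (0 : ℝ), ‖boundaryTerm a Ω w y t‖ₑ := by
        refine lintegral_add_left ?_ _
        have e1 : (fun t => boundaryTerm a Ω v y t) = fun t => ∫ s,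
            ((-(normalChord fneg fpos s t₀ * (heatK a t (graphPt p e F s - y) / (2 * t))) : ℝ) : ℂ)
              * v (graphPt p e F s) :=
          funext fun t => hc.boundaryTerm_eq_integral h.isOpen a t hvs hvc hvt t₀
        have hm : Measurable fun q : ℝ × ℝ => ((-(normalChord fneg fpos q.2 t₀
            * (heatK a q.1 (graphPt p e F q.2 - y) / (2 * q.1))) : ℝ) : ℂ) * v (graphPt p e F q.2) := by
          have h1 : Measurable fun q : ℝ × ℝ => heatK a q.1 (graphPt p e F q.2 - y) :=
            (measurable_heatK a).comp (measurable_fst.prodMk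
              ((hcont.measurable.comp measurable_snd).sub_const y))
          refine Measurable.mul (Complex.measurable_ofReal.comp ?_)
            (hvs.continuous.measurable.comp (hcont.measurable.comp measurable_snd))
          exact (((measurable_normalChord hl t₀).comp measurable_snd).mul
            (h1.div (measurable_fst.const_mul 2))).neg
        have := hm.stronglyMeasurable.integral_prod_right' (ν := volume)
        rw [← e1] at this
        exact this.measurable.enorm
    _ ≤ ENNReal.ofReal N * ENNReal.ofReal S + ENNReal.ofReal (2 * B * (4 / r)) * ENNReal.ofReal S := by
        rw [← hSl]
        exact add_le_add near far
    _ = ENNReal.ofReal ((N + 2 * B * (4 / r)) * S) := by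
        rw [← add_mul, ← ENNReal.ofReal_add hN0 (by positivity), ← ENNReal.ofReal_mul (by positivity)]

/-! ### The contribution of a corner -/

/-- Across a corner the normal component of a chord is, at every scale, comparable with the distance
to the corner, and its sign is that of the difference of the one-sided slopes. -/
theorem IsLegPair.exists_normalChord_lower {fneg fpos : ℝ → ℝ} (h : IsLegPair fneg fpos)
    (hne : deriv fneg 0 ≠ deriv fpos 0) :
    ∃ ρ, 0 < ρ ∧ ∀ γ, 0 < γ → γ < ρ → ∀ s ∈ Icc (-(3 * γ)) (-γ), ∀ t₀ ∈ Icc γ (3 * γ),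
      (deriv fpos 0 - deriv fneg 0) ^ 2 * γ / 2
        ≤ (deriv fpos 0 - deriv fneg 0) * normalChord fneg fpos s t₀ := by
  set α := deriv fneg 0 with hα
  set β := deriv fpos 0 with hβ
  set δ := β - α with hδ
  have hδ0 : 0 < |δ| := abs_pos.2 (sub_ne_zero.2 (Ne.symm hne))
  -- the errors below add up to `12 η γ`, which is half of the main term `|δ| γ`
  set η := |δ| / 24 with hη
  have hη0 : 0 < η := by positivity
  have h1 : ∀ᶠ s in 𝓝 (0 : ℝ), |deriv fneg s - α| ≤ η := by
    have hcont := (h.smooth_neg.continuous_deriv (by simp)).continuousAt (x := 0)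
    have := hcont.eventually (Metric.closedBall_mem_nhds _ hη0)
    filter_upwards [this] with s hs
    simpa [Real.dist_eq] using hs
  have h2 : ∀ᶠ s in 𝓝 (0 : ℝ), |fneg s - α * s| ≤ η * |s| := by
    have := (h.smooth_neg.differentiable (by simp) 0).hasDerivAt.isLittleO.def hη0
    filter_upwards [this] with s hs
    simpa [h.neg_zero, mul_comm] using hs
  have h3 : ∀ᶠ s in 𝓝 (0 : ℝ), |fpos s - β * s| ≤ η * |s| := by
    have := (h.smooth_pos.differentiable (by simp) 0).hasDerivAt.isLittleO.def hη0
    filter_upwards [this] with s hs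
    simpa [h.pos_zero, mul_comm] using hs
  obtain ⟨ρ, hρ, hall⟩ := Metric.eventually_nhds_iff.1 (h1.and (h2.and h3))
  refine ⟨ρ / 3, by positivity, fun γ hγ hγρ s hs t₀ ht₀ => ?_⟩
  have hs0 : s < 0 := by linarith [hs.2]
  have ht0 : ¬ t₀ < 0 := by linarith [ht₀.1]
  obtain ⟨a1, a2, -⟩ := hall (y := s) (by
    rw [Real.dist_eq, sub_zero, abs_of_neg hs0]; linarith [hs.1])
  obtain ⟨-, -, a3⟩ := hall (y := t₀) (by
    rw [Real.dist_eq, sub_zero, abs_of_nonneg (not_lt.1 ht0)]; linarith [ht₀.2])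
  have e : normalChord fneg fpos s t₀ = δ * t₀ + ((deriv fneg s - α) * (s - t₀)
      - (fneg s - α * s) + (fpos t₀ - β * t₀)) := by
    simp only [normalChord, legDeriv, legFun, hs0, ht0, if_true, if_false, hδ]
    ring
  have b1 : |(deriv fneg s - α) * (s - t₀)| ≤ η * (6 * γ) := by
    rw [abs_mul]
    have : |s - t₀| ≤ 6 * γ := by rw [abs_le]; constructor <;> linarith [hs.1, hs.2, ht₀.1, ht₀.2]
    gcongr
  have b2 : |fneg s - α * s| ≤ η * (3 * γ) := a2.trans (by
    rw [abs_of_neg hs0]; gcongr; linarith [hs.1])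
  have b3 : |fpos t₀ - β * t₀| ≤ η * (3 * γ) := a3.trans (by
    rw [abs_of_nonneg (not_lt.1 ht0)]; gcongr; exact ht₀.2)
  set R := (deriv fneg s - α) * (s - t₀) - (fneg s - α * s) + (fpos t₀ - β * t₀) with hR
  have b4 : |R| ≤ |δ| * γ / 2 := by
    refine (abs_add_le _ _).trans ?_
    have := abs_sub ((deriv fneg s - α) * (s - t₀)) (fneg s - α * s)
    have e2 : |δ| * γ / 2 = η * (6 * γ) + η * (3 * γ) + η * (3 * γ) := by rw [hη]; ring
    linarith
  have b5 : |δ * R| ≤ δ ^ 2 * γ / 2 := by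
    rw [abs_mul, ← sq_abs δ]
    calc |δ| * |R| ≤ |δ| * (|δ| * γ / 2) := by gcongr
      _ = _ := by ring
  have b6 : δ ^ 2 * γ ≤ δ ^ 2 * t₀ := by gcongr; exact ht₀.1
  have b7 := (abs_le.1 b5).1
  rw [e]
  nlinarith

theorem integrableOn_boundaryTerm {a : ℝ} (ha : 0 < a) {u : Plane → ℂ} (hu : ContDiff ℝ 1 u)
    (hc : HasCompactSupport u) (y : Plane) (Ω : Set Plane) {ε : ℝ} (hε : 0 < ε) :
    IntegrableOn (boundaryTerm a Ω u y) (Ioi ε) := by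
  have hp := integrable_heatDot_prod ha hu.continuous hc y Ω hε
  have hE := integrable_heatEnergy_prod ha hu hc y Ω
  have hi := (integral_greenEnergy ha hu hc y Ω).1
  refine Integrable.congr ((hi.mono_set (Ioi_subset_Ioi hε.le)).add hp.integral_prod_right) ?_
  have ae1 : ∀ᵐ t ∂(volume.restrict (Ioi ε)),
      Integrable (fun x => heatEnergy a t u y x) (volume.restrict Ω) :=
    ae_restrict_of_ae_restrict_of_subset (Ioi_subset_Ioi hε.le) hE.prod_left_ae
  filter_upwards [ae1, hp.prod_left_ae, ae_restrict_mem measurableSet_Ioi] with t h1 h2 ht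
  rw [boundaryTerm_eq hu hc y Ω (hε.trans ht)]
  exact (integral_add h1 h2).symm

/-- A function on one side of a corner, seen from a pole on the other side: all the boundary terms
have the same sign, and those of the times comparable with `γ ^ 2` are bounded below. -/
theorem IsCornerChart.exists_greenEnergy_lower {Ω : Set Plane} {p : Plane}
    {e : Plane ≃ₗᵢ[ℝ] Plane} {fneg fpos : ℝ → ℝ} {r : ℝ} (hc : IsCornerChart Ω p e fneg fpos r)
    (hΩ : IsOpen Ω) (hne : deriv fneg 0 ≠ deriv fpos 0) {k : ℝ} (hk : 0 < k) :
    ∃ ρ P, 0 < ρ ∧ 0 < P ∧ ∀ γ, 0 < γ → γ < ρ → ∀ V : Plane → ℝ, ContDiff ℝ 1 V →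
      HasCompactSupport V → (∀ x, 0 ≤ V x) → tsupport V ⊆ Metric.ball p r →
      (∀ s, V (graphPt p e (legFun fneg fpos) s) ≠ 0 → s ∈ Icc (-(3 * γ)) (-γ)) →
      ∀ m, 0 ≤ m → (∀ s ∈ Icc (-(2 * γ) - k * γ) (-(2 * γ) + k * γ),
        m ≤ V (graphPt p e (legFun fneg fpos) s)) →
      ∀ t₀ ∈ Icc γ (3 * γ),
      P * m ≤ -(deriv fpos 0 - deriv fneg 0) * (∫ x in Ω, greenEnergy (γ⁻¹ ^ 2)
        (fun x => (V x : ℂ)) (graphPt p e (legFun fneg fpos) t₀) x).re := by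
  have hl := hc.isLegPair
  have hr := hc.radius_pos
  have hcont := continuous_graphPt p e hl.continuous_legFun
  obtain ⟨ρ, hρ, hlow⟩ := hl.exists_normalChord_lower hne
  obtain ⟨L, hL0, hL⟩ := hl.exists_lipschitz r
  set δ := deriv fpos 0 - deriv fneg 0 with hδ
  have hδ0 : δ ≠ 0 := sub_ne_zero.2 (Ne.symm hne)
  set Λ := 6 * (1 + L) with hΛ
  set P := δ ^ 2 * k * (Real.exp (-2) * Real.exp (-(Λ ^ 2 / 4))) / (32 * Real.pi) with hP
  refine ⟨min ρ (r / 3), P, lt_min hρ (by positivity), by positivity, ?_⟩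
  intro γ hγ hγρ V hV hVc hV0 hVt hVs m hm0 hm t₀ ht₀
  have hγ1 : γ < ρ := hγρ.trans_le (min_le_left _ _)
  have hγ2 : 3 * γ < r := by linarith [hγρ.trans_le (min_le_right ρ (r / 3))]
  have ha : 0 < γ⁻¹ ^ 2 := by positivity
  set a := γ⁻¹ ^ 2 with hadef
  set F := legFun fneg fpos with hF
  set y := graphPt p e F t₀ with hy
  set u : Plane → ℂ := fun x => (V x : ℂ) with hu
  have hus : ContDiff ℝ 1 u := Complex.ofRealCLM.contDiff.comp hV
  have huc : HasCompactSupport u := hVc.comp_left (g := fun t : ℝ => (t : ℂ)) (by simp)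
  have hut : tsupport u ⊆ Metric.ball p r :=
    (closure_mono (show Function.support u ⊆ Function.support V from
      fun x hx h0 => hx (by simp [hu, h0]))).trans hVt
  have huy : u y = 0 := by
    by_contra h
    have := hVs t₀ fun h0 => h (by simp [hu, hy, h0])
    linarith [this.2, ht₀.1]
  -- the boundary terms, up to sign, as integrals of nonnegative functions
  set q : ℝ → ℝ → ℝ := fun t s => δ * normalChord fneg fpos s t₀
    * (heatK a t (graphPt p e F s - y) / (2 * t)) * V (graphPt p e F s) with hq
  have hbt : ∀ t, -δ * (boundaryTerm a Ω u y t).re = ∫ s, q t s := by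
    intro t
    rw [hc.boundaryTerm_eq_integral hΩ a t hus huc hut t₀]
    have : ∀ s, ((-(normalChord fneg fpos s t₀ * (heatK a t (graphPt p e F s
        - graphPt p e F t₀) / (2 * t))) : ℝ) : ℂ) * u (graphPt p e F s)
        = ((-(normalChord fneg fpos s t₀ * (heatK a t (graphPt p e F s
        - graphPt p e F t₀) / (2 * t))) * V (graphPt p e F s) : ℝ) : ℂ) := fun s => by
      rw [Complex.ofReal_mul]
    rw [integral_congr_ae (Eventually.of_forall this), integral_complex_ofReal, Complex.ofReal_re, ← integral_const_mul]
    congr 1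
    funext s
    simp only [hq, hy]
    ring
  have hchord : ∀ s, V (graphPt p e F s) ≠ 0 →
      δ ^ 2 * γ / 2 ≤ δ * normalChord fneg fpos s t₀ := fun s hs =>
    hlow γ hγ hγ1 s (hVs s hs) t₀ ht₀
  have hq0 : ∀ t, 0 < t → ∀ s, 0 ≤ q t s := by
    intro t ht s
    by_cases hs : V (graphPt p e F s) = 0
    · simp [hq, hs]
    · have h1 : 0 ≤ δ * normalChord fneg fpos s t₀ := le_trans (by positivity) (hchord s hs)
      have h2 := heatK_nonneg a ht (graphPt p e F s - y)
      have h3 := hV0 (graphPt p e F s)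
      simp only [hq]
      positivity
  have hqi : ∀ t, Integrable (q t) := by
    intro t
    obtain ⟨N, hN0, hN⟩ := hl.exists_normalChord_bound (r := r) hγ
    have hg : Continuous fun x => (heatK a t (x - y) / (2 * t)) * V x :=
      ((((continuous_heatK a t).comp (continuous_id.sub continuous_const)).div_const _).mul
        hV.continuous)
    have hi : Integrable fun s => (fun x => (heatK a t (x - y) / (2 * t)) * V x)
        (graphPt p e F s) := by
      refine (hg.comp hcont).integrable_of_hasCompactSupport
        (HasCompactSupport.of_support_subset_isCompact (isCompact_Icc (a := -(3 * γ)) (b := -γ))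
          fun s hs => hVs s fun h0 => hs (by simp [h0]))
    refine (hi.const_mul (|δ| * (N * (2 * r) ^ 2))).mono ?_ (Eventually.of_forall fun s => ?_)
    · have h1 := (measurable_normalChord hl t₀).const_mul δ
      have h2 := hg.measurable.comp hcont.measurable
      refine (h1.mul h2).aestronglyMeasurable.congr (Eventually.of_forall fun s => ?_)
      simp only [hq, Function.comp_apply, Pi.mul_apply]
      ring
    · by_cases hs : V (graphPt p e F s) = 0
      · simp [hq, hs]
      · have h1 := hVs s hs
        have h2 := hN s ⟨by linarith [h1.1], by linarith [h1.2]⟩ t₀ ⟨ht₀.1, by linarith [ht₀.2]⟩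
        have h3 : (s - t₀) ^ 2 ≤ (2 * r) ^ 2 := by
          rw [← sq_abs]
          have : |s - t₀| ≤ 2 * r := by
            rw [abs_le]; constructor <;> linarith [h1.1, h1.2, ht₀.1, ht₀.2]
          gcongr
        have e1 : q t s = (δ * normalChord fneg fpos s t₀)
            * ((heatK a t (graphPt p e F s - y) / (2 * t)) * V (graphPt p e F s)) := by
          simp only [hq]; ring
        rw [e1, norm_mul, norm_mul, norm_mul (|δ| * (N * (2 * r) ^ 2))]
        refine mul_le_mul_of_nonneg_right ?_ (norm_nonneg _)
        rw [Real.norm_eq_abs, Real.norm_eq_abs, Real.norm_eq_abs,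
          abs_of_nonneg (by positivity : 0 ≤ |δ| * (N * (2 * r) ^ 2))]
        gcongr
        exact h2.trans (by gcongr)
  -- a lower bound of the kernel at times in `[γ ^ 2, 2 γ ^ 2]` and distances at most `Λ γ`
  set lam := Real.exp (-2) * Real.exp (-(Λ ^ 2 / 4)) / (32 * Real.pi * γ ^ 4) with hlam
  have hlam0 : 0 < lam := by positivity
  have hmain : ∀ t ∈ Icc (γ ^ 2) (2 * γ ^ 2), δ ^ 2 * γ / 2 * lam * m * (2 * (k * γ))
      ≤ ∫ s, q t s := by
    intro t ht
    have ht0 : 0 < t := lt_of_lt_of_le (by positivity) ht.1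
    have hpt : ∀ s ∈ Icc (-(2 * γ) - k * γ) (-(2 * γ) + k * γ),
        δ ^ 2 * γ / 2 * lam * m ≤ q t s := by
      intro s hs
      by_cases hs0 : V (graphPt p e F s) = 0
      · have : m = 0 := le_antisymm ((hm s hs).trans hs0.le) hm0
        simp [this, hq, hs0]
      · have h1 := hVs s hs0
        have h2 := hm s hs
        have h3 := hchord s hs0
        have h4 : lam ≤ heatK a t (graphPt p e F s - y) / (2 * t) := by
          have hz : ‖graphPt p e F s - y‖ ≤ Λ * γ := by
            refine (norm_graphPt_sub_le p e F (hL s ⟨by linarith [h1.1], by linarith [h1.2]⟩ t₀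
              ⟨by linarith [ht₀.1], by linarith [ht₀.2]⟩)).trans ?_
            have : |s - t₀| ≤ 6 * γ := by
              rw [abs_le]; constructor <;> linarith [h1.1, h1.2, ht₀.1, ht₀.2]
            calc (1 + L) * |s - t₀| ≤ (1 + L) * (6 * γ) := by gcongr
              _ = Λ * γ := by rw [hΛ]; ring
          have c1 : Real.exp (-2) ≤ Real.exp (-(a * t)) := by
            refine Real.exp_le_exp.2 (neg_le_neg ?_)
            rw [hadef, inv_pow, inv_mul_le_iff₀ (by positivity)]
            linarith [ht.2]
          have c2 : Real.exp (-(Λ ^ 2 / 4))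
              ≤ Real.exp (-(‖graphPt p e F s - y‖ ^ 2 / (4 * t))) := by
            refine Real.exp_le_exp.2 (neg_le_neg ?_)
            rw [div_le_div_iff₀ (by positivity) (by norm_num)]
            have : ‖graphPt p e F s - y‖ ^ 2 ≤ (Λ * γ) ^ 2 := by gcongr
            have : Λ ^ 2 * γ ^ 2 ≤ Λ ^ 2 * t := by gcongr; exact ht.1
            nlinarith
          have c3 : (8 * Real.pi * γ ^ 2)⁻¹ ≤ (4 * Real.pi * t)⁻¹ := by
            refine inv_anti₀ (by positivity) ?_
            nlinarith [Real.pi_pos, ht.2]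
          have c4 : (4 * γ ^ 2)⁻¹ ≤ (2 * t)⁻¹ :=
            inv_anti₀ (by positivity) (by linarith [ht.2])
          calc lam = Real.exp (-2) * (8 * Real.pi * γ ^ 2)⁻¹ * Real.exp (-(Λ ^ 2 / 4))
                * (4 * γ ^ 2)⁻¹ := by rw [hlam]; field_simp; norm_num
            _ ≤ Real.exp (-(a * t)) * (4 * Real.pi * t)⁻¹
                * Real.exp (-(‖graphPt p e F s - y‖ ^ 2 / (4 * t))) * (2 * t)⁻¹ := by gcongr
            _ = _ := by rw [heatK, div_eq_mul_inv _ (2 * t)]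
        have hd : 0 ≤ δ ^ 2 * γ / 2 := by positivity
        have hn := hd.trans h3
        exact mul_le_mul (mul_le_mul h3 h4 hlam0.le hn) h2 hm0 (mul_nonneg hn (hlam0.le.trans h4))
    calc δ ^ 2 * γ / 2 * lam * m * (2 * (k * γ))
        = ∫ _ in Icc (-(2 * γ) - k * γ) (-(2 * γ) + k * γ), δ ^ 2 * γ / 2 * lam * m := by
          rw [setIntegral_const, Real.volume_real_Icc_of_le (by nlinarith), smul_eq_mul]
          ring
      _ ≤ ∫ s in Icc (-(2 * γ) - k * γ) (-(2 * γ) + k * γ), q t s :=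
          setIntegral_mono_on (integrableOn_const measure_Icc_lt_top.ne) (hqi t).integrableOn measurableSet_Icc hpt
      _ ≤ ∫ s, q t s := setIntegral_le_integral (hqi t) (Eventually.of_forall (hq0 t ht0))
  -- passage to the limit in Green's representation
  have hlim := ((Complex.continuous_re.tendsto _).comp
    (tendsto_boundaryTerm ha hus huc y Ω)).const_mul (-δ)
  -- the heat semigroup contributes nothing, because `u` vanishes at the pole `y`
  have hW : Tendsto (fun ε => -δ * (∫ x in Ω, ((heatK a ε (x - y) : ℝ) : ℂ) * u x).re) (𝓝[>] 0)
      (𝓝 0) := by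
    have h1 : Tendsto (fun ε => ∫ x in Ω, ((heatK a ε (x - y) : ℝ) : ℂ) * u x) (𝓝[>] 0) (𝓝 0) := by
      have h2 := tendsto_integral_heatK a hus.continuous.norm huc.norm y
      rw [huy, norm_zero] at h2
      refine squeeze_zero_norm' ?_ h2
      filter_upwards [self_mem_nhdsWithin] with ε hε
      exact norm_setIntegral_heatK_le a hε hus.continuous huc y Ω
    simpa using ((Complex.continuous_re.tendsto _).comp h1).const_mul (-δ)
  have hlim2 := hlim.sub hW
  rw [sub_zero] at hlim2
  refine ge_of_tendsto hlim2 ?_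
  filter_upwards [Ioo_mem_nhdsGT (show (0 : ℝ) < γ ^ 2 by positivity)] with ε hε
  have hbi := integrableOn_boundaryTerm ha hus huc y Ω hε.1
  have hqI : IntegrableOn (fun t => ∫ s, q t s) (Ioi ε) := by
    have := (hbi.re).const_mul (-δ)
    refine this.congr (Eventually.of_forall fun t => ?_)
    exact hbt t
  have e1 : -δ * (∫ t in Ioi ε, boundaryTerm a Ω u y t).re = ∫ t in Ioi ε, ∫ s, q t s := by
    have h1 : (∫ t in Ioi ε, boundaryTerm a Ω u y t).re
        = ∫ t in Ioi ε, (boundaryTerm a Ω u y t).re := (integral_re hbi).symm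
    rw [h1, ← integral_const_mul]
    exact integral_congr_ae (Eventually.of_forall fun t => hbt t)
  have e2 : P * m ≤ ∫ t in Ioi ε, ∫ s, q t s := by
    have hsub : Icc (γ ^ 2) (2 * γ ^ 2) ⊆ Ioi ε := fun t ht => hε.2.trans_le ht.1
    calc P * m = ∫ _ in Icc (γ ^ 2) (2 * γ ^ 2), δ ^ 2 * γ / 2 * lam * m * (2 * (k * γ)) := by
          rw [setIntegral_const, Real.volume_real_Icc_of_le (by nlinarith [sq_nonneg γ]),
            smul_eq_mul, hP, hlam]
          field_simp
          ring
      _ ≤ ∫ t in Icc (γ ^ 2) (2 * γ ^ 2), ∫ s, q t s :=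
          setIntegral_mono_on (integrableOn_const measure_Icc_lt_top.ne) (hqI.mono_set hsub) measurableSet_Icc hmain
      _ ≤ ∫ t in Ioi ε, ∫ s, q t s := by
          refine setIntegral_mono_set hqI ?_ hsub.eventuallyLE
          filter_upwards [ae_restrict_mem measurableSet_Ioi] with t ht
          exact integral_nonneg (hq0 t (hε.1.trans ht))
  have e3 : ∀ A B : ℂ, -δ * (A + B).re - -δ * B.re = -δ * A.re := fun A B => by
    rw [Complex.add_re]; ring
  change _ ≤ -δ * (_ + _ : ℂ).re - -δ * _
  rw [e3, e1]
  exact e2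

/-! ### Square integrable functionals and the interpolation norms -/

theorem enorm_integral_mul_le {α : Type*} [MeasurableSpace α] {μ : Measure α} {f g : α → ℂ}
    (hf : AEStronglyMeasurable f μ) (hg : AEStronglyMeasurable g μ) :
    ‖∫ x, f x * g x ∂μ‖ₑ ≤ eLpNorm f 2 μ * eLpNorm g 2 μ := by
  have : ENNReal.HolderTriple 2 2 1 := ⟨by rw [inv_one]; exact ENNReal.inv_two_add_inv_two⟩
  calc ‖∫ x, f x * g x ∂μ‖ₑ ≤ ∫⁻ x, ‖f x * g x‖ₑ ∂μ := enorm_integral_le_lintegral_enorm _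
    _ = eLpNorm (f • g) 1 μ := by rw [eLpNorm_one_eq_lintegral_enorm]; rfl
    _ ≤ _ := eLpNorm_smul_le_mul_eLpNorm hg hf

theorem integrable_mul_of_memLp {α : Type*} [MeasurableSpace α] {μ : Measure α} {f g : α → ℂ}
    (hf : MemLp f 2 μ) (hg : MemLp g 2 μ) : Integrable (fun x => f x * g x) μ :=
  hf.integrable_mul hg

theorem tendsto_integral_mul {α : Type*} [MeasurableSpace α] {μ : Measure α} {g f : α → ℂ}
    {u : ℕ → α → ℂ} (hg : MemLp g 2 μ) (hf : MemLp f 2 μ) (hu : ∀ n, MemLp (u n) 2 μ)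
    (h : Tendsto (fun n => eLpNorm (u n - f) 2 μ) atTop (𝓝 0)) :
    Tendsto (fun n => ∫ x, g x * u n x ∂μ) atTop (𝓝 (∫ x, g x * f x ∂μ)) := by
  rw [tendsto_iff_edist_tendsto_0]
  have h0 : Tendsto (fun n => eLpNorm g 2 μ * eLpNorm (u n - f) 2 μ) atTop (𝓝 0) := by
    have := ENNReal.Tendsto.const_mul (a := eLpNorm g 2 μ) h (Or.inr hg.2.ne)
    rwa [mul_zero] at this
  refine tendsto_of_tendsto_of_tendsto_of_le_of_le tendsto_const_nhds h0 (fun _ => zero_le)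
    fun n => ?_
  have e : (∫ x, g x * u n x ∂μ) - ∫ x, g x * f x ∂μ = ∫ x, g x * (u n - f) x ∂μ := by
    rw [← integral_sub (integrable_mul_of_memLp hg (hu n)) (integrable_mul_of_memLp hg hf)]
    simp [mul_sub]
  change edist (∫ x, g x * u n x ∂μ) (∫ x, g x * f x ∂μ) ≤ _
  rw [edist_eq_enorm_sub, e]
  exact enorm_integral_mul_le hg.1 ((hu n).sub hf).1

/-- The functional `v ↦ ∫ f v dσ` on `H^{1/2}(Γ)`. -/
def ofL2 {Ω : Set Plane} (f : Lp ℂ 2 (arcMeasure (frontier Ω))) : Functional Ω where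
  toFun v := ∫ x, f x * (v : Lp ℂ 2 (arcMeasure (frontier Ω))) x ∂(arcMeasure (frontier Ω))
  map_add' v w := by
    rw [← integral_add (integrable_mul_of_memLp (Lp.memLp f) (Lp.memLp v.1))
      (integrable_mul_of_memLp (Lp.memLp f) (Lp.memLp w.1))]
    refine integral_congr_ae ?_
    filter_upwards [Lp.coeFn_add v.1 w.1] with x hx
    rw [Submodule.coe_add, hx]
    simp [mul_add]
  map_smul' c v := by
    rw [RingHom.id_apply, smul_eq_mul, ← integral_const_mul]
    refine integral_congr_ae ?_
    filter_upwards [Lp.coeFn_smul c v.1] with x hx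
    rw [Submodule.coe_smul, hx]
    simp only [Pi.smul_apply, smul_eq_mul]
    ring

theorem ofL2_apply {Ω : Set Plane} (f : Lp ℂ 2 (arcMeasure (frontier Ω))) (v : HHalf Ω) :
    ofL2 f v = ∫ x, f x * (v : Lp ℂ 2 (arcMeasure (frontier Ω))) x ∂(arcMeasure (frontier Ω)) := rfl

theorem l2Norm_ofL2_le {Ω : Set Plane} (f : Lp ℂ 2 (arcMeasure (frontier Ω))) :
    l2Norm Ω (ofL2 f) ≤ ‖f‖ₑ := iInf₂_le f fun _ => rfl

theorem ofL2_add {Ω : Set Plane} (f g : Lp ℂ 2 (arcMeasure (frontier Ω))) :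
    ofL2 (f + g) = ofL2 f + ofL2 g := by
  ext v
  rw [LinearMap.add_apply, ofL2_apply, ofL2_apply, ofL2_apply,
    ← integral_add (integrable_mul_of_memLp (Lp.memLp f) (Lp.memLp v.1))
      (integrable_mul_of_memLp (Lp.memLp g) (Lp.memLp v.1))]
  refine integral_congr_ae ?_
  filter_upwards [Lp.coeFn_add f g] with x hx
  rw [hx]
  simp [add_mul]

theorem ofL2_smul {Ω : Set Plane} (c : ℂ) (f : Lp ℂ 2 (arcMeasure (frontier Ω))) :
    ofL2 (c • f) = c • ofL2 f := by
  ext v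
  rw [LinearMap.smul_apply, ofL2_apply, ofL2_apply, smul_eq_mul, ← integral_const_mul]
  refine integral_congr_ae ?_
  filter_upwards [Lp.coeFn_smul c f] with x hx
  rw [hx]
  simp only [Pi.smul_apply, smul_eq_mul]
  ring

theorem enorm_apply_le_l2Norm {Ω : Set Plane} (φ : Functional Ω) (v : HHalf Ω) :
    ‖φ v‖ₑ ≤ l2Norm Ω φ * ‖(v : Lp ℂ 2 (arcMeasure (frontier Ω)))‖ₑ := by
  unfold l2Norm
  by_cases h0 : ‖(v : Lp ℂ 2 (arcMeasure (frontier Ω)))‖ₑ = 0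
  · have hv : v = 0 := by simpa using h0
    simp [hv]
  rw [ENNReal.iInf_mul' (fun h => absurd h enorm_ne_top) (fun h => absurd h h0)]
  refine le_iInf fun f => ?_
  rw [ENNReal.iInf_mul' (fun h => absurd h enorm_ne_top) (fun h => absurd h h0)]
  refine le_iInf fun hf => ?_
  rw [hf v]
  refine (enorm_integral_mul_le (Lp.aestronglyMeasurable f) (Lp.aestronglyMeasurable v.1)).trans ?_
  rw [Lp.enorm_def, Lp.enorm_def]

theorem enorm_apply_le_dualNorm {γ : ℝ} {Ω : Set Plane} {j : Fin 2} (φ : Functional Ω)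
    {v : HHalf Ω} (hv : hHalfNorm γ Ω j v ≤ 1) : ‖φ v‖ₑ ≤ dualNorm γ Ω j φ :=
  le_iSup₂ (f := fun (v : HHalf Ω) (_ : hHalfNorm γ Ω j v ≤ 1) => ‖φ v‖ₑ) v hv

theorem l2Norm_zero (Ω : Set Plane) : l2Norm Ω (0 : Functional Ω) = 0 := by
  refine le_antisymm ?_ zero_le
  have e : (0 : Functional Ω) = ofL2 0 := by
    have := ofL2_smul (Ω := Ω) 0 0
    rw [zero_smul, zero_smul] at this
    exact this.symm
  rw [e]
  exact (l2Norm_ofL2_le 0).trans (by simp)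

theorem dualNorm_zero (γ : ℝ) (Ω : Set Plane) (j : Fin 2) :
    dualNorm γ Ω j (0 : Functional Ω) = 0 := by
  simp [dualNorm]

theorem sum_sq_rpow_sq (f : Fin 2 → ℝ≥0∞) :
    ((∑ j, f j ^ 2) ^ (1 / 2 : ℝ)) ^ 2 = f 0 ^ 2 + f 1 ^ 2 := by
  rw [← ENNReal.rpow_natCast, ← ENNReal.rpow_mul, Fin.sum_univ_two]
  norm_num

theorem pairL2Norm_sq (Ω : Set Plane) (φ : NeumannPair Ω) :
    pairL2Norm Ω φ ^ 2 = l2Norm Ω (φ 0) ^ 2 + l2Norm Ω (φ 1) ^ 2 :=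
  sum_sq_rpow_sq fun j => l2Norm Ω (φ j)

theorem pairDualNorm_sq (γ : ℝ) (Ω : Set Plane) (φ : NeumannPair Ω) :
    pairDualNorm γ Ω φ ^ 2 = dualNorm γ Ω 0 (φ 0) ^ 2 + dualNorm γ Ω 1 (φ 1) ^ 2 :=
  sum_sq_rpow_sq fun j => dualNorm γ Ω j (φ j)

theorem l2Norm_le_pairL2Norm (Ω : Set Plane) (φ : NeumannPair Ω) :
    l2Norm Ω (φ 1) ≤ pairL2Norm Ω φ := by
  rw [← ENNReal.pow_le_pow_left_iff two_ne_zero, pairL2Norm_sq]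
  exact le_add_self

theorem dualNorm_le_pairDualNorm (γ : ℝ) (Ω : Set Plane) (φ : NeumannPair Ω) :
    dualNorm γ Ω 1 (φ 1) ≤ pairDualNorm γ Ω φ := by
  rw [← ENNReal.pow_le_pow_left_iff two_ne_zero, pairDualNorm_sq]
  exact le_add_self

theorem pairL2Norm_of_zero {Ω : Set Plane} {φ : NeumannPair Ω} (h : φ 0 = 0) :
    pairL2Norm Ω φ = l2Norm Ω (φ 1) := by
  rw [← (ENNReal.pow_right_strictMono two_ne_zero).injective.eq_iff, pairL2Norm_sq, h, l2Norm_zero]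
  simp

theorem pairDualNorm_of_zero {γ : ℝ} {Ω : Set Plane} {φ : NeumannPair Ω} (h : φ 0 = 0) :
    pairDualNorm γ Ω φ = dualNorm γ Ω 1 (φ 1) := by
  rw [← (ENNReal.pow_right_strictMono two_ne_zero).injective.eq_iff, pairDualNorm_sq, h,
    dualNorm_zero]
  simp

theorem kFunctionalSq_le_left (γ : ℝ) (Ω : Set Plane) (t : ℝ) (φ : NeumannPair Ω) :
    kFunctionalSq γ Ω t φ ≤ pairL2Norm Ω φ ^ 2 := by
  refine (iInf_le _ φ).trans ?_
  have : pairDualNorm γ Ω (φ - φ) = 0 := by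
    rw [sub_self, pairDualNorm_of_zero rfl]
    exact dualNorm_zero γ Ω 1
  rw [this]
  simp

theorem kFunctionalSq_le_right (γ : ℝ) (Ω : Set Plane) (t : ℝ) (φ : NeumannPair Ω) :
    kFunctionalSq γ Ω t φ ≤ ENNReal.ofReal (t ^ 2) * pairDualNorm γ Ω φ ^ 2 := by
  refine (iInf_le _ 0).trans ?_
  have : pairL2Norm Ω (0 : NeumannPair Ω) = 0 := by
    rw [pairL2Norm_of_zero rfl]
    exact l2Norm_zero Ω
  rw [this]
  simp

theorem kFunctionalSq_le {γ : ℝ} {Ω : Set Plane} {φ : NeumannPair Ω} {α β : ℝ}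
    (hα0 : 0 ≤ α) (hβ0 : 0 ≤ β) (hα : pairL2Norm Ω φ ≤ ENNReal.ofReal α)
    (hβ : pairDualNorm γ Ω φ ≤ ENNReal.ofReal β) (t : ℝ) :
    kFunctionalSq γ Ω t φ ≤ ENNReal.ofReal (min (α ^ 2) (t ^ 2 * β ^ 2)) := by
  rw [ENNReal.ofReal_min]
  refine le_min ((kFunctionalSq_le_left γ Ω t φ).trans ?_)
    ((kFunctionalSq_le_right γ Ω t φ).trans ?_)
  · rw [ENNReal.ofReal_pow hα0]
    gcongr
  · rw [ENNReal.ofReal_mul (sq_nonneg t), ENNReal.ofReal_pow hβ0]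
    gcongr

/-- Testing against a single function bounds the `K`-functional from below at all scales: in any
decomposition one of the two parts carries half of the value. -/
theorem le_kFunctionalSq {γ : ℝ} {Ω : Set Plane} {χ : NeumannPair Ω} {v : HHalf Ω} {A P : ℝ}
    (hA : 0 < A) (hP : 0 ≤ P) (hv : hHalfNorm γ Ω 1 v ≤ 1)
    (hvA : ‖(v : Lp ℂ 2 (arcMeasure (frontier Ω)))‖ ≤ A) (hχ : P ≤ ‖χ 1 v‖) (t : ℝ) :
    ENNReal.ofReal (min ((P / (2 * A)) ^ 2) ((t * (P / 2)) ^ 2)) ≤ kFunctionalSq γ Ω t χ := by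
  refine le_iInf fun ζ => ?_
  have hvA' : ‖(v : Lp ℂ 2 (arcMeasure (frontier Ω)))‖ₑ ≤ ENNReal.ofReal A := by
    rw [← ofReal_norm]; exact ENNReal.ofReal_le_ofReal hvA
  -- either the square integrable part `ζ` or the remainder `χ - ζ` has at least half of the value at `v`
  by_cases h : P / 2 ≤ ‖ζ 1 v‖
  · refine le_trans ?_ le_self_add
    have h1 : ENNReal.ofReal (P / 2) ≤ pairL2Norm Ω ζ * ENNReal.ofReal A :=
      calc ENNReal.ofReal (P / 2) ≤ ‖ζ 1 v‖ₑ := by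
            rw [← ofReal_norm]; exact ENNReal.ofReal_le_ofReal h
        _ ≤ _ := (enorm_apply_le_l2Norm _ v).trans (by gcongr; exact l2Norm_le_pairL2Norm Ω ζ)
    have h2 : ENNReal.ofReal (P / (2 * A)) ≤ pairL2Norm Ω ζ := by
      rw [← div_div, ENNReal.ofReal_div_of_pos hA]
      exact ENNReal.div_le_of_le_mul h1
    refine (ENNReal.ofReal_le_ofReal (min_le_left _ _)).trans ?_
    rw [ENNReal.ofReal_pow (by positivity)]
    gcongr
  · refine le_trans ?_ le_add_self
    have h1 : P / 2 ≤ ‖(χ - ζ) 1 v‖ := by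
      have : ‖χ 1 v‖ - ‖ζ 1 v‖ ≤ ‖χ 1 v - ζ 1 v‖ := norm_sub_norm_le _ _
      have e : (χ - ζ) 1 v = χ 1 v - ζ 1 v := rfl
      rw [e]
      linarith
    have h2 : ENNReal.ofReal (P / 2) ≤ pairDualNorm γ Ω (χ - ζ) :=
      calc ENNReal.ofReal (P / 2) ≤ ‖(χ - ζ) 1 v‖ₑ := by
            rw [← ofReal_norm]; exact ENNReal.ofReal_le_ofReal h1
        _ ≤ _ := (enorm_apply_le_dualNorm _ hv).trans (dualNorm_le_pairDualNorm γ Ω _)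
    refine (ENNReal.ofReal_le_ofReal (min_le_right _ _)).trans ?_
    rw [mul_pow, ENNReal.ofReal_mul (sq_nonneg t), ENNReal.ofReal_pow (p := P / 2) (by positivity)]
    gcongr

/-- Comparison of norms, uniformly in the interpolation parameter. -/
theorem le_hsNorm {γ : ℝ} {Ω : Set Plane} {φ χ : NeumannPair Ω} {v : HHalf Ω} {A P α β c s : ℝ}
    (hA : 0 < A) (hP : 0 ≤ P) (hv : hHalfNorm γ Ω 1 v ≤ 1)
    (hvA : ‖(v : Lp ℂ 2 (arcMeasure (frontier Ω)))‖ ≤ A) (hχ : P ≤ ‖χ 1 v‖)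
    (hα0 : 0 ≤ α) (hβ0 : 0 ≤ β) (hα : pairL2Norm Ω φ ≤ ENNReal.ofReal α)
    (hβ : pairDualNorm γ Ω φ ≤ ENNReal.ofReal β) (hc0 : 0 ≤ c)
    (h1 : c * α ≤ P / (2 * A)) (h2 : c * β ≤ P / 2) :
    ENNReal.ofReal c * hsNorm γ Ω s φ ≤ hsNorm γ Ω s χ := by
  have hvA' : ‖(v : Lp ℂ 2 (arcMeasure (frontier Ω)))‖ₑ ≤ ENNReal.ofReal A := by
    rw [← ofReal_norm]; exact ENNReal.ofReal_le_ofReal hvA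
  have hPe : ENNReal.ofReal P ≤ ‖χ 1 v‖ₑ := by
    rw [← ofReal_norm]; exact ENNReal.ofReal_le_ofReal hχ
  unfold hsNorm
  split_ifs with hs hs'
  · calc ENNReal.ofReal c * pairL2Norm Ω φ ≤ ENNReal.ofReal c * ENNReal.ofReal α := by gcongr
      _ = ENNReal.ofReal (c * α) := (ENNReal.ofReal_mul hc0).symm
      _ ≤ ENNReal.ofReal (P / A) := ENNReal.ofReal_le_ofReal (h1.trans (by
          gcongr; linarith))
      _ ≤ pairL2Norm Ω χ := by
          rw [ENNReal.ofReal_div_of_pos hA]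
          refine ENNReal.div_le_of_le_mul (hPe.trans ((enorm_apply_le_l2Norm _ v).trans ?_))
          gcongr
          exact l2Norm_le_pairL2Norm Ω χ
  · calc ENNReal.ofReal c * pairDualNorm γ Ω φ ≤ ENNReal.ofReal c * ENNReal.ofReal β := by gcongr
      _ = ENNReal.ofReal (c * β) := (ENNReal.ofReal_mul hc0).symm
      _ ≤ ENNReal.ofReal P := ENNReal.ofReal_le_ofReal (h2.trans (by linarith))
      _ ≤ pairDualNorm γ Ω χ :=
          hPe.trans ((enorm_apply_le_dualNorm _ hv).trans (dualNorm_le_pairDualNorm γ Ω _))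
  · have hk : ∀ t ∈ Ioi (0 : ℝ), ENNReal.ofReal (c ^ 2) * kFunctionalSq γ Ω t φ
        ≤ kFunctionalSq γ Ω t χ := by
      intro t ht
      have ht0 : (0 : ℝ) < t := ht
      calc ENNReal.ofReal (c ^ 2) * kFunctionalSq γ Ω t φ
          ≤ ENNReal.ofReal (c ^ 2) * ENNReal.ofReal (min (α ^ 2) (t ^ 2 * β ^ 2)) := by
            gcongr; exact kFunctionalSq_le hα0 hβ0 hα hβ t
        _ = ENNReal.ofReal (min ((c * α) ^ 2) ((t * (c * β)) ^ 2)) := by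
            rw [← ENNReal.ofReal_mul (sq_nonneg c), mul_min_of_nonneg _ _ (sq_nonneg c)]
            congr 2 <;> ring
        _ ≤ ENNReal.ofReal (min ((P / (2 * A)) ^ 2) ((t * (P / 2)) ^ 2)) := by gcongr
        _ ≤ _ := le_kFunctionalSq hA hP hv hvA hχ t
    unfold interpNorm
    have e : ENNReal.ofReal c = ENNReal.ofReal (c ^ 2) ^ (1 / 2 : ℝ) := by
      rw [ENNReal.ofReal_pow hc0, ← ENNReal.rpow_natCast, ← ENNReal.rpow_mul]
      norm_num
    rw [e, ← ENNReal.mul_rpow_of_nonneg _ _ (by norm_num)]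
    refine ENNReal.rpow_le_rpow ?_ (by norm_num)
    rw [mul_left_comm]
    gcongr
    rw [← lintegral_const_mul' _ _ ENNReal.ofReal_ne_top]
    refine setLIntegral_mono' measurableSet_Ioi fun t ht => ?_
    rw [mul_left_comm]
    gcongr
    exact hk t ht

theorem hsNorm_pos {γ : ℝ} {Ω : Set Plane} {χ : NeumannPair Ω} {v : HHalf Ω} {A P s : ℝ}
    (hA : 0 < A) (hP : 0 < P) (hv : hHalfNorm γ Ω 1 v ≤ 1)
    (hvA : ‖(v : Lp ℂ 2 (arcMeasure (frontier Ω)))‖ ≤ A) (hχ : P ≤ ‖χ 1 v‖)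
    (hs1 : -(1 / 2) ≤ s) (hs0 : s ≤ 0) : 0 < hsNorm γ Ω s χ := by
  have hvA' : ‖(v : Lp ℂ 2 (arcMeasure (frontier Ω)))‖ₑ ≤ ENNReal.ofReal A := by
    rw [← ofReal_norm]; exact ENNReal.ofReal_le_ofReal hvA
  have hPe : ENNReal.ofReal P ≤ ‖χ 1 v‖ₑ := by
    rw [← ofReal_norm]; exact ENNReal.ofReal_le_ofReal hχ
  have hP' : 0 < ENNReal.ofReal P := ENNReal.ofReal_pos.2 hP
  unfold hsNorm
  split_ifs with hs hs'
  · refine pos_iff_ne_zero.2 fun h0 => ?_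
    have h1 := hPe.trans ((enorm_apply_le_l2Norm _ v).trans
      (mul_le_mul_left (l2Norm_le_pairL2Norm Ω χ) _))
    rw [h0, zero_mul] at h1
    exact absurd h1 (not_le.2 hP')
  · exact hP'.trans_le (hPe.trans ((enorm_apply_le_dualNorm _ hv).trans
      (dualNorm_le_pairDualNorm γ Ω _)))
  · have hθ0 : 0 < -2 * s := by
      have := lt_of_le_of_ne hs0 hs
      linarith
    have hθ1 : -2 * s < 1 := by
      have := lt_of_le_of_ne hs1 (Ne.symm hs')
      linarith
    set θ := -2 * s with hθ
    set μ := min ((P / (2 * A)) ^ 2) ((1 * (P / 2)) ^ 2) with hμ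
    have hμ0 : 0 < μ := lt_min (by positivity) (by positivity)
    have hsin : 0 < Real.sin (Real.pi * θ) :=
      Real.sin_pos_of_pos_of_lt_pi (by positivity) (by nlinarith [Real.pi_pos])
    refine ENNReal.rpow_pos_of_nonneg ?_ (by norm_num)
    refine ENNReal.mul_pos (ENNReal.ofReal_pos.2 (by positivity)).ne' ?_
    have h1 : ∫⁻ _ in Ioc (1 : ℝ) 2, ENNReal.ofReal ((2 : ℝ) ^ (-2 * θ - 1)) * ENNReal.ofReal μ
        ≤ ∫⁻ t in Ioi (0 : ℝ), ENNReal.ofReal (t ^ (-2 * θ - 1)) * kFunctionalSq γ Ω t χ := by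
      refine (setLIntegral_mono' measurableSet_Ioc fun t ht => ?_).trans
        (lintegral_mono_set fun t ht => one_pos.trans ht.1)
      have ht0 : 0 < t := one_pos.trans ht.1
      refine mul_le_mul' (ENNReal.ofReal_le_ofReal
        (Real.rpow_le_rpow_of_nonpos ht0 ht.2 (by linarith))) ?_
      refine le_trans (ENNReal.ofReal_le_ofReal ?_) (le_kFunctionalSq hA hP.le hv hvA hχ t)
      have := ht.1.le
      rw [hμ]
      gcongr
    refine (lt_of_lt_of_le ?_ h1).ne'
    rw [lintegral_const]
    refine ENNReal.mul_pos (mul_ne_zero ?_ ?_) ?_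
    · exact (ENNReal.ofReal_pos.2 (by positivity)).ne'
    · exact (ENNReal.ofReal_pos.2 hμ0).ne'
    · simp

theorem memHs_of_lt_top {γ : ℝ} {Ω : Set Plane} {φ : NeumannPair Ω} {s : ℝ}
    (hα : pairL2Norm Ω φ < ⊤) (hβ : pairDualNorm γ Ω φ < ⊤)
    (hs1 : -(1 / 2) ≤ s) (hs0 : s ≤ 0) : MemHs γ Ω s φ := by
  unfold MemHs hsNorm
  split_ifs with hs hs'
  · exact hα
  · exact hβ
  have hθ0 : 0 < -2 * s := by
    have := lt_of_le_of_ne hs0 hs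
    linarith
  have hθ1 : -2 * s < 1 := by
    have := lt_of_le_of_ne hs1 (Ne.symm hs')
    linarith
  set θ := -2 * s with hθ
  refine ENNReal.rpow_lt_top_of_nonneg (by norm_num) (ENNReal.mul_ne_top ENNReal.ofReal_ne_top ?_)
  refine ne_of_lt ?_
  rw [← Ioc_union_Ioi_eq_Ioi (zero_le_one' ℝ)]
  refine (lintegral_union_le _ _ _).trans_lt (ENNReal.add_lt_top.2 ⟨?_, ?_⟩)
  · have hi : IntegrableOn (fun t : ℝ => t ^ (1 - 2 * θ)) (Ioc 0 1) :=
      (intervalIntegrable_iff_integrableOn_Ioc_of_le zero_le_one).1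
        (intervalIntegral.intervalIntegrable_rpow' (by linarith))
    refine lt_of_le_of_lt (b := ∫⁻ t in Ioc (0 : ℝ) 1, ENNReal.ofReal (t ^ (1 - 2 * θ))
      * pairDualNorm γ Ω φ ^ 2) (setLIntegral_mono' measurableSet_Ioc fun t ht => ?_) ?_
    · refine (mul_le_mul_right (kFunctionalSq_le_right γ Ω t φ) _).trans (le_of_eq ?_)
      rw [← mul_assoc, ← ENNReal.ofReal_mul (Real.rpow_nonneg ht.1.le _), ← Real.rpow_natCast t 2,
        ← Real.rpow_add ht.1]
      congr 3
      push_cast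
      ring
    · rw [lintegral_mul_const' _ _ (ENNReal.pow_ne_top hβ.ne)]
      exact ENNReal.mul_lt_top hi.lintegral_lt_top (ENNReal.pow_lt_top hβ)
  · have hi : IntegrableOn (fun t : ℝ => t ^ (-2 * θ - 1)) (Ioi 1) :=
      integrableOn_Ioi_rpow_of_lt (by linarith) one_pos
    refine lt_of_le_of_lt (b := ∫⁻ t in Ioi (1 : ℝ), ENNReal.ofReal (t ^ (-2 * θ - 1))
      * pairL2Norm Ω φ ^ 2) (setLIntegral_mono' measurableSet_Ioi fun t _ =>
        mul_le_mul_right (kFunctionalSq_le_left γ Ω t φ) _) ?_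
    rw [lintegral_mul_const' _ _ (ENNReal.pow_ne_top hα.ne)]
    exact ENNReal.mul_lt_top hi.lintegral_lt_top (ENNReal.pow_lt_top hα)

/-! ### Traces of smooth functions -/

theorem classicalGrad_apply (u : Plane → ℂ) (x : Plane) (i : Fin 2) :
    classicalGrad u x i = partialD i u x := rfl

namespace IsTestFunction

variable {Ω : Set Plane} {ξ : Plane → ℝ}

theorem contDiff_ofReal (hξ : IsTestFunction Ω ξ) : ContDiff ℝ ∞ fun x => (ξ x : ℂ) :=
  Complex.ofRealCLM.contDiff.comp hξ.smooth

theorem hasCompactSupport_ofReal (hξ : IsTestFunction Ω ξ) :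
    HasCompactSupport fun x => (ξ x : ℂ) :=
  hξ.compact.comp_left (g := fun t : ℝ => (t : ℂ)) (by simp)

theorem partialD_ofReal (hξ : IsTestFunction Ω ξ) (i : Fin 2) (x : Plane) :
    partialD i (fun x => (ξ x : ℂ)) x
      = ((fderiv ℝ ξ x (EuclideanSpace.single i 1) : ℝ) : ℂ) := by
  have h := ((hξ.smooth.differentiable (by simp) x).hasFDerivAt)
  have h2 := (Complex.ofRealCLM.hasFDerivAt (x := ξ x)).comp x h
  have h3 : HasFDerivAt (fun x => (ξ x : ℂ)) (Complex.ofRealCLM.comp (fderiv ℝ ξ x)) x := h2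
  rw [partialD, h3.fderiv]
  rfl

theorem eq_zero (hξ : IsTestFunction Ω ξ) {x : Plane} (hx : x ∉ Ω) : ξ x = 0 :=
  image_eq_zero_of_notMem_tsupport fun h => hx (hξ.support h)

theorem fderiv_eq_zero (hξ : IsTestFunction Ω ξ) {x : Plane} (hx : x ∉ Ω) : fderiv ℝ ξ x = 0 :=
  image_eq_zero_of_notMem_tsupport fun h => hx (hξ.support (tsupport_fderiv_subset ℝ h))

end IsTestFunction

theorem isH1_of_contDiff (S : Set Plane) {u : Plane → ℂ} (hu : ContDiff ℝ ∞ u)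
    (hc : HasCompactSupport u) : IsH1 S u (classicalGrad u) where
  memLp := (hu.continuous.memLp_of_hasCompactSupport hc).restrict _
  memLp_grad := by
    refine ((continuous_classicalGrad hu).memLp_of_hasCompactSupport ?_).restrict _
    refine (hc.fderiv ℝ).mono fun x hx h => hx ?_
    ext i
    simp [classicalGrad, h]
  weak ξ hξ i := by
    have hξc := hξ.contDiff_ofReal
    have h1 : ContDiff ℝ 1 fun x => u x * (ξ x : ℂ) := (hu.mul hξc).of_le (by simp)
    have h2 : HasCompactSupport fun x => u x * (ξ x : ℂ) := hc.mul_right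
    have h3 := integral_fderiv_eq_zero h1 h2 (EuclideanSpace.single i 1)
    rw [← sub_eq_zero, sub_neg_eq_add, ← integral_add]
    · rw [setIntegral_eq_integral_of_forall_compl_eq_zero, ← h3]
      · congr 1
        funext x
        rw [fderiv_fun_mul (hu.differentiable (by simp) x) (hξc.differentiable (by simp) x),
          classicalGrad_apply, ← hξ.partialD_ofReal]
        simp only [partialD, add_apply, smul_apply, smul_eq_mul]
        ring
      · intro x hx
        simp [hξ.eq_zero hx, hξ.fderiv_eq_zero hx]
    · exact hξ.integrable_deriv ((hu.continuous.memLp_of_hasCompactSupport hc).restrict _) i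
    · refine Continuous.integrable_of_hasCompactSupport ?_ ?_ |>.integrableOn
      · exact (continuous_partialD (hu.of_le (by simp)) i).mul hξc.continuous
      · exact hξ.hasCompactSupport_ofReal.mul_left

/-- The class in `L²(Γ)` of a continuous function with compact support. -/
def l2Class (Γ : Set Plane) [IsFiniteMeasure (arcMeasure Γ)] {u : Plane → ℂ} (hu : Continuous u)
    (hc : HasCompactSupport u) : Lp ℂ 2 (arcMeasure Γ) :=
  (memLp_arcMeasure hu hc).toLp u

theorem hasTrace_of_contDiff (S Γ : Set Plane) [IsFiniteMeasure (arcMeasure Γ)] {u : Plane → ℂ}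
    (hu : ContDiff ℝ ∞ u) (hc : HasCompactSupport u) :
    HasTrace S Γ u (classicalGrad u) (l2Class Γ hu.continuous hc) where
  isH1 := isH1_of_contDiff S hu hc
  approx := by
    refine ⟨fun _ => u, fun _ => ⟨hu, hc⟩, by simp, by simp, ?_⟩
    refine tendsto_const_nhds.congr fun n => ?_
    rw [← eLpNorm_zero (ε := ℂ) (α := Plane) (p := 2) (μ := arcMeasure Γ)]
    refine eLpNorm_congr_ae ?_
    filter_upwards [(memLp_arcMeasure (Γ := Γ) hu.continuous hc).coeFn_toLp] with x hx
    rw [l2Class, hx]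
    simp

/-- The trace in `H^{1/2}(Γ)` of a function in `C_c^∞(ℝ²)`. -/
def smoothTrace (Ω : Set Plane) [IsFiniteMeasure (arcMeasure (frontier Ω))] {u : Plane → ℂ}
    (hu : ContDiff ℝ ∞ u) (hc : HasCompactSupport u) : HHalf Ω :=
  ⟨l2Class (frontier Ω) hu.continuous hc,
    ⟨⟨u, _, hasTrace_of_contDiff _ _ hu hc⟩, ⟨u, _, hasTrace_of_contDiff _ _ hu hc⟩⟩⟩

theorem coeFn_smoothTrace (Ω : Set Plane) [IsFiniteMeasure (arcMeasure (frontier Ω))]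
    {u : Plane → ℂ} (hu : ContDiff ℝ ∞ u) (hc : HasCompactSupport u) :
    (smoothTrace Ω hu hc : Lp ℂ 2 (arcMeasure (frontier Ω))) =ᵐ[arcMeasure (frontier Ω)] u :=
  (memLp_arcMeasure hu.continuous hc).coeFn_toLp

theorem ofL2_smoothTrace {Ω : Set Plane} [IsFiniteMeasure (arcMeasure (frontier Ω))]
    {u : Plane → ℂ} (hu : ContDiff ℝ ∞ u) (hc : HasCompactSupport u)
    (f : Lp ℂ 2 (arcMeasure (frontier Ω))) :
    ofL2 f (smoothTrace Ω hu hc) = ∫ x, f x * u x ∂(arcMeasure (frontier Ω)) := by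
  rw [ofL2_apply]
  refine integral_congr_ae ?_
  filter_upwards [coeFn_smoothTrace Ω hu hc] with x hx
  rw [hx]

theorem hHalfNorm_smoothTrace_le (γ : ℝ) {Ω : Set Plane}
    [IsFiniteMeasure (arcMeasure (frontier Ω))] (j : Fin 2)
    {u : Plane → ℂ} (hu : ContDiff ℝ ∞ u) (hc : HasCompactSupport u) :
    hHalfNorm γ Ω j (smoothTrace Ω hu hc) ≤ h1Norm γ (side Ω j) u (classicalGrad u) :=
  iInf_le_of_le u (iInf₂_le (classicalGrad u) (hasTrace_of_contDiff _ _ hu hc))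

theorem eLpNorm_grad_le_h1Norm (γ : ℝ) (S : Set Plane) (F : Plane → ℂ)
    (G : Plane → EuclideanSpace ℂ (Fin 2)) :
    eLpNorm G 2 (volume.restrict S) ≤ h1Norm γ S F G := by
  have : eLpNorm G 2 (volume.restrict S) = (eLpNorm G 2 (volume.restrict S) ^ 2) ^ (1 / 2 : ℝ) := by
    rw [← ENNReal.rpow_natCast, ← ENNReal.rpow_mul]; norm_num
  rw [this]
  exact ENNReal.rpow_le_rpow le_self_add (by norm_num)

theorem eLpNorm_le_h1Norm {γ : ℝ} (hγ : 0 < γ) (S : Set Plane) (F : Plane → ℂ)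
    (G : Plane → EuclideanSpace ℂ (Fin 2)) :
    eLpNorm F 2 (volume.restrict S) ≤ ENNReal.ofReal γ * h1Norm γ S F G := by
  have : ENNReal.ofReal γ⁻¹ * eLpNorm F 2 (volume.restrict S)
      = (ENNReal.ofReal (γ⁻¹ ^ 2) * eLpNorm F 2 (volume.restrict S) ^ 2) ^ (1 / 2 : ℝ) := by
    rw [ENNReal.ofReal_pow (by positivity), ← mul_pow, ← ENNReal.rpow_natCast, ← ENNReal.rpow_mul]
    norm_num
  have h2 : ENNReal.ofReal γ⁻¹ * eLpNorm F 2 (volume.restrict S) ≤ h1Norm γ S F G := by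
    rw [this]
    exact ENNReal.rpow_le_rpow le_add_self (by norm_num)
  calc eLpNorm F 2 (volume.restrict S)
      = ENNReal.ofReal γ * (ENNReal.ofReal γ⁻¹ * eLpNorm F 2 (volume.restrict S)) := by
        rw [← mul_assoc, ← ENNReal.ofReal_mul hγ.le, mul_inv_cancel₀ hγ.ne']; simp
    _ ≤ _ := by gcongr

/-- A bound of a functional in terms of the extensions of its argument. -/
theorem dualNorm_le {γ : ℝ} (hγ : 0 < γ) {Ω : Set Plane} {j : Fin 2} {φ : Functional Ω}
    {A B : ℝ≥0∞} (hA : A ≠ ⊤) (hB : B ≠ ⊤)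
    (h : ∀ (v : HHalf Ω) F G, HasTrace (side Ω j) (frontier Ω) F G v →
      ‖φ v‖ₑ ≤ A * eLpNorm F 2 (volume.restrict (side Ω j))
        + B * eLpNorm G 2 (volume.restrict (side Ω j))) :
    dualNorm γ Ω j φ ≤ A * ENNReal.ofReal γ + B := by
  refine iSup₂_le fun v hv => ?_
  set K := A * ENNReal.ofReal γ + B with hK
  have hKt : K ≠ ⊤ := ENNReal.add_ne_top.2 ⟨ENNReal.mul_ne_top hA ENNReal.ofReal_ne_top, hB⟩
  have h1 : ∀ F G, HasTrace (side Ω j) (frontier Ω) F G v → ‖φ v‖ₑ ≤ K * h1Norm γ (side Ω j) F G := by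
    intro F G hFG
    refine (h v F G hFG).trans ?_
    rw [hK, add_mul, mul_assoc]
    gcongr
    · exact eLpNorm_le_h1Norm hγ _ F G
    · exact eLpNorm_grad_le_h1Norm γ _ F G
  by_cases hK0 : K = 0
  · obtain ⟨F, G, hFG⟩ : (v : Lp ℂ 2 (arcMeasure (frontier Ω)))
        ∈ traceSpace (side Ω j) (frontier Ω) := by
      fin_cases j
      · exact v.2.1
      · exact v.2.2
    have := h1 F G hFG
    rw [hK0, zero_mul] at this
    exact this.trans zero_le
  · have h2 : ‖φ v‖ₑ / K ≤ hHalfNorm γ Ω j v := by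
      refine le_iInf fun F => le_iInf fun G => le_iInf fun hFG => ?_
      exact ENNReal.div_le_of_le_mul (by rw [mul_comm]; exact h1 F G hFG)
    have h3 := (ENNReal.div_le_iff hK0 hKt).1 (h2.trans hv)
    rwa [one_mul] at h3

/-- It suffices to bound a functional given by an `L²` function on smooth functions. -/
theorem enorm_ofL2_le_of_smooth {S Γ : Set Plane} {A B : ℝ≥0∞} (hA : A ≠ ⊤) (hB : B ≠ ⊤)
    {f v : Lp ℂ 2 (arcMeasure Γ)} {F : Plane → ℂ} {G : Plane → EuclideanSpace ℂ (Fin 2)}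
    [IsFiniteMeasure (arcMeasure Γ)] (hFG : HasTrace S Γ F G v)
    (h : ∀ u : Plane → ℂ, ContDiff ℝ ∞ u → HasCompactSupport u →
      ‖∫ x, f x * u x ∂(arcMeasure Γ)‖ₑ ≤ A * eLpNorm u 2 (volume.restrict S)
        + B * eLpNorm (classicalGrad u) 2 (volume.restrict S)) :
    ‖∫ x, f x * v x ∂(arcMeasure Γ)‖ₑ ≤ A * eLpNorm F 2 (volume.restrict S)
        + B * eLpNorm G 2 (volume.restrict S) := by
  obtain ⟨u, hu, h1, h2, h3⟩ := hFG.approx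
  have hlim := (tendsto_integral_mul (Lp.memLp f) (Lp.memLp v)
    (fun n => memLp_arcMeasure (hu n).1.continuous (hu n).2) h3).enorm
  have e1 : ∀ n, eLpNorm (u n) 2 (volume.restrict S)
      ≤ eLpNorm (u n - F) 2 (volume.restrict S) + eLpNorm F 2 (volume.restrict S) := fun n => by
    have := eLpNorm_add_le (((hu n).1.continuous.aestronglyMeasurable (μ := volume.restrict S)).sub
      hFG.isH1.memLp.1) hFG.isH1.memLp.1 (p := 2) (by norm_num)
    simpa using this
  have e2 : ∀ n, eLpNorm (classicalGrad (u n)) 2 (volume.restrict S)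
      ≤ eLpNorm (classicalGrad (u n) - G) 2 (volume.restrict S)
        + eLpNorm G 2 (volume.restrict S) := fun n => by
    have := eLpNorm_add_le (((continuous_classicalGrad (hu n).1).aestronglyMeasurable
      (μ := volume.restrict S)).sub hFG.isH1.memLp_grad.1) hFG.isH1.memLp_grad.1 (p := 2)
      (by norm_num)
    simpa using this
  have r1 := ENNReal.Tendsto.const_mul (a := A)
    (h1.add_const (eLpNorm F 2 (volume.restrict S))) (Or.inr hA)
  have r2 := ENNReal.Tendsto.const_mul (a := B)
    (h2.add_const (eLpNorm G 2 (volume.restrict S))) (Or.inr hB)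
  have r3 := r1.add r2
  rw [zero_add, zero_add] at r3
  refine le_of_tendsto_of_tendsto' hlim r3 fun n => (h (u n) (hu n).1 (hu n).2).trans ?_
  gcongr
  · exact e1 n
  · exact e2 n

theorem dualNorm_add_smul_lt_top {γ : ℝ} {Ω : Set Plane} {j : Fin 2} {φ η : Functional Ω} (c : ℂ)
    (h1 : dualNorm γ Ω j φ < ⊤) (h2 : dualNorm γ Ω j η < ⊤) : dualNorm γ Ω j (φ - c • η) < ⊤ := by
  refine lt_of_le_of_lt (b := dualNorm γ Ω j φ + ‖c‖ₑ * dualNorm γ Ω j η)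
    (iSup₂_le fun v hv => ?_) (ENNReal.add_lt_top.2 ⟨h1, ENNReal.mul_lt_top (by simp) h2⟩)
  rw [LinearMap.sub_apply, LinearMap.smul_apply, smul_eq_mul]
  refine (enorm_sub_le).trans ?_
  rw [enorm_mul]
  gcongr
  · exact enorm_apply_le_dualNorm φ hv
  · exact enorm_apply_le_dualNorm η hv

/-! ### Normal derivatives of potentials -/

theorem isOpen_side {Ω : Set Plane} (h : IsOpen Ω) (j : Fin 2) : IsOpen (side Ω j) := by
  unfold side exterior
  split_ifs
  · exact isClosed_closure.isOpen_compl
  · exact h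

theorem notMem_frontier_of_mem_side {Ω : Set Plane} (h : IsOpen Ω) {j : Fin 2} {x : Plane}
    (hx : x ∈ side Ω j) : x ∉ frontier Ω := by
  unfold side exterior at hx
  intro hf
  split_ifs at hx
  · exact hx (frontier_subset_closure hf)
  · rw [h.frontier_eq] at hf
    exact hf.2 hx

theorem isH1_potential {a : ℝ} (ha : 0 < a) {ν : Measure Plane} [IsFiniteMeasure ν]
    (hν : HasBoundedRiesz ν) (S : Set Plane) :
    IsH1 S (fun x => (potential a ν x : ℂ)) (gradPotential a ν) where
  memLp := (memLp_potential ha hν).restrict _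
  memLp_grad := (memLp_gradPotential ha hν).restrict _
  weak ξ hξ i := by
    have h := integral_potential_partial ha ν (hξ.contDiff_ofReal.of_le (by simp))
      hξ.hasCompactSupport_ofReal i
    rw [setIntegral_eq_integral_of_forall_compl_eq_zero,
      setIntegral_eq_integral_of_forall_compl_eq_zero, ← h]
    · simp only [hξ.partialD_ofReal]
    · intro x hx; simp [hξ.eq_zero hx]
    · intro x hx; simp [hξ.fderiv_eq_zero hx]

theorem integral_energy_univ {a : ℝ} (ha : 0 < a) (ν : Measure Plane) [IsFiniteMeasure ν]
    {u : Plane → ℂ} (hu : ContDiff ℝ 1 u) (hc : HasCompactSupport u) :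
    ∫ x, (∑ i, gradPotential a ν x i * partialD i u x + (a : ℂ) * potential a ν x * u x)
      = ∫ y, u y ∂ν := by
  have := integral_energy_potential ha ν hu hc univ
  rw [setIntegral_univ] at this
  rw [this]
  congr 1
  funext y
  rw [setIntegral_univ]
  exact integral_greenEnergy_univ ha hu hc y

theorem isWeakDiv_gradPotential {a : ℝ} (ha : 0 < a) {ν : Measure Plane} [IsFiniteMeasure ν]
    (hν : HasBoundedRiesz ν) {S : Set Plane} (hS : ν S = 0) :
    IsWeakDiv S (gradPotential a ν) (fun x => (a : ℂ) * potential a ν x) := by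
  have hΨ : MemLp (fun x => (a : ℂ) * potential a ν x) 2 volume :=
    (memLp_potential ha hν).const_mul (a : ℂ)
  refine ⟨hΨ.restrict _, fun ξ hξ => ?_⟩
  have h := integral_energy_univ ha ν (hξ.contDiff_ofReal.of_le (by simp))
    hξ.hasCompactSupport_ofReal
  have h0 : ∫ y, (ξ y : ℂ) ∂ν = 0 := by
    refine integral_eq_zero_of_ae ?_
    have : ∀ᵐ y ∂ν, y ∉ S := by rw [ae_iff]; simpa using hS
    filter_upwards [this] with y hy
    simp [hξ.eq_zero hy]
  have hi : ∀ i, Integrable (fun x => gradPotential a ν x i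
      * ((fderiv ℝ ξ x (EuclideanSpace.single i 1) : ℝ) : ℂ)) (volume.restrict S) := fun i =>
    hξ.integrable_deriv (memLp_coord ((memLp_gradPotential ha hν).restrict _) i) i
  rw [← sub_eq_zero, sub_neg_eq_add, ← integral_add (integrable_finsetSum _ fun i _ => hi i)
    (hξ.integrable_mul (hΨ.restrict _) hξ.smooth.continuous subset_rfl),
    setIntegral_eq_integral_of_forall_compl_eq_zero, ← h0, ← h]
  · simp only [hξ.partialD_ofReal]
  · intro x hx; simp [hξ.eq_zero hx, hξ.fderiv_eq_zero hx]

theorem isH1_congr {S : Set Plane} (hS : MeasurableSet S) {F F' : Plane → ℂ}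
    {G : Plane → EuclideanSpace ℂ (Fin 2)} (h : IsH1 S F G) (he : ∀ x ∈ S, F' x = F x) :
    IsH1 S F' G where
  memLp := h.memLp.ae_eq ((ae_restrict_iff' hS).2 (Eventually.of_forall fun x hx => (he x hx).symm))
  memLp_grad := h.memLp_grad
  weak ξ hξ i := by
    rw [← h.weak ξ hξ i]
    exact setIntegral_congr_fun hS fun x hx => by simp only [he x hx]

/-- Green's formula for smooth functions passes to all functions of `H¹` with a trace. -/
theorem integral_energy_eq_of_hasTrace {a : ℝ} (ha : 0 < a) {ν : Measure Plane} [IsFiniteMeasure ν]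
    (hν : HasBoundedRiesz ν) {S Γ : Set Plane} [IsFiniteMeasure (arcMeasure Γ)]
    {f v : Lp ℂ 2 (arcMeasure Γ)}
    (hf : ∀ u : Plane → ℂ, ContDiff ℝ ∞ u → HasCompactSupport u →
      ∫ x in S, (∑ i, gradPotential a ν x i * partialD i u x + (a : ℂ) * potential a ν x * u x)
        = ∫ x, f x * u x ∂(arcMeasure Γ))
    {V : Plane → ℂ} {H : Plane → EuclideanSpace ℂ (Fin 2)} (hV : HasTrace S Γ V H v) :
    ∫ x, f x * v x ∂(arcMeasure Γ)
      = ∫ x in S, ((∑ i, gradPotential a ν x i * H x i) + (a : ℂ) * potential a ν x * V x) := by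
  obtain ⟨u, hu, h1, h2, h3⟩ := hV.approx
  have hG := fun i => memLp_coord ((memLp_gradPotential ha hν).restrict S) i
  have hΨ : MemLp (fun x => (a : ℂ) * potential a ν x) 2 (volume.restrict S) :=
    ((memLp_potential ha hν).const_mul (a : ℂ)).restrict _
  have hun := fun n => isH1_of_contDiff S (hu n).1 (hu n).2
  have l1 := tendsto_integral_mul (Lp.memLp f) (Lp.memLp v)
    (fun n => memLp_arcMeasure (hu n).1.continuous (hu n).2) h3
  have l2 := tendsto_integral_mul hΨ hV.isH1.memLp (fun n => (hun n).memLp) h1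
  have l3 : ∀ i, Tendsto (fun n => ∫ x in S, gradPotential a ν x i * classicalGrad (u n) x i) atTop
      (𝓝 (∫ x in S, gradPotential a ν x i * H x i)) := fun i => by
    refine tendsto_integral_mul (u := fun n x => classicalGrad (u n) x i) (hG i)
      (memLp_coord hV.isH1.memLp_grad i) (fun n => memLp_coord (hun n).memLp_grad i) ?_
    refine tendsto_of_tendsto_of_tendsto_of_le_of_le tendsto_const_nhds h2 (fun _ => zero_le)
      fun n => eLpNorm_mono fun x => ?_
    exact PiLp.norm_apply_le (classicalGrad (u n) x - H x) i
  have split : ∀ (W : Plane → ℂ) (K : Plane → EuclideanSpace ℂ (Fin 2)),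
      MemLp W 2 (volume.restrict S) → MemLp K 2 (volume.restrict S) →
      ∫ x in S, ((∑ i, gradPotential a ν x i * K x i) + (a : ℂ) * potential a ν x * W x)
        = (∑ i, ∫ x in S, gradPotential a ν x i * K x i)
          + ∫ x in S, (a : ℂ) * potential a ν x * W x := fun W K hW hK => by
    have hi := fun i => integrable_mul_of_memLp (hG i) (memLp_coord hK i)
    rw [integral_add (integrable_finsetSum _ fun i _ => hi i) (integrable_mul_of_memLp hΨ hW),
      integral_finsetSum _ fun i _ => hi i]
  rw [split V H hV.isH1.memLp hV.isH1.memLp_grad]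
  refine tendsto_nhds_unique l1 (((tendsto_finsetSum _ fun i _ => l3 i).add l2).congr fun n => ?_)
  rw [← split _ _ (hun n).memLp (hun n).memLp_grad, ← hf (u n) (hu n).1 (hu n).2]
  rfl

theorem isNormalDeriv_ofL2 {a : ℝ} (ha : 0 < a) {ν : Measure Plane} [IsFiniteMeasure ν]
    (hν : HasBoundedRiesz ν) {Ω : Set Plane} (hΩ : IsOpen Ω) {j : Fin 2}
    [IsFiniteMeasure (arcMeasure (frontier Ω))] (hνΩ : ν (frontier Ω)ᶜ = 0)
    {f : Lp ℂ 2 (arcMeasure (frontier Ω))}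
    (hf : ∀ u : Plane → ℂ, ContDiff ℝ ∞ u → HasCompactSupport u →
      ∫ x in side Ω j, (∑ i, gradPotential a ν x i * partialD i u x
        + (a : ℂ) * potential a ν x * u x) = ∫ x, f x * u x ∂(arcMeasure (frontier Ω)))
    {Ψ : Plane → ℂ} (hΨ : ∀ x ∉ frontier Ω, Ψ x = potential a ν x) :
    IsNormalDeriv Ω j Ψ (ofL2 f) := by
  refine ⟨gradPotential a ν, fun x => (a : ℂ) * potential a ν x,
    isH1_congr (isOpen_side hΩ j).measurableSet (isH1_potential ha hν _)
      fun x hx => hΨ x (notMem_frontier_of_mem_side hΩ hx),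
    isWeakDiv_gradPotential ha hν (measure_mono_null
      (fun x hx => notMem_frontier_of_mem_side hΩ hx) hνΩ), fun v V H hV => ?_⟩
  exact integral_energy_eq_of_hasTrace ha hν hf hV

/-- The functionals given by normal derivatives of potentials have finite dual norm. -/
theorem dualNorm_ofL2_lt_top {a : ℝ} (ha : 0 < a) {ν : Measure Plane} [IsFiniteMeasure ν]
    (hν : HasBoundedRiesz ν) {Ω : Set Plane} {j : Fin 2}
    [IsFiniteMeasure (arcMeasure (frontier Ω))] {f : Lp ℂ 2 (arcMeasure (frontier Ω))}
    (hf : ∀ u : Plane → ℂ, ContDiff ℝ ∞ u → HasCompactSupport u →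
      ∫ x in side Ω j, (∑ i, gradPotential a ν x i * partialD i u x
        + (a : ℂ) * potential a ν x * u x) = ∫ x, f x * u x ∂(arcMeasure (frontier Ω)))
    {γ : ℝ} (hγ : 0 < γ) : dualNorm γ Ω j (ofL2 f) < ⊤ := by
  set S := side Ω j with hS
  have hGm := (memLp_gradPotential ha hν).restrict S
  have hG := fun i => memLp_coord hGm i
  have hΨ : MemLp (fun x => (a : ℂ) * potential a ν x) 2 (volume.restrict S) :=
    ((memLp_potential ha hν).const_mul (a : ℂ)).restrict _
  have hA := hΨ.2.ne
  have hB : (∑ i, eLpNorm (fun x => gradPotential a ν x i) 2 (volume.restrict S)) ≠ ⊤ :=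
    ENNReal.sum_ne_top.2 fun i _ => (hG i).2.ne
  refine (dualNorm_le hγ hA hB fun v F G hFG => ?_).trans_lt (ENNReal.add_lt_top.2
    ⟨ENNReal.mul_lt_top hA.lt_top ENNReal.ofReal_lt_top, hB.lt_top⟩)
  have hi := fun i => integrable_mul_of_memLp (hG i) (memLp_coord hFG.isH1.memLp_grad i)
  rw [ofL2_apply, integral_energy_eq_of_hasTrace ha hν hf hFG,
    integral_add (integrable_finsetSum _ fun i _ => hi i)
      (integrable_mul_of_memLp hΨ hFG.isH1.memLp), integral_finsetSum _ fun i _ => hi i, add_comm]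
  refine (enorm_add_le _ _).trans (add_le_add
    (enorm_integral_mul_le hΨ.1 hFG.isH1.memLp.1) ?_)
  rw [Finset.sum_mul]
  refine (enorm_sum_le _ _).trans (Finset.sum_le_sum fun i _ => ?_)
  refine (enorm_integral_mul_le (hG i).1 (memLp_coord hFG.isH1.memLp_grad i).1).trans ?_
  gcongr
  exact eLpNorm_mono fun x => PiLp.norm_apply_le (G x) i

/-- A functional bounded in terms of the image of its argument in `L²` is given by an `L²`
function, by the theorems of Hahn–Banach and of Riesz. -/
theorem exists_l2_representation {E : Type*} [AddCommGroup E] [Module ℂ E] {α : Type*}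
    [MeasurableSpace α] {μ : Measure α} (T : E →ₗ[ℂ] Lp ℂ 2 μ) (B : E →ₗ[ℂ] ℂ) (C : ℝ)
    (hB : ∀ u, ‖B u‖ ≤ C * ‖T u‖) :
    ∃ h : Lp ℂ 2 μ, ∀ u, B u = ∫ x, h x * T u x ∂μ := by
  obtain ⟨s, hs⟩ := LinearMap.exists_rightInverse_of_surjective T.rangeRestrict
    T.range_rangeRestrict
  have hs' : ∀ y : LinearMap.range T, T (s y) = y := fun y =>
    congrArg Subtype.val (LinearMap.congr_fun hs y)
  let g : LinearMap.range T →L[ℂ] ℂ := (B.comp s).mkContinuous C fun y => by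
    have := hB (s y)
    rw [hs'] at this
    exact this
  obtain ⟨g', hg', -⟩ := exists_extension_norm_eq _ g
  set w := (InnerProductSpace.toDual ℂ (Lp ℂ 2 μ)).symm g' with hw
  have hstar : MemLp (fun x => (starRingEnd ℂ) (w x)) 2 μ := (Lp.memLp w).star
  refine ⟨hstar.toLp _, fun u => ?_⟩
  have e1 : B u = g' (T u) := by
    have h1 := hg' ⟨T u, LinearMap.mem_range_self T u⟩
    have h2 : g ⟨T u, LinearMap.mem_range_self T u⟩ = B (s ⟨T u, LinearMap.mem_range_self T u⟩) :=
      rfl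
    have h3 : B (s ⟨T u, LinearMap.mem_range_self T u⟩) - B u = 0 := by
      rw [← map_sub]
      have := hB (s ⟨T u, LinearMap.mem_range_self T u⟩ - u)
      rw [map_sub T, hs', sub_self, norm_zero, mul_zero] at this
      exact norm_le_zero_iff.1 this
    rw [h2, sub_eq_zero.1 h3] at h1
    exact h1.symm
  have e2 : g' (T u) = inner ℂ w (T u) := by
    rw [hw, InnerProductSpace.toDual_symm_apply]
  rw [e1, e2, L2.inner_def]
  refine integral_congr_ae ?_
  filter_upwards [hstar.coeFn_toLp] with x hx
  rw [hx]
  simp [mul_comm]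

theorem integrable_energy {a : ℝ} (ha : 0 < a) {ν : Measure Plane} [IsFiniteMeasure ν]
    (hν : HasBoundedRiesz ν) {u : Plane → ℂ} (hu : ContDiff ℝ ∞ u) (hc : HasCompactSupport u) :
    Integrable fun x => ∑ i, gradPotential a ν x i * partialD i u x
      + (a : ℂ) * potential a ν x * u x := by
  have hH := isH1_of_contDiff univ hu hc
  have h1 := hH.memLp
  have h2 := hH.memLp_grad
  rw [Measure.restrict_univ] at h1 h2
  refine Integrable.add (integrable_finsetSum _ fun i _ => ?_) ?_
  · exact integrable_mul_of_memLp (memLp_coord (memLp_gradPotential ha hν) i) (memLp_coord h2 i)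
  · exact integrable_mul_of_memLp ((memLp_potential ha hν).const_mul (a : ℂ)) h1

/-- The space `C_c^∞(ℝ²)`. -/
def smoothSpace : Submodule ℂ (Plane → ℂ) where
  carrier := {u | ContDiff ℝ ∞ u ∧ HasCompactSupport u}
  zero_mem' := ⟨contDiff_const, HasCompactSupport.zero⟩
  add_mem' h1 h2 := ⟨h1.1.add h2.1, h1.2.add h2.2⟩
  smul_mem' c _ h := ⟨contDiff_const.smul h.1, h.2.comp_left (g := fun z : ℂ => c • z) (by simp)⟩

theorem integral_norm_le_l2Class {Γ : Set Plane} [IsFiniteMeasure (arcMeasure Γ)] :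
    ∃ K, 0 ≤ K ∧ ∀ {u : Plane → ℂ} (hu : Continuous u) (hc : HasCompactSupport u),
      ∫ x, ‖u x‖ ∂(arcMeasure Γ) ≤ K * ‖l2Class Γ hu hc‖ := by
  refine ⟨(arcMeasure Γ univ ^ (1 / 2 : ℝ)).toReal, ENNReal.toReal_nonneg, fun {u} hu hc => ?_⟩
  have h1 := eLpNorm_le_eLpNorm_mul_rpow_measure_univ (μ := arcMeasure Γ) (p := 1) (q := 2)
    (by norm_num) hu.aestronglyMeasurable
  have hK : arcMeasure Γ univ ^ (1 / 2 : ℝ) ≠ ⊤ :=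
    ENNReal.rpow_ne_top_of_nonneg (by norm_num) (measure_ne_top _ _)
  have h2 := (memLp_arcMeasure (Γ := Γ) hu hc).2.ne
  rw [eLpNorm_one_eq_lintegral_enorm,
    ← ofReal_integral_norm_eq_lintegral_enorm (integrable_arcMeasure hu hc)] at h1
  rw [show 1 / (1 : ℝ≥0∞).toReal - 1 / (2 : ℝ≥0∞).toReal = 1 / 2 by norm_num] at h1
  have h3 := ENNReal.toReal_mono (ENNReal.mul_ne_top h2 hK) h1
  rw [ENNReal.toReal_ofReal (integral_nonneg fun _ => norm_nonneg _), ENNReal.toReal_mul] at h3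
  rw [l2Class, Lp.norm_toLp, mul_comm]
  exact h3

/-- The interior normal derivative of the potential of a measure on a smooth side, bounded by
arc length, is a square integrable function. -/
theorem IsCurvilinearPolygon.exists_normal_density {Ω : Set Plane} (h : IsCurvilinearPolygon Ω)
    {p : Plane} {e : Plane ≃ₗᵢ[ℝ] Plane} {fneg fpos : ℝ → ℝ} {r : ℝ}
    (hc : IsCornerChart Ω p e fneg fpos r) {a : ℝ} (ha : 0 < a) {t₁ : ℝ} (ht₁ : 0 < t₁)
    {ν : Measure Plane} [IsFiniteMeasure ν] (hν : HasBoundedRiesz ν)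
    (hle : ν ≤ arcMeasure (frontier Ω))
    (hsupp : ∀ᵐ y ∂ν, ∃ t₀, t₁ ≤ t₀ ∧ t₀ ≤ r ∧ graphPt p e (legFun fneg fpos) t₀
      ∈ Metric.ball p (r / 4) ∧ y = graphPt p e (legFun fneg fpos) t₀) :
    ∃ f : Lp ℂ 2 (arcMeasure (frontier Ω)), ∀ u : Plane → ℂ, ContDiff ℝ ∞ u →
      HasCompactSupport u →
      ∫ x in Ω, (∑ i, gradPotential a ν x i * partialD i u x + (a : ℂ) * potential a ν x * u x)
        = ∫ x, f x * u x ∂(arcMeasure (frontier Ω)) := by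
  have hfin := h.isFiniteMeasure_arcMeasure
  obtain ⟨C, hC0, hC⟩ := h.exists_greenEnergy_bound hc ha ht₁
  obtain ⟨K, hK0, hK⟩ := integral_norm_le_l2Class (Γ := frontier Ω)
  let T : smoothSpace →ₗ[ℂ] Lp ℂ 2 (arcMeasure (frontier Ω)) :=
    { toFun := fun u => l2Class (frontier Ω) u.2.1.continuous u.2.2
      map_add' := fun _ _ => rfl
      map_smul' := fun _ _ => rfl }
  have hd : ∀ u ∈ smoothSpace, Differentiable ℝ u := fun u hu => hu.1.differentiable (by simp)
  let B : smoothSpace →ₗ[ℂ] ℂ :=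
    { toFun := fun u => ∫ x in Ω, (∑ i, gradPotential a ν x i * partialD i u.1 x
        + (a : ℂ) * potential a ν x * u.1 x)
      map_add' := fun u v => by
        rw [← integral_add (integrable_energy ha hν u.2.1 u.2.2).integrableOn
          (integrable_energy ha hν v.2.1 v.2.2).integrableOn]
        congr 1
        funext x
        simp only [partialD, Submodule.coe_add, fderiv_add (hd u.1 u.2 x) (hd v.1 v.2 x),
          add_apply, Pi.add_apply, Fin.sum_univ_two]
        ring
      map_smul' := fun c u => by
        rw [RingHom.id_apply, smul_eq_mul, ← integral_const_mul]
        congr 1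
        funext x
        simp only [partialD, Submodule.coe_smul, fderiv_const_smul (hd u.1 u.2 x),
          smul_apply, Pi.smul_apply, Fin.sum_univ_two, smul_eq_mul]
        ring }
  -- the bound of the energy forms for a fixed pole, averaged over the pole; the point evaluations
  -- average to an integral that `ν ≤ σ` controls
  obtain ⟨f, hf⟩ := exists_l2_representation T B ((ν.real univ * C + 1) * K) fun u => by
    have hus : ContDiff ℝ 1 u.1 := u.2.1.of_le (by simp)
    have huc := u.2.2
    set S := ∫ x, ‖u.1 x‖ ∂(arcMeasure (frontier Ω)) with hS
    have hiσ := (integrable_arcMeasure (Γ := frontier Ω) hus.continuous huc).norm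
    have hiν : Integrable (fun y => ‖u.1 y‖) ν := hiσ.mono_measure hle
    have e1 : B u = ∫ y, (∫ x in Ω, greenEnergy a u.1 y x) ∂ν :=
      integral_energy_potential ha ν hus huc Ω
    have h1 : ‖B u‖ ≤ ∫ y, (C * S + ‖u.1 y‖) ∂ν := by
      rw [e1]
      refine norm_integral_le_of_norm_le ((integrable_const _).add hiν) ?_
      filter_upwards [hsupp] with y hy
      obtain ⟨t₀, h1, h2, h3, rfl⟩ := hy
      exact hC u.1 hus huc t₀ h1 h2 h3
    have h2 : ∫ y, ‖u.1 y‖ ∂ν ≤ S :=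
      integral_mono_measure hle (Eventually.of_forall fun _ => norm_nonneg _) hiσ
    rw [integral_add (integrable_const _) hiν, integral_const, smul_eq_mul] at h1
    have h3 : S ≤ K * ‖T u‖ := hK hus.continuous huc
    have h4 : 0 ≤ ν.real univ * C + 1 := by positivity
    calc ‖B u‖ ≤ (ν.real univ * C + 1) * S := by linarith
      _ ≤ (ν.real univ * C + 1) * (K * ‖T u‖) := by gcongr
      _ = _ := by ring
  refine ⟨f, fun u hu huc => ?_⟩
  have := hf ⟨u, hu, huc⟩
  refine this.trans (integral_congr_ae ?_)
  filter_upwards [(memLp_arcMeasure (Γ := frontier Ω) hu.continuous huc).coeFn_toLp] with x hx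
  change f x * ((memLp_arcMeasure (Γ := frontier Ω) hu.continuous huc).toLp u) x = _
  rw [hx]

/-- A measure bounded by `σ` has a density with values in `[0, 1]`; hence the square of its `L²` norm
is at most the mass. -/
theorem exists_density {σ ν : Measure Plane} [IsFiniteMeasure σ] (hle : ν ≤ σ) :
    ∃ f : Lp ℂ 2 σ, (∀ u : Plane → ℂ, ∫ x, f x * u x ∂σ = ∫ x, u x ∂ν) ∧ ‖f‖ₑ ^ 2 ≤ ν univ := by
  have hfin : IsFiniteMeasure ν := isFiniteMeasure_of_le σ hle
  have hdec := Measure.haveLebesgueDecomposition_of_finiteMeasure (μ := ν) (ν := σ)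
  have h1 := Measure.rnDeriv_le_one_of_le hle
  have hac : ν ≪ σ := Measure.absolutelyContinuous_of_le hle
  have hm : Measurable fun x => ((ν.rnDeriv σ x).toReal : ℂ) :=
    Complex.measurable_ofReal.comp (Measure.measurable_rnDeriv ν σ).ennreal_toReal
  have hb : ∀ᵐ x ∂σ, ‖((ν.rnDeriv σ x).toReal : ℂ)‖ₑ = ν.rnDeriv σ x := by
    filter_upwards [h1] with x hx
    have : ν.rnDeriv σ x ≠ ⊤ := ne_top_of_le_ne_top ENNReal.one_ne_top hx
    rw [← ofReal_norm, Complex.norm_real, Real.norm_eq_abs, abs_of_nonneg ENNReal.toReal_nonneg,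
      ENNReal.ofReal_toReal this]
  have hL : MemLp (fun x => ((ν.rnDeriv σ x).toReal : ℂ)) 2 σ := by
    refine MemLp.of_bound hm.aestronglyMeasurable 1 ?_
    filter_upwards [h1] with x hx
    rw [Complex.norm_real, Real.norm_eq_abs, abs_of_nonneg ENNReal.toReal_nonneg]
    exact ENNReal.toReal_le_of_le_ofReal zero_le_one (by simpa using hx)
  refine ⟨hL.toLp _, fun u => ?_, ?_⟩
  · refine Eq.trans ?_ (integral_rnDeriv_smul (f := u) hac)
    refine integral_congr_ae ?_
    filter_upwards [hL.coeFn_toLp] with x hx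
    rw [hx]
    rfl
  · rw [Lp.enorm_toLp, eLpNorm_eq_lintegral_rpow_enorm_toReal (by norm_num) (by norm_num),
      ← ENNReal.rpow_natCast, ← ENNReal.rpow_mul]
    norm_num
    calc ∫⁻ x, ‖((ν.rnDeriv σ x).toReal : ℂ)‖ₑ ^ 2 ∂σ ≤ ∫⁻ x, ν.rnDeriv σ x ∂σ := by
          refine lintegral_mono_ae ?_
          filter_upwards [hb, h1] with x hx hx1
          rw [hx, pow_two]
          exact mul_le_of_le_one_left zero_le hx1
      _ ≤ ν univ := Measure.lintegral_rnDeriv_le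

/-- The two sides fill the plane up to the boundary, which is a null set. -/
theorem setIntegral_side {Ω : Set Plane} (h : IsCurvilinearPolygon Ω) {g : Plane → ℂ}
    (hg : Integrable g) : ∫ x in side Ω 0, g x = (∫ x, g x) - ∫ x in side Ω 1, g x := by
  have e0 : side Ω 0 = (closure Ω)ᶜ := rfl
  have e1 : side Ω 1 = Ω := rfl
  have hae : (closure Ω)ᶜ =ᵐ[volume] Ωᶜ := by
    have h0 := h.volume_frontier
    have : ∀ᵐ x : Plane, x ∉ frontier Ω := by rw [ae_iff]; simpa using h0
    filter_upwards [this] with x hx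
    refine propext ⟨fun h1 h2 => h1 (subset_closure h2), fun h1 h2 => hx ?_⟩
    rw [h.isOpen.frontier_eq]
    exact ⟨h2, h1⟩
  have e2 : ∫ x in (closure Ω)ᶜ, g x = ∫ x in Ωᶜ, g x := setIntegral_congr_set hae
  rw [e0, e1, e2, eq_sub_iff_add_eq, add_comm]
  exact integral_add_compl h.isOpen.measurableSet hg

/-! ### The potential of a density on the boundary -/

theorem exists_smooth_eq_greenFn {Γ : Set Plane} (hΓ : IsCompact Γ) {γ : ℝ} (hγ : 0 < γ)
    {x : Plane} (hx : x ∉ Γ) :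
    ∃ u : Plane → ℂ, ContDiff ℝ ∞ u ∧ HasCompactSupport u ∧ ∀ y ∈ Γ, u y = greenFn γ (x - y) := by
  obtain ⟨ε, hε, hεΓ⟩ := Metric.isOpen_iff.1 hΓ.isClosed.isOpen_compl x hx
  obtain ⟨R, hR0, hR⟩ := hΓ.isBounded.subset_closedBall_lt 0 (0 : Plane)
  let b1 : ContDiffBump x := ⟨ε / 2, ε, by positivity, by linarith⟩
  let b2 : ContDiffBump (0 : Plane) := ⟨R, R + 1, hR0, by linarith⟩
  have hsm : ContDiff ℝ ∞ fun y => (1 - b1 y) * greenFn γ (x - y) := by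
    rw [contDiff_iff_contDiffAt]
    intro y
    by_cases hxy : y = x
    · have : (fun y => (1 - b1 y) * greenFn γ (x - y)) =ᶠ[𝓝 y] fun _ => 0 := by
        rw [hxy]
        filter_upwards [b1.eventuallyEq_one] with z hz
        simp [hz]
      exact contDiffAt_const.congr_of_eventuallyEq this
    · have h1 : x - y ≠ 0 := sub_ne_zero.2 (Ne.symm hxy)
      have h2 : ContDiffAt ℝ ∞ (fun y => greenFn γ (x - y)) y :=
        ContDiffAt.comp (g := greenFn γ) y (contDiffAt_greenFn hγ h1)
          (contDiffAt_const.sub contDiffAt_id)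
      exact (contDiffAt_const.sub b1.contDiffAt).mul h2
  have h3 : ContDiff ℝ ∞ fun y => b2 y * ((1 - b1 y) * greenFn γ (x - y)) := b2.contDiff.mul hsm
  refine ⟨fun y => ((b2 y * ((1 - b1 y) * greenFn γ (x - y)) : ℝ) : ℂ),
    Complex.ofRealCLM.contDiff.comp h3,
    (b2.hasCompactSupport.mul_right).comp_left (g := fun t : ℝ => (t : ℂ)) (by simp),
    fun y hy => ?_⟩
  have h4 : b2 y = 1 := b2.one_of_mem_closedBall (hR hy)
  have h5 : b1 y = 0 := by
    refine b1.zero_of_le_dist ?_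
    by_contra h
    exact hεΓ (Metric.mem_ball.2 (not_le.1 h)) hy
  simp [h4, h5]

theorem ae_mem_frontier {Ω : Set Plane} {ν : Measure Plane} (hle : ν ≤ arcMeasure (frontier Ω)) :
    ν (frontier Ω)ᶜ = 0 := by
  refine le_antisymm ((hle _).trans (le_of_eq ?_)) zero_le
  rw [arcMeasure, Measure.restrict_apply isClosed_frontier.measurableSet.compl]
  simp

/-- The potential defined through the duality pairing is the potential of the measure with the given
density. -/
theorem layerPotential_eq {Ω : Set Plane} (h : IsCurvilinearPolygon Ω) {γ : ℝ} (hγ : 0 < γ)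
    {ν : Measure Plane} (hle : ν ≤ arcMeasure (frontier Ω))
    {f : Lp ℂ 2 (arcMeasure (frontier Ω))}
    (hf : ∀ u : Plane → ℂ, ∫ x, f x * u x ∂(arcMeasure (frontier Ω)) = ∫ x, u x ∂ν)
    {x : Plane} (hx : x ∉ frontier Ω) :
    layerPotential γ (![0, ofL2 f] : NeumannPair Ω) x = potential (γ⁻¹ ^ 2) ν x := by
  have hfin := h.isFiniteMeasure_arcMeasure
  obtain ⟨u, hu, huc, hug⟩ := exists_smooth_eq_greenFn h.isCompact_frontier hγ hx
  have hex : ∃ v : HHalf Ω, ((v : Lp ℂ 2 (arcMeasure (frontier Ω))) : Plane → ℂ)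
      =ᵐ[arcMeasure (frontier Ω)] fun y => (greenFn γ (x - y) : ℂ) := by
    refine ⟨smoothTrace Ω hu huc, (coeFn_smoothTrace Ω hu huc).trans ?_⟩
    refine (ae_restrict_iff' isClosed_frontier.measurableSet).2 (Eventually.of_forall hug)
  have h0 : pairing (0 : Functional Ω) (fun y => (greenFn γ (x - y) : ℂ)) = 0 := by
    unfold pairing
    split_ifs <;> simp
  have h1 : pairing (ofL2 f : Functional Ω) (fun y => (greenFn γ (x - y) : ℂ))
      = ∫ y, (greenFn γ (x - y) : ℂ) ∂ν := by
    unfold pairing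
    rw [dif_pos hex, ofL2_apply, ← hf]
    refine integral_congr_ae ?_
    filter_upwards [hex.choose_spec] with y hy
    rw [hy]
  rw [layerPotential, Fin.sum_univ_two]
  change pairing 0 _ + pairing (ofL2 f) _ = _
  rw [h0, zero_add, h1, potential, ← integral_complex_ofReal]
  refine integral_congr_ae ?_
  have : ∀ᵐ y ∂ν, y ∈ frontier Ω := by
    rw [ae_iff]
    exact ae_mem_frontier hle
  filter_upwards [this] with y hy
  have hz : x - y ≠ 0 := sub_ne_zero.2 fun h => hx (h ▸ hy)
  rw [greenK_eq_greenFn hγ hz]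

/-- The exchange operator on `(0, f)`, for a density `f` whose potential has a square integrable
interior normal derivative `f₁`. -/
theorem isExchange_of_density {Ω : Set Plane} (h : IsCurvilinearPolygon Ω) {γ : ℝ} (hγ : 0 < γ)
    {ν : Measure Plane} [IsFiniteMeasure ν] (hν : HasBoundedRiesz ν)
    (hle : ν ≤ arcMeasure (frontier Ω)) {f f₁ : Lp ℂ 2 (arcMeasure (frontier Ω))}
    (hf : ∀ u : Plane → ℂ, ∫ x, f x * u x ∂(arcMeasure (frontier Ω)) = ∫ x, u x ∂ν)
    (hf₁ : ∀ u : Plane → ℂ, ContDiff ℝ ∞ u → HasCompactSupport u →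
      ∫ x in Ω, (∑ i, gradPotential (γ⁻¹ ^ 2) ν x i * partialD i u x
        + ((γ⁻¹ ^ 2 : ℝ) : ℂ) * potential (γ⁻¹ ^ 2) ν x * u x)
        = ∫ x, f₁ x * u x ∂(arcMeasure (frontier Ω))) :
    IsExchange γ Ω ![0, ofL2 f]
        (fun j => (![0, ofL2 f] : NeumannPair Ω) j - (2 : ℂ) • ofL2 (![f - f₁, f₁] j)) ∧
      ∀ j, dualNorm γ Ω j (ofL2 (![f - f₁, f₁] j)) < ⊤ := by
  have hfin := h.isFiniteMeasure_arcMeasure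
  have ha : 0 < γ⁻¹ ^ 2 := by positivity
  have hf₀ : ∀ u : Plane → ℂ, ContDiff ℝ ∞ u → HasCompactSupport u →
      ∫ x in side Ω 0, (∑ i, gradPotential (γ⁻¹ ^ 2) ν x i * partialD i u x
        + ((γ⁻¹ ^ 2 : ℝ) : ℂ) * potential (γ⁻¹ ^ 2) ν x * u x)
        = ∫ x, (f - f₁) x * u x ∂(arcMeasure (frontier Ω)) := by
    intro u hu hc
    rw [setIntegral_side h (integrable_energy ha hν hu hc),
      integral_energy_univ ha ν (hu.of_le (by simp)) hc, ← hf]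
    change _ - ∫ x in Ω, _ = _
    rw [hf₁ u hu hc, ← integral_sub
      (integrable_mul_of_memLp (Lp.memLp f) (memLp_arcMeasure hu.continuous hc))
      (integrable_mul_of_memLp (Lp.memLp f₁) (memLp_arcMeasure hu.continuous hc))]
    refine integral_congr_ae ?_
    filter_upwards [Lp.coeFn_sub f f₁] with x hx
    rw [hx]
    simp [sub_mul]
  have hall : ∀ j, ∀ u : Plane → ℂ, ContDiff ℝ ∞ u → HasCompactSupport u →
      ∫ x in side Ω j, (∑ i, gradPotential (γ⁻¹ ^ 2) ν x i * partialD i u x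
        + ((γ⁻¹ ^ 2 : ℝ) : ℂ) * potential (γ⁻¹ ^ 2) ν x * u x)
        = ∫ x, (![f - f₁, f₁] j) x * u x ∂(arcMeasure (frontier Ω)) := by
    intro j
    fin_cases j
    · exact hf₀
    · exact hf₁
  refine ⟨⟨fun j => ofL2 (![f - f₁, f₁] j), fun j => ?_, fun j => rfl⟩,
    fun j => dualNorm_ofL2_lt_top ha hν (hall j) hγ⟩
  exact isNormalDeriv_ofL2 ha hν h.isOpen (ae_mem_frontier hle) (hall j)
    fun x hx => layerPotential_eq h hγ hle hf hx

/-- Projection to the axis of the chart does not increase distances, which reduces the claim to the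
local integrability of `|s| ^ (-1/2)` on the line. -/
theorem IsCornerChart.hasBoundedRiesz {Ω : Set Plane} {p : Plane} {e : Plane ≃ₗᵢ[ℝ] Plane}
    {fneg fpos : ℝ → ℝ} {r : ℝ} (hc : IsCornerChart Ω p e fneg fpos r) {ν : Measure Plane}
    (hle : ν ≤ chartMeasure p e (legFun fneg fpos) r) : HasBoundedRiesz ν := by
  have hl := hc.isLegPair
  have hcont := continuous_graphPt p e hl.continuous_legFun
  set F := legFun fneg fpos with hF
  set k : ℝ → ℝ≥0∞ := indicator (Ioc 0 1) fun τ => ENNReal.ofReal (τ ^ (-(1 / 2) : ℝ)) with hk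
  have hkm : Measurable k := by
    refine Measurable.indicator ?_ measurableSet_Ioc
    fun_prop
  have hk1 : ∫⁻ τ, k τ < ⊤ := by
    rw [hk, lintegral_indicator measurableSet_Ioc]
    exact ((intervalIntegrable_iff_integrableOn_Ioc_of_le zero_le_one).1
      (intervalIntegral.intervalIntegrable_rpow' (by norm_num))).lintegral_lt_top
  have hkle : ∀ τ : ℝ, τ ≠ 0 → ENNReal.ofReal (|τ| ^ (-(1 / 2) : ℝ)) ≤ k τ + k (-τ) + 1 := by
    intro τ hτ
    have hτ0 : 0 < |τ| := abs_pos.2 hτ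
    by_cases h1 : |τ| ≤ 1
    · refine le_trans (le_of_eq ?_) le_self_add
      rcases lt_or_gt_of_ne hτ with h | h
      · rw [abs_of_neg h] at h1 hτ0 ⊢
        have e1 : k τ = 0 := indicator_of_notMem (fun h' => absurd h'.1 (not_lt.2 h.le)) _
        have e2 : k (-τ) = ENNReal.ofReal ((-τ) ^ (-(1 / 2) : ℝ)) := indicator_of_mem (mem_Ioc.2 ⟨hτ0, h1⟩) _
        rw [e1, e2, zero_add]
      · rw [abs_of_pos h] at h1 hτ0 ⊢
        have e1 : k (-τ) = 0 := indicator_of_notMem (fun h' => by linarith [h'.1]) _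
        have e2 : k τ = ENNReal.ofReal (τ ^ (-(1 / 2) : ℝ)) := indicator_of_mem (mem_Ioc.2 ⟨hτ0, h1⟩) _
        rw [e1, e2, add_zero]
    · refine le_trans ?_ le_add_self
      rw [← ENNReal.ofReal_one]
      exact ENNReal.ofReal_le_ofReal
        (Real.rpow_le_one_of_one_le_of_nonpos (not_le.1 h1).le (by norm_num))
  refine ⟨(∫⁻ τ, k τ) + (∫⁻ τ, k τ) + volume (Ioo (-r) r), by simp [hk1], fun x => ?_⟩
  have hg : Measurable fun y : Plane => ENNReal.ofReal (‖x - y‖ ^ (-(1 / 2) : ℝ)) := by fun_prop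
  set x₁ := e (x - p) 0 with hx₁
  have hsub : {s | graphPt p e F s ∈ Metric.ball p r} ⊆ Ioo (-r) r := fun s hs =>
    abs_lt.1 (hl.abs_lt_of_graphPt_mem hs)
  have hdist : ∀ s, |x₁ - s| ≤ ‖x - graphPt p e F s‖ := by
    intro s
    have e1 : e (x - graphPt p e F s) 0 = x₁ - s := by
      have : x - graphPt p e F s = (x - p) - (graphPt p e F s - p) := by abel
      rw [this, map_sub, graphPt_coord]
      simp [hx₁]
    rw [← e1, ← e.norm_map]
    exact abs_coord_le_norm _ 0
  have hne : ∀ᵐ s : ℝ, x₁ - s ≠ 0 := by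
    have : ∀ᵐ s : ℝ, s ≠ x₁ := by simp [ae_iff]
    filter_upwards [this] with s hs
    exact sub_ne_zero.2 (Ne.symm hs)
  calc ∫⁻ y, ENNReal.ofReal (‖x - y‖ ^ (-(1 / 2) : ℝ)) ∂ν
      ≤ ∫⁻ y, ENNReal.ofReal (‖x - y‖ ^ (-(1 / 2) : ℝ)) ∂(chartMeasure p e F r) :=
        lintegral_mono' hle le_rfl
    _ = ∫⁻ s in {s | graphPt p e F s ∈ Metric.ball p r},
          ENNReal.ofReal (‖x - graphPt p e F s‖ ^ (-(1 / 2) : ℝ)) := by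
        rw [chartMeasure, lintegral_map hg hcont.measurable]
    _ ≤ ∫⁻ s in Ioo (-r) r, ENNReal.ofReal (‖x - graphPt p e F s‖ ^ (-(1 / 2) : ℝ)) :=
        lintegral_mono_set hsub
    _ ≤ ∫⁻ s in Ioo (-r) r, (k (x₁ - s) + k (s - x₁) + 1) := by
        refine lintegral_mono_ae (ae_restrict_of_ae ?_)
        filter_upwards [hne] with s hs
        have h1 := hkle _ hs
        rw [neg_sub] at h1
        refine le_trans (ENNReal.ofReal_le_ofReal ?_) h1
        exact Real.rpow_le_rpow_of_nonpos (abs_pos.2 hs) (hdist s) (by norm_num)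
    _ = (∫⁻ s in Ioo (-r) r, k (x₁ - s)) + (∫⁻ s in Ioo (-r) r, k (s - x₁))
          + volume (Ioo (-r) r) := by
        have m1 : Measurable fun s => k (x₁ - s) := hkm.comp (measurable_id.const_sub x₁)
        have m2 : Measurable fun s => k (s - x₁) := hkm.comp (measurable_id.sub_const x₁)
        rw [lintegral_add_right _ measurable_const, lintegral_add_left m1]
        simp
    _ ≤ _ := by
        refine add_le_add (add_le_add ?_ ?_) le_rfl
        · refine (setLIntegral_le_lintegral _ _).trans (le_of_eq ?_)
          exact lintegral_sub_left_eq_self k x₁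
        · refine (setLIntegral_le_lintegral _ _).trans (le_of_eq ?_)
          exact lintegral_sub_right_eq_self k x₁

/-! ### Bump functions at the scale `γ` -/

/-- A fixed radial profile, equal to `1` on the ball of radius `1 / 2` and supported in the unit
ball. -/
def bumpProfile : ContDiffBump (0 : Plane) := ⟨1 / 2, 1, by norm_num, by norm_num⟩

/-- The bump function at the scale `γ` centred at `c`. -/
def bumpAt (γ : ℝ) (c x : Plane) : ℝ := bumpProfile (γ⁻¹ • (x - c))

theorem contDiff_bumpAt (γ : ℝ) (c : Plane) : ContDiff ℝ ∞ (bumpAt γ c) := by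
  have h : ContDiff ℝ ∞ fun x : Plane => γ⁻¹ • (x - c) := by fun_prop
  exact bumpProfile.contDiff.comp h

theorem bumpAt_nonneg (γ : ℝ) (c x : Plane) : 0 ≤ bumpAt γ c x := bumpProfile.nonneg

theorem bumpAt_le_one (γ : ℝ) (c x : Plane) : bumpAt γ c x ≤ 1 := bumpProfile.le_one

theorem bumpAt_eq_one {γ : ℝ} (hγ : 0 < γ) {c x : Plane} (h : ‖x - c‖ ≤ γ / 2) :
    bumpAt γ c x = 1 := by
  refine bumpProfile.one_of_mem_closedBall ?_
  rw [mem_closedBall_zero_iff, norm_smul, norm_inv, Real.norm_eq_abs, abs_of_pos hγ,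
    inv_mul_le_iff₀ hγ]
  change _ ≤ γ * (1 / 2)
  linarith

theorem norm_sub_lt_of_bumpAt_ne_zero {γ : ℝ} (hγ : 0 < γ) {c x : Plane} (h : bumpAt γ c x ≠ 0) :
    ‖x - c‖ < γ := by
  have h1 : γ⁻¹ • (x - c) ∈ Function.support bumpProfile := h
  rw [bumpProfile.support_eq, mem_ball_zero_iff, norm_smul, norm_inv, Real.norm_eq_abs,
    abs_of_pos hγ, inv_mul_lt_iff₀ hγ] at h1
  change _ < γ * 1 at h1
  linarith

/-- `bumpAt` as a complex valued function. -/
def cBump (γ : ℝ) (c : Plane) : Plane → ℂ := fun x => (bumpAt γ c x : ℂ)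

theorem contDiff_cBump (γ : ℝ) (c : Plane) : ContDiff ℝ ∞ (cBump γ c) :=
  Complex.ofRealCLM.contDiff.comp (contDiff_bumpAt γ c)

theorem tsupport_bumpAt_subset {γ : ℝ} (hγ : 0 < γ) (c : Plane) :
    tsupport (bumpAt γ c) ⊆ Metric.closedBall c γ :=
  closure_minimal (fun _ hx => mem_closedBall_iff_norm.2 (norm_sub_lt_of_bumpAt_ne_zero hγ hx).le)
    Metric.isClosed_closedBall

theorem hasCompactSupport_bumpAt {γ : ℝ} (hγ : 0 < γ) (c : Plane) :
    HasCompactSupport (bumpAt γ c) :=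
  (isCompact_closedBall c γ).of_isClosed_subset (isClosed_tsupport _) (tsupport_bumpAt_subset hγ c)

theorem tsupport_cBump_subset {γ : ℝ} (hγ : 0 < γ) (c : Plane) :
    tsupport (cBump γ c) ⊆ Metric.closedBall c γ :=
  (closure_mono (show Function.support (cBump γ c) ⊆ Function.support (bumpAt γ c) from
    fun x hx h0 => hx (by simp [cBump, h0]))).trans (tsupport_bumpAt_subset hγ c)

theorem hasCompactSupport_cBump {γ : ℝ} (hγ : 0 < γ) (c : Plane) : HasCompactSupport (cBump γ c) :=
  (hasCompactSupport_bumpAt hγ c).comp_left (g := fun t : ℝ => (t : ℂ)) (by simp)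

theorem norm_cBump_le (γ : ℝ) (c x : Plane) : ‖cBump γ c x‖ ≤ 1 := by
  rw [cBump, Complex.norm_real, Real.norm_eq_abs, abs_of_nonneg (bumpAt_nonneg γ c x)]
  exact bumpAt_le_one γ c x

theorem exists_bound_partialD_cBump :
    ∃ M, 0 ≤ M ∧ ∀ γ, 0 < γ → ∀ c i x, ‖partialD i (cBump γ c) x‖ ≤ M * γ⁻¹ := by
  have hs : ContDiff ℝ ∞ fun x => (bumpProfile x : ℂ) :=
    Complex.ofRealCLM.contDiff.comp bumpProfile.contDiff
  obtain ⟨M, hM0, -, hM⟩ := exists_bound_of_compact (hs.of_le (by simp))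
    (bumpProfile.hasCompactSupport.comp_left (g := fun t : ℝ => (t : ℂ)) (by simp))
  refine ⟨M, hM0, fun γ hγ c i x => ?_⟩
  have h1 := (hs.differentiable (by simp) (γ⁻¹ • (x - c))).hasFDerivAt
  have h2 : HasFDerivAt (fun x : Plane => γ⁻¹ • (x - c))
      (γ⁻¹ • ContinuousLinearMap.id ℝ Plane) x := ((hasFDerivAt_id x).sub_const c).const_smul γ⁻¹
  have h3 : HasFDerivAt (cBump γ c) _ x :=
    HasFDerivAt.comp (g := fun x => (bumpProfile x : ℂ)) x h1 h2
  rw [partialD, h3.fderiv]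
  have h4 := hM i (γ⁻¹ • (x - c))
  have e : ((fderiv ℝ (fun x => (bumpProfile x : ℂ)) (γ⁻¹ • (x - c))).comp
      (γ⁻¹ • ContinuousLinearMap.id ℝ Plane)) (EuclideanSpace.single i 1)
      = γ⁻¹ • partialD i (fun x => (bumpProfile x : ℂ)) (γ⁻¹ • (x - c)) := by
    simp [partialD]
  rw [e, norm_smul, norm_inv, Real.norm_eq_abs, abs_of_pos hγ, mul_comm]
  gcongr

theorem norm_le_of_coord_le {z : EuclideanSpace ℂ (Fin 2)} {K : ℝ} (h : ∀ i, ‖z i‖ ≤ K) :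
    ‖z‖ ≤ 2 * K := by
  have hK : 0 ≤ K := (norm_nonneg _).trans (h 0)
  rw [EuclideanSpace.norm_eq, Fin.sum_univ_two]
  refine Real.sqrt_le_iff.2 ⟨by positivity, ?_⟩
  nlinarith [h 0, h 1, norm_nonneg (z 0), norm_nonneg (z 1)]

theorem norm_fderiv_apply_le (u : Plane → ℂ) (x w : Plane) :
    ‖fderiv ℝ u x w‖ ≤ 2 * ‖w‖ * ‖classicalGrad u x‖ := by
  have hw : w = ∑ i, w i • (EuclideanSpace.single i (1 : ℝ) : Plane) := by
    ext j
    fin_cases j <;> simp [Fin.sum_univ_two]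
  have h1 : fderiv ℝ u x w = ∑ i, w i • classicalGrad u x i := by
    conv_lhs => rw [hw]
    rw [map_sum]
    simp only [map_smul]
    rfl
  have h2 : ∀ i, ‖w i • classicalGrad u x i‖ ≤ ‖w‖ * ‖classicalGrad u x‖ := fun i => by
    rw [norm_smul]
    exact mul_le_mul (abs_coord_le_norm w i) (PiLp.norm_apply_le _ i) (norm_nonneg _)
      (norm_nonneg _)
  rw [h1, Fin.sum_univ_two]
  refine (norm_add_le _ _).trans ?_
  linarith [h2 0, h2 1]

theorem eLpNorm_le_of_support {α E : Type*} [MeasurableSpace α] [NormedAddCommGroup E]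
    {μ : Measure α} {f : α → E} {S : Set α} (hS : MeasurableSet S) {K : ℝ}
    (hK : ∀ x, ‖f x‖ ≤ K) (h0 : ∀ x ∉ S, f x = 0) :
    eLpNorm f 2 μ ≤ μ S ^ (1 / 2 : ℝ) * ENNReal.ofReal K := by
  have e : f = S.indicator f := by
    funext x
    by_cases hx : x ∈ S
    · rw [indicator_of_mem hx]
    · rw [indicator_of_notMem hx, h0 x hx]
  rw [e, eLpNorm_indicator_eq_eLpNorm_restrict hS]
  refine (eLpNorm_le_of_ae_bound (Eventually.of_forall hK)).trans (le_of_eq ?_)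
  rw [Measure.restrict_apply_univ]
  norm_num

theorem ofReal_sq_rpow_half {x : ℝ} (hx : 0 ≤ x) :
    ENNReal.ofReal (x ^ 2) ^ (1 / 2 : ℝ) = ENNReal.ofReal x := by
  rw [ENNReal.ofReal_pow hx, ← ENNReal.rpow_natCast, ← ENNReal.rpow_mul]
  norm_num

theorem volume_closedBall_rpow_half_le (S : Set Plane) {γ : ℝ} (hγ : 0 < γ) (c : Plane) :
    (volume.restrict S) (Metric.closedBall c γ) ^ (1 / 2 : ℝ) ≤ ENNReal.ofReal (2 * γ) := by
  rw [← ofReal_sq_rpow_half (by positivity)]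
  refine ENNReal.rpow_le_rpow ((Measure.restrict_apply_le _ _).trans ?_) (by norm_num)
  rw [EuclideanSpace.volume_closedBall_fin_two, ← ENNReal.ofReal_pow hγ.le]
  rw [← ENNReal.ofReal_mul (by positivity)]
  refine ENNReal.ofReal_le_ofReal ?_
  nlinarith [Real.pi_le_four, sq_nonneg γ]

theorem eLpNorm_cBump_le (S : Set Plane) {γ : ℝ} (hγ : 0 < γ) (c : Plane) :
    eLpNorm (cBump γ c) 2 (volume.restrict S) ≤ ENNReal.ofReal (2 * γ) := by
  refine (eLpNorm_le_of_support Metric.isClosed_closedBall.measurableSet (norm_cBump_le γ c)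
    fun x hx => image_eq_zero_of_notMem_tsupport fun h => hx (tsupport_cBump_subset hγ c h)).trans ?_
  rw [ENNReal.ofReal_one, mul_one]
  exact volume_closedBall_rpow_half_le S hγ c

theorem eLpNorm_classicalGrad_cBump_le {M : ℝ}
    (hM : ∀ γ, 0 < γ → ∀ c i x, ‖partialD i (cBump γ c) x‖ ≤ M * γ⁻¹) (S : Set Plane) {γ : ℝ}
    (hγ : 0 < γ) (c : Plane) :
    eLpNorm (classicalGrad (cBump γ c)) 2 (volume.restrict S) ≤ ENNReal.ofReal (4 * M) := by
  refine (eLpNorm_le_of_support (S := Metric.closedBall c γ)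
    Metric.isClosed_closedBall.measurableSet (K := 2 * (M * γ⁻¹))
    (fun x => norm_le_of_coord_le fun i => hM γ hγ c i x) fun x hx => ?_).trans ?_
  · have h0 : fderiv ℝ (cBump γ c) x = 0 := image_eq_zero_of_notMem_tsupport fun h =>
      hx (tsupport_cBump_subset hγ c (tsupport_fderiv_subset ℝ h))
    ext i
    simp [classicalGrad, h0]
  · refine (mul_le_mul_left (volume_closedBall_rpow_half_le S hγ c) _).trans (le_of_eq ?_)
    rw [← ENNReal.ofReal_mul (by positivity)]
    congr 1
    field_simp
    ring

namespace IsCornerChart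

variable {Ω : Set Plane} {p : Plane} {e : Plane ≃ₗᵢ[ℝ] Plane} {fneg fpos : ℝ → ℝ} {r : ℝ}

/-- The dual norm of a bump of scale `γ` is of order `γ`: integration by parts in the transversal
direction gains one order over the trivial estimate. -/
theorem dualNorm_le_of_bump (hc : IsCornerChart Ω p e fneg fpos r) (hΩ : IsOpen Ω)
    [IsFiniteMeasure (arcMeasure (frontier Ω))] {γ : ℝ} (hγ : 0 < γ) {c : Plane}
    (hsub : Metric.closedBall c γ ⊆ Metric.ball p r) {M : ℝ} (hM0 : 0 ≤ M)
    (hM : ∀ γ, 0 < γ → ∀ c i x, ‖partialD i (cBump γ c) x‖ ≤ M * γ⁻¹)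
    {f : Lp ℂ 2 (arcMeasure (frontier Ω))}
    (hf : ∀ u : Plane → ℂ, Continuous u → ∫ x, f x * u x ∂(arcMeasure (frontier Ω))
      = ∫ s, cBump γ c (graphPt p e (legFun fneg fpos) s)
        * u (graphPt p e (legFun fneg fpos) s)) :
    dualNorm γ Ω 1 (ofL2 f) ≤ ENNReal.ofReal ((8 * M + 4) * γ) := by
  have hA : (ENNReal.ofReal (8 * M)) ≠ ⊤ := ENNReal.ofReal_ne_top
  have hB : (ENNReal.ofReal (4 * γ)) ≠ ⊤ := ENNReal.ofReal_ne_top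
  refine (dualNorm_le hγ hA hB fun v F G hFG => ?_).trans (le_of_eq ?_)
  swap
  · rw [← ENNReal.ofReal_mul (by positivity), ← ENNReal.ofReal_add (by positivity) (by positivity)]
    congr 1
    ring
  rw [ofL2_apply]
  refine enorm_ofL2_le_of_smooth hA hB hFG fun u hu huc => ?_
  change _ ≤ _ * eLpNorm u 2 (volume.restrict Ω) + _ * eLpNorm _ 2 (volume.restrict Ω)
  set b := cBump γ c with hb
  have hbs : ContDiff ℝ ∞ b := contDiff_cBump γ c
  have hbc : HasCompactSupport b := hasCompactSupport_cBump hγ c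
  -- for the vertical direction `w` of the chart the boundary integral has the constant weight `-1`,
  -- so that the functional is minus the integral over `Ω` of the derivative of the product
  set w : Plane := e.symm (EuclideanSpace.single 1 1) with hw
  have hwn : ‖w‖ = 1 := by rw [hw, LinearIsometryEquiv.norm_map]; simp
  have h1 := hc.integral_fderiv hΩ (u := fun x => b x * u x) ((hbs.mul hu).of_le (by simp))
    hbc.mul_right ((tsupport_mul_subset_left).trans ((tsupport_cBump_subset hγ c).trans hsub)) w
  have e0 : e w = EuclideanSpace.single 1 1 := by rw [hw, LinearIsometryEquiv.apply_symm_apply]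
  rw [e0] at h1
  have h2 : ∫ x, f x * u x ∂(arcMeasure (frontier Ω))
      = -∫ x in Ω, fderiv ℝ (fun x => b x * u x) x w := by
    rw [hf u hu.continuous, h1, ← integral_neg]
    simp
  have hcd : ∀ {g : Plane → ℂ}, ContDiff ℝ ∞ g → Continuous fun x => fderiv ℝ g x w :=
    fun hg => (hg.continuous_fderiv (by simp)).clm_apply continuous_const
  have h3 : ∀ x, fderiv ℝ (fun x => b x * u x) x w = b x * fderiv ℝ u x w
      + fderiv ℝ b x w * u x := fun x => by
    rw [fderiv_fun_mul (hbs.differentiable (by simp) x) (hu.differentiable (by simp) x)]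
    simp only [add_apply, smul_apply, smul_eq_mul]
    ring
  have hder : ∀ {g : Plane → ℂ}, ContDiff ℝ ∞ g → eLpNorm (fun x => fderiv ℝ g x w) 2
      (volume.restrict Ω) ≤ 2 * eLpNorm (classicalGrad g) 2 (volume.restrict Ω) := fun {g} hg => by
    have := eLpNorm_le_mul_eLpNorm_of_ae_le_mul (μ := volume.restrict Ω) (p := 2)
      (f := fun x => fderiv ℝ g x w) (g := classicalGrad g) (c := 2)
      (Eventually.of_forall fun x => by
        have := norm_fderiv_apply_le g x w
        rwa [hwn, mul_one] at this)
    simpa using this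
  rw [h2, enorm_neg]
  simp only [h3]
  rw [integral_add]
  · refine (enorm_add_le _ _).trans ?_
    rw [add_comm]
    refine add_le_add ?_ ?_
    · refine (enorm_integral_mul_le (hcd hbs).aestronglyMeasurable
        hu.continuous.aestronglyMeasurable).trans ?_
      refine mul_le_mul_left ((hder hbs).trans ?_) _
      refine (mul_le_mul_right (eLpNorm_classicalGrad_cBump_le hM Ω hγ c) _).trans
        (le_of_eq ?_)
      rw [show (2 : ℝ≥0∞) = ENNReal.ofReal 2 by simp, ← ENNReal.ofReal_mul (by norm_num)]
      congr 1
      ring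
    · refine (enorm_integral_mul_le hbs.continuous.aestronglyMeasurable
        (hcd hu).aestronglyMeasurable).trans ?_
      refine (mul_le_mul' (eLpNorm_cBump_le Ω hγ c) (hder hu)).trans (le_of_eq ?_)
      rw [← mul_assoc]
      congr 1
      rw [show (2 : ℝ≥0∞) = ENNReal.ofReal 2 by simp, ← ENNReal.ofReal_mul (by positivity)]
      congr 1
      ring
  · exact ((hbs.continuous.mul (hcd hu)).integrable_of_hasCompactSupport
      hbc.mul_right).integrableOn
  · exact (((hcd hbs).mul hu.continuous).integrable_of_hasCompactSupport
      huc.mul_left).integrableOn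

theorem graphPt_zero (hc : IsCornerChart Ω p e fneg fpos r) :
    graphPt p e (legFun fneg fpos) 0 = p := by
  have h := graphPt_coord p e (legFun fneg fpos) 0
  rw [hc.isLegPair.legFun_zero] at h
  have h2 : e (graphPt p e (legFun fneg fpos) 0 - p) = 0 := by
    rw [h]; ext i; fin_cases i <;> simp
  exact sub_eq_zero.1 ((map_eq_zero_iff e e.injective).1 h2)

/-- The measure on a side of the corner whose density is a bump function of scale `γ`, at the
distance `2 γ` from the corner. -/
theorem exists_bump_measure (hc : IsCornerChart Ω p e fneg fpos r)
    [IsFiniteMeasure (arcMeasure (frontier Ω))] {L : ℝ} (hL0 : 0 ≤ L)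
    (hL : ∀ s ∈ Icc (-r) r, ∀ t ∈ Icc (-r) r,
      |legFun fneg fpos s - legFun fneg fpos t| ≤ L * |s - t|)
    {γ : ℝ} (hγ : 0 < γ) (hsmall : (1 + L) * (2 * γ) + γ < r / 4) :
    ∃ ν : Measure Plane, IsFiniteMeasure ν ∧ ν ≤ chartMeasure p e (legFun fneg fpos) r ∧
      ν univ ≤ ENNReal.ofReal (2 * γ) ∧ 2 * ((2 * (1 + L))⁻¹ * γ) ≤ ν.real univ ∧
      (∀ᵐ y ∂ν, y ∈ Metric.ball (graphPt p e (legFun fneg fpos) (2 * γ)) γ ∧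
        ∃ t₀ ∈ Icc γ (3 * γ), y = graphPt p e (legFun fneg fpos) t₀) ∧
      ∀ u : Plane → ℂ, Continuous u → ∫ x, u x ∂ν
        = ∫ s, cBump γ (graphPt p e (legFun fneg fpos) (2 * γ))
            (graphPt p e (legFun fneg fpos) s) * u (graphPt p e (legFun fneg fpos) s) := by
  have hr := hc.radius_pos
  have hl := hc.isLegPair
  set F := legFun fneg fpos with hF
  set c := graphPt p e F (2 * γ) with hcdef
  have hLγ : 0 ≤ L * γ := by positivity
  have hcp : ‖c - p‖ ≤ (1 + L) * (2 * γ) := by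
    have := norm_graphPt_sub_le p e F (hL (2 * γ) ⟨by linarith, by linarith⟩ 0
      ⟨by linarith, hr.le⟩)
    rwa [hc.graphPt_zero, sub_zero, abs_of_pos (by positivity)] at this
  have hsub : Metric.closedBall c γ ⊆ Metric.ball p r := by
    refine Metric.closedBall_subset_ball' ?_
    rw [dist_eq_norm]
    linarith
  set m := chartMeasure p e F r with hm
  have hmσ : m ≤ arcMeasure (frontier Ω) := hc.chartMeasure_le
  set b := bumpAt γ c with hb
  have hbm : Measurable b := (contDiff_bumpAt γ c).continuous.measurable
  set d : Plane → ℝ≥0∞ := fun x => ENNReal.ofReal (b x) with hd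
  have hdm : Measurable d := hbm.ennreal_ofReal
  have hle : m.withDensity d ≤ m := by
    refine (withDensity_mono (g := 1) (Eventually.of_forall fun x => ?_)).trans (by simp)
    exact ENNReal.ofReal_le_one.2 (bumpAt_le_one γ c x)
  have hfin : IsFiniteMeasure (m.withDensity d) :=
    isFiniteMeasure_of_le _ (hle.trans hmσ)
  have huniv : (m.withDensity d) univ = ∫⁻ s, d (graphPt p e F s) := by
    rw [withDensity_apply _ MeasurableSet.univ, Measure.restrict_univ,
      hc.lintegral_chartMeasure hdm]
    intro x hx
    have : b x = 0 := image_eq_zero_of_notMem_tsupport fun h =>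
      hx (hsub (tsupport_bumpAt_subset hγ c h))
    simp [hd, this]
  have hsupp : ∀ s, b (graphPt p e F s) ≠ 0 → s ∈ Icc γ (3 * γ) := fun s hs => by
    have h1 := (abs_sub_le_norm_graphPt_sub p e F s (2 * γ)).trans_lt
      (norm_sub_lt_of_bumpAt_ne_zero hγ hs)
    rw [abs_lt] at h1
    exact ⟨by linarith [h1.1], by linarith [h1.2]⟩
  refine ⟨m.withDensity d, hfin, hle, ?_, ?_, ?_, ?_⟩
  · rw [huniv]
    calc ∫⁻ s, d (graphPt p e F s) ≤ ∫⁻ s, (Icc γ (3 * γ)).indicator 1 s := by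
          refine lintegral_mono fun s => ?_
          by_cases hs : s ∈ Icc γ (3 * γ)
          · rw [indicator_of_mem hs]
            exact ENNReal.ofReal_le_one.2 (bumpAt_le_one γ c _)
          · rw [indicator_of_notMem hs]
            have : b (graphPt p e F s) = 0 := by_contra fun h => hs (hsupp s h)
            simp [hd, this]
      _ = ENNReal.ofReal (2 * γ) := by
          rw [lintegral_indicator_one measurableSet_Icc, Real.volume_Icc]
          congr 1
          ring
  · rw [Measure.real, ← ENNReal.ofReal_le_iff_le_toReal (measure_ne_top _ _), huniv]
    set k := (2 * (1 + L))⁻¹ with hk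
    have hk0 : 0 < k := by positivity
    have hk1 : (1 + L) * k = 1 / 2 := by rw [hk]; field_simp
    have hkγ : k * γ ≤ γ := by
      have : k ≤ 1 := inv_le_one_of_one_le₀ (by linarith)
      nlinarith
    calc ENNReal.ofReal (2 * (k * γ))
        = ∫⁻ s, (Icc (2 * γ - k * γ) (2 * γ + k * γ)).indicator 1 s := by
          rw [lintegral_indicator_one measurableSet_Icc, Real.volume_Icc]
          congr 1
          ring
      _ ≤ ∫⁻ s, d (graphPt p e F s) := by
          refine lintegral_mono fun s => ?_
          by_cases hs : s ∈ Icc (2 * γ - k * γ) (2 * γ + k * γ)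
          · rw [indicator_of_mem hs]
            have h1 : |s - 2 * γ| ≤ k * γ := by
              rw [abs_le]; exact ⟨by linarith [hs.1], by linarith [hs.2]⟩
            have h2 : ‖graphPt p e F s - c‖ ≤ γ / 2 := by
              refine (norm_graphPt_sub_le p e F (hL s ⟨by linarith [hs.1], by linarith [hs.2]⟩
                (2 * γ) ⟨by linarith, by linarith⟩)).trans ?_
              calc (1 + L) * |s - 2 * γ| ≤ (1 + L) * (k * γ) := by gcongr
                _ = γ / 2 := by rw [← mul_assoc, hk1]; ring
            simp [hd, hb, bumpAt_eq_one hγ h2]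
          · rw [indicator_of_notMem hs]
            exact zero_le
  · refine (ae_withDensity_iff hdm).2 ?_
    have hfr : ∀ᵐ y ∂m, y ∈ frontier Ω := by
      rw [ae_iff]
      exact ae_mem_frontier hmσ
    filter_upwards [hfr] with y hy hdy
    have hby : b y ≠ 0 := fun h => hdy (by simp [hd, h])
    have h1 : y ∈ Metric.ball c γ := mem_ball_iff_norm.2 (norm_sub_lt_of_bumpAt_ne_zero hγ hby)
    have h2 := hc.eq_graphPt (hsub (Metric.ball_subset_closedBall h1)) hy
    refine ⟨h1, e (y - p) 0, hsupp _ ?_, h2⟩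
    rw [← h2]
    exact hby
  · intro u hu
    have hbu : Continuous fun x => cBump γ c x * u x := (contDiff_cBump γ c).continuous.mul hu
    rw [← hc.integral_chartMeasure hbu ((tsupport_mul_subset_left).trans
      ((tsupport_cBump_subset hγ c).trans hsub)),
      integral_withDensity_eq_integral_toReal_smul hdm (Eventually.of_forall fun x => by simp [hd])]
    congr 1
    funext x
    rw [hd, ENNReal.toReal_ofReal (bumpAt_nonneg γ c x)]
    rfl

end IsCornerChart

theorem h1Norm_le {γ : ℝ} (hγ : 0 < γ) (S : Set Plane) (F : Plane → ℂ)
    (G : Plane → EuclideanSpace ℂ (Fin 2)) :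
    h1Norm γ S F G ≤ eLpNorm G 2 (volume.restrict S)
      + ENNReal.ofReal γ⁻¹ * eLpNorm F 2 (volume.restrict S) := by
  set X := eLpNorm G 2 (volume.restrict S)
  set Y := ENNReal.ofReal γ⁻¹ * eLpNorm F 2 (volume.restrict S) with hY
  have e1 : X + Y = ((X + Y) ^ 2) ^ (1 / 2 : ℝ) := by
    rw [← ENNReal.rpow_natCast, ← ENNReal.rpow_mul]; norm_num
  have e2 : ENNReal.ofReal (γ⁻¹ ^ 2) * eLpNorm F 2 (volume.restrict S) ^ 2 = Y ^ 2 := by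
    rw [hY, mul_pow, ENNReal.ofReal_pow (by positivity)]
  rw [e1, h1Norm, e2]
  refine ENNReal.rpow_le_rpow ?_ (by norm_num)
  rw [add_sq]
  exact add_le_add le_self_add le_rfl

/-! ### Failure of convergence at a vertex -/

theorem integrable_integral_greenEnergy {a : ℝ} (ha : 0 < a) (ν : Measure Plane) [IsFiniteMeasure ν]
    {u : Plane → ℂ} (hu : ContDiff ℝ 1 u) (hc : HasCompactSupport u) (Ω : Set Plane) :
    Integrable (fun y => ∫ x in Ω, greenEnergy a u y x) ν :=
  (integrable_greenEnergy_prod ha ν hu hc Ω).integral_prod_right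

set_option maxHeartbeats 1000000 in
/-- For small `γ` there is a pair `φ = (0, f)`, with `f` concentrated at the distance `2 γ` from a
vertex, for which `Π_γ φ - Π₀ φ` is comparable with `φ` in all the spaces `H^s_γ(Γ)` at once. -/
theorem IsCurvilinearPolygon.exists_exchange_lower {Ω : Set Plane} (h : IsCurvilinearPolygon Ω)
    (hv : ∃ p, IsVertex Ω p) :
    ∃ c : ℝ, 0 < c ∧ ∀ γ : ℝ, 0 < γ → γ < c → ∃ φ ψ : NeumannPair Ω, φ ≠ 0 ∧
      IsExchange γ Ω φ ψ ∧ ∀ s : ℝ, -(1 / 2) ≤ s → s ≤ 0 → MemHs γ Ω s φ ∧ MemHs γ Ω s ψ ∧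
        0 < hsNorm γ Ω s (ψ - localExchange φ) ∧
        ENNReal.ofReal c * hsNorm γ Ω s φ ≤ hsNorm γ Ω s (ψ - localExchange φ) := by
  have hfin := h.isFiniteMeasure_arcMeasure
  obtain ⟨p, hpf, e, fneg, fpos, r, hc, hne⟩ := hv
  have hr := hc.radius_pos
  have hl := hc.isLegPair
  obtain ⟨L, hL0, hL⟩ := hl.exists_lipschitz r
  set k := (2 * (1 + L))⁻¹ with hk
  have hk0 : 0 < k := by positivity
  have hk1 : (1 + L) * k = 1 / 2 := by rw [hk]; field_simp
  obtain ⟨ρ, P, hρ, hP, hlow⟩ := hc.exists_greenEnergy_lower h.isOpen hne hk0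
  obtain ⟨M, hM0, hM⟩ := exists_bound_partialD_cBump
  set δ := deriv fpos 0 - deriv fneg 0 with hδ
  have hδ0 : 0 < |δ| := abs_pos.2 (sub_ne_zero.2 (Ne.symm hne))
  -- the normalization of the test function, which has norm at most `1` in `H¹_γ`
  set B := 4 * M + 2 with hB
  have hB0 : 0 < B := by positivity
  set p₀ := 2 * (P * B⁻¹ * (2 * k)) / |δ| with hp₀
  have hp₀0 : 0 < p₀ := by positivity
  set c := min (min ρ (r / (16 * (1 + L)))) (min (p₀ / (4 * (1 + L))) (p₀ / (2 * (8 * M + 4))))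
    with hcdef
  have hc0 : 0 < c := lt_min (lt_min hρ (by positivity)) (lt_min (by positivity) (by positivity))
  have hc1 : c * (4 * (1 + L)) ≤ p₀ := by
    rw [← le_div_iff₀ (by positivity)]
    exact (min_le_right _ _).trans (min_le_left _ _)
  have hc2 : c * (2 * (8 * M + 4)) ≤ p₀ := by
    rw [← le_div_iff₀ (by positivity)]
    exact (min_le_right _ _).trans (min_le_right _ _)
  refine ⟨c, hc0, fun γ hγ hγc => ?_⟩
  have hγρ : γ < ρ := hγc.trans_le ((min_le_left _ _).trans (min_le_left _ _))
  have hγr : γ * (16 * (1 + L)) < r := by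
    rw [← lt_div_iff₀ (by positivity)]
    exact hγc.trans_le ((min_le_left _ _).trans (min_le_right _ _))
  have hLγ : 0 ≤ L * γ := by positivity
  have hsmall : (1 + L) * (2 * γ) + γ < r / 4 := by nlinarith
  have ha : 0 < γ⁻¹ ^ 2 := by positivity
  set F := legFun fneg fpos with hF
  obtain ⟨ν, hνfin, hνm, hν2, hν1, hνae, hνint⟩ := hc.exists_bump_measure hL0 hL hγ hsmall
  set cp := graphPt p e F (2 * γ) with hcp
  set cn := graphPt p e F (-(2 * γ)) with hcn
  have hcenter : ∀ t, |t| = 2 * γ → ‖graphPt p e F t - p‖ ≤ (1 + L) * (2 * γ) := by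
    intro t ht
    have ht' := abs_le.1 ht.le
    have := norm_graphPt_sub_le p e F (hL t ⟨by linarith [ht'.1], by linarith [ht'.2]⟩ 0
      ⟨by linarith, hr.le⟩)
    rwa [hc.graphPt_zero, sub_zero, ht] at this
  have hcpn : ‖cp - p‖ ≤ (1 + L) * (2 * γ) := hcenter _ (abs_of_pos (by positivity))
  have hcnn : ‖cn - p‖ ≤ (1 + L) * (2 * γ) := hcenter _ (by
    rw [abs_neg]; exact abs_of_pos (by positivity))
  have hsubp : Metric.closedBall cp γ ⊆ Metric.ball p (r / 4) :=
    Metric.closedBall_subset_ball' (by rw [dist_eq_norm]; linarith)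
  have hsubn : Metric.closedBall cn γ ⊆ Metric.ball p r :=
    Metric.closedBall_subset_ball' (by rw [dist_eq_norm]; linarith)
  have hνσ : ν ≤ arcMeasure (frontier Ω) := hνm.trans hc.chartMeasure_le
  have hνR : HasBoundedRiesz ν := hc.hasBoundedRiesz hνm
  obtain ⟨f, hf, hfn⟩ := exists_density hνσ
  obtain ⟨f₁, hf₁⟩ := h.exists_normal_density hc ha hγ hνR hνσ (by
    filter_upwards [hνae] with y hy
    obtain ⟨h1, t₀, ht₀, rfl⟩ := hy
    exact ⟨t₀, ht₀.1, by linarith [ht₀.2], hsubp (Metric.ball_subset_closedBall h1), rfl⟩)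
  obtain ⟨hex, hdual⟩ := isExchange_of_density h hγ hνR hνσ hf hf₁
  set φ : NeumannPair Ω := ![0, ofL2 f] with hφ
  set ψ : NeumannPair Ω := fun j => φ j - (2 : ℂ) • ofL2 (![f - f₁, f₁] j) with hψ
  have hφ0 : φ 0 = 0 := rfl
  have hφ1 : φ 1 = ofL2 f := rfl
  -- `φ` is of order `γ ^ (1 / 2)` in `L²(Γ)`, and of order `γ` in the dual norm
  have hα : pairL2Norm Ω φ ≤ ENNReal.ofReal √(2 * γ) := by
    rw [pairL2Norm_of_zero hφ0, hφ1]
    refine (l2Norm_ofL2_le f).trans ?_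
    rw [← ENNReal.pow_le_pow_left_iff two_ne_zero, ← ENNReal.ofReal_pow (Real.sqrt_nonneg _),
      Real.sq_sqrt (by positivity)]
    exact hfn.trans hν2
  have hβ : pairDualNorm γ Ω φ ≤ ENNReal.ofReal ((8 * M + 4) * γ) := by
    rw [pairDualNorm_of_zero hφ0, hφ1]
    exact hc.dualNorm_le_of_bump h.isOpen hγ
      (hsubp.trans (Metric.ball_subset_ball (by linarith))) hM0 hM
      fun u hu => (hf u).trans (hνint u hu)
  -- both norms of `ψ` are finite, without any uniformity in `γ`
  have hψl2 : pairL2Norm Ω ψ < ⊤ := by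
    have h1 : ∀ j, l2Norm Ω (ψ j) < ⊤ := by
      intro j
      have e1 : ψ j = ofL2 ((![0, f] : Fin 2 → Lp ℂ 2 (arcMeasure (frontier Ω))) j
          + (-2 : ℂ) • (![f - f₁, f₁] : Fin 2 → Lp ℂ 2 (arcMeasure (frontier Ω))) j) := by
        rw [ofL2_add, ofL2_smul, neg_smul, ← sub_eq_add_neg]
        have e2 : φ j = ofL2 ((![0, f] : Fin 2 → Lp ℂ 2 (arcMeasure (frontier Ω))) j) := by
          fin_cases j
          · have := ofL2_smul (Ω := Ω) 0 0
            rw [zero_smul, zero_smul] at this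
            exact this.symm
          · rfl
        rw [← e2]
      rw [e1]
      exact (l2Norm_ofL2_le _).trans_lt enorm_lt_top
    have h2 : pairL2Norm Ω ψ ^ 2 < ⊤ := by
      rw [pairL2Norm_sq]
      exact ENNReal.add_lt_top.2 ⟨ENNReal.pow_lt_top (h1 0), ENNReal.pow_lt_top (h1 1)⟩
    exact lt_top_iff_ne_top.2 fun h3 => h2.ne (by rw [h3]; simp)
  have hφdual : ∀ j, dualNorm γ Ω j (φ j) < ⊤ := by
    intro j
    fin_cases j
    · exact (dualNorm_zero γ Ω 0).trans_lt ENNReal.zero_lt_top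
    · exact (dualNorm_le_pairDualNorm γ Ω φ).trans_lt (hβ.trans_lt ENNReal.ofReal_lt_top)
  have hψdual : pairDualNorm γ Ω ψ < ⊤ := by
    have h1 : ∀ j, dualNorm γ Ω j (ψ j) < ⊤ := fun j =>
      dualNorm_add_smul_lt_top 2 (hφdual j) (hdual j)
    have h2 : pairDualNorm γ Ω ψ ^ 2 < ⊤ := by
      rw [pairDualNorm_sq]
      exact ENNReal.add_lt_top.2 ⟨ENNReal.pow_lt_top (h1 0), ENNReal.pow_lt_top (h1 1)⟩
    exact lt_top_iff_ne_top.2 fun h3 => h2.ne (by rw [h3]; simp)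
  -- `φ` does not vanish: its value on a bump equal to `1` on the support is the mass of `ν`
  have hφne : φ ≠ 0 := by
    intro h0
    have h1 : ofL2 f (smoothTrace Ω (contDiff_cBump (2 * γ) cp)
        (hasCompactSupport_cBump (by positivity) cp)) = 0 := by
      rw [← hφ1, h0]; rfl
    rw [ofL2_smoothTrace, hf] at h1
    have h2 : ∫ x, cBump (2 * γ) cp x ∂ν = ∫ _, (1 : ℂ) ∂ν := by
      refine integral_congr_ae ?_
      filter_upwards [hνae] with y hy
      have : ‖y - cp‖ ≤ 2 * γ / 2 := by
        have := (mem_ball_iff_norm.1 hy.1).le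
        linarith
      simp [cBump, bumpAt_eq_one (by positivity : 0 < 2 * γ) this]
    rw [h2, integral_const, smul_eq_zero] at h1
    have h3 : ν.real univ = 0 := h1.resolve_right one_ne_zero
    have : 0 < 2 * (k * γ) := by positivity
    linarith
  -- the test function, a bump of scale `γ` on the other side of the vertex
  set V : Plane → ℝ := fun x => B⁻¹ * bumpAt γ cn x with hV
  have hVs : ContDiff ℝ ∞ V := contDiff_const.mul (contDiff_bumpAt γ cn)
  have hVc : HasCompactSupport V := (hasCompactSupport_bumpAt hγ cn).mul_left
  set u : Plane → ℂ := fun x => (V x : ℂ) with hu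
  have hue : u = (B⁻¹ : ℂ) • cBump γ cn := by
    funext x; simp [hu, hV, cBump]
  have hus : ContDiff ℝ ∞ u := Complex.ofRealCLM.contDiff.comp hVs
  have huc : HasCompactSupport u := hVc.comp_left (g := fun t : ℝ => (t : ℂ)) (by simp)
  have hBe : ‖(B⁻¹ : ℂ)‖ₑ = ENNReal.ofReal B⁻¹ := by
    rw [← ofReal_norm, norm_inv, Complex.norm_real, Real.norm_eq_abs, abs_of_pos hB0]
  set v := smoothTrace Ω hus huc with hvdef
  have hvn : hHalfNorm γ Ω 1 v ≤ 1 := by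
    refine (hHalfNorm_smoothTrace_le γ 1 hus huc).trans ((h1Norm_le hγ _ _ _).trans ?_)
    rw [hue, classicalGrad_smul _ (contDiff_cBump γ cn), eLpNorm_const_smul, eLpNorm_const_smul, hBe]
    calc ENNReal.ofReal B⁻¹ * eLpNorm (classicalGrad (cBump γ cn)) 2 (volume.restrict (side Ω 1))
          + ENNReal.ofReal γ⁻¹ * (ENNReal.ofReal B⁻¹
            * eLpNorm (cBump γ cn) 2 (volume.restrict (side Ω 1)))
        ≤ ENNReal.ofReal B⁻¹ * ENNReal.ofReal (4 * M)
          + ENNReal.ofReal γ⁻¹ * (ENNReal.ofReal B⁻¹ * ENNReal.ofReal (2 * γ)) := by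
          gcongr
          · exact eLpNorm_classicalGrad_cBump_le hM _ hγ cn
          · exact eLpNorm_cBump_le _ hγ cn
      _ = ENNReal.ofReal (B⁻¹ * (4 * M) + γ⁻¹ * (B⁻¹ * (2 * γ))) := by
          rw [ENNReal.ofReal_add (by positivity) (by positivity),
            ENNReal.ofReal_mul (p := B⁻¹) (q := 4 * M) (by positivity),
            ENNReal.ofReal_mul (p := γ⁻¹) (by positivity),
            ENNReal.ofReal_mul (p := B⁻¹) (q := 2 * γ) (by positivity)]
      _ = 1 := by
          rw [← ENNReal.ofReal_one]
          congr 1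
          rw [hB]
          field_simp
  set A := √(2 * (1 + L) * γ) with hA
  have hA0 : 0 < A := Real.sqrt_pos.2 (by positivity)
  have hvA : ‖(v : Lp ℂ 2 (arcMeasure (frontier Ω)))‖ ≤ A := by
    have h1 : eLpNorm u 2 (arcMeasure (frontier Ω)) ≤ ENNReal.ofReal A := by
      refine (eLpNorm_le_of_support (S := Metric.ball cn γ) Metric.isOpen_ball.measurableSet
        (K := 1) (fun x => ?_) fun x hx => ?_).trans ?_
      · rw [hue, Pi.smul_apply, norm_smul, norm_inv, Complex.norm_real, Real.norm_eq_abs,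
          abs_of_pos hB0]
        have : B⁻¹ ≤ 1 := inv_le_one_of_one_le₀ (by linarith)
        exact mul_le_one₀ this (norm_nonneg _) (norm_cBump_le γ cn x)
      · have : bumpAt γ cn x = 0 := by_contra fun h0 =>
          hx (mem_ball_iff_norm.2 (norm_sub_lt_of_bumpAt_ne_zero hγ h0))
        simp [hu, hV, this]
      · rw [ENNReal.ofReal_one, mul_one, ← ofReal_sq_rpow_half hA0.le, hA,
          Real.sq_sqrt (by positivity)]
        refine ENNReal.rpow_le_rpow ?_ (by norm_num)
        rw [arcMeasure, Measure.restrict_apply Metric.isOpen_ball.measurableSet, inter_comm]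
        have h2 := hc.frontier_inter_subset (Metric.ball_subset_closedBall.trans hsubn)
        have e1 : e (cn - p) 0 = -(2 * γ) := by rw [hcn, graphPt_coord]; simp
        rw [e1] at h2
        refine (measure_mono h2).trans ((hausdorffMeasure_graphPt_image_le p e hL0 ?_).trans
          (le_of_eq ?_))
        · intro s hs t ht
          exact hL s ⟨by linarith [hs.1], by linarith [hs.2]⟩ t
            ⟨by linarith [ht.1], by linarith [ht.2]⟩
        · congr 1
          ring
    have h2 : ‖(v : Lp ℂ 2 (arcMeasure (frontier Ω)))‖
        = (eLpNorm u 2 (arcMeasure (frontier Ω))).toReal := by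
      rw [hvdef]
      exact Lp.norm_toLp u (memLp_arcMeasure hus.continuous huc)
    rw [h2]
    exact ENNReal.toReal_le_of_le_ofReal hA0.le h1
  -- on the test function, which vanishes on the support of `f`, only the normal derivative is left
  set χ := ψ - localExchange φ with hχ
  set E := ∫ x in Ω, (∑ i, gradPotential (γ⁻¹ ^ 2) ν x i * partialD i u x
        + ((γ⁻¹ ^ 2 : ℝ) : ℂ) * potential (γ⁻¹ ^ 2) ν x * u x) with hE
  have hVsupp : ∀ s, V (graphPt p e F s) ≠ 0 → s ∈ Icc (-(3 * γ)) (-γ) := by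
    intro s hs
    have h0 : bumpAt γ cn (graphPt p e F s) ≠ 0 := fun h0 => hs (by simp [hV, h0])
    have h1 := (abs_sub_le_norm_graphPt_sub p e F s (-(2 * γ))).trans_lt
      (norm_sub_lt_of_bumpAt_ne_zero hγ h0)
    rw [abs_lt] at h1
    exact ⟨by linarith [h1.1], by linarith [h1.2]⟩
  have hχv : χ 1 v = -2 * E := by
    have e1 : χ 1 = ψ 1 + φ 0 := by
      rw [hχ]
      change ψ 1 - (-φ 0) = _
      rw [sub_neg_eq_add]
    have e2 : ψ 1 = ofL2 f - (2 : ℂ) • ofL2 f₁ := rfl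
    have e3 : ∫ x, u x ∂ν = 0 := by
      refine integral_eq_zero_of_ae ?_
      filter_upwards [hνae] with y hy
      obtain ⟨-, t₀, ht₀, rfl⟩ := hy
      have : V (graphPt p e F t₀) = 0 := by_contra fun h0 => by
        linarith [(hVsupp t₀ h0).2, ht₀.1]
      exact congrArg Complex.ofReal this
    rw [e1, hφ0, add_zero, e2, LinearMap.sub_apply, LinearMap.smul_apply, ofL2_smoothTrace,
      ofL2_smoothTrace, hf, e3, ← hf₁ u hus huc, smul_eq_mul, zero_sub, neg_mul]
  have hElow : P * B⁻¹ * (2 * (k * γ)) ≤ |δ| * ‖E‖ := by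
    have hint := integrable_integral_greenEnergy ha ν (hus.of_le (by simp)) huc Ω
    have h1 : -δ * E.re = ∫ y, -δ * (∫ x in Ω, greenEnergy (γ⁻¹ ^ 2) u y x).re ∂ν := by
      rw [hE, integral_energy_potential ha ν (hus.of_le (by simp)) huc Ω, integral_const_mul]
      congr 1
      exact (integral_re hint).symm
    have h2 : ∫ _, P * B⁻¹ ∂ν ≤ ∫ y, -δ * (∫ x in Ω, greenEnergy (γ⁻¹ ^ 2) u y x).re ∂ν := by
      refine integral_mono_ae (integrable_const _) (hint.re.const_mul (-δ)) ?_
      filter_upwards [hνae] with y hy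
      obtain ⟨-, t₀, ht₀, rfl⟩ := hy
      refine hlow γ hγ hγρ V (hVs.of_le (by simp)) hVc
        (fun x => mul_nonneg (by positivity) (bumpAt_nonneg γ cn x)) ?_ hVsupp B⁻¹ (by positivity)
        ?_ t₀ ht₀
      · exact (tsupport_mul_subset_right).trans ((tsupport_bumpAt_subset hγ cn).trans hsubn)
      · intro s hs
        have h3 : |s - -(2 * γ)| ≤ k * γ := by
          rw [abs_le]; exact ⟨by linarith [hs.1], by linarith [hs.2]⟩
        have hkγ : k * γ ≤ γ := by
          have : k ≤ 1 := inv_le_one_of_one_le₀ (by linarith)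
          nlinarith
        have h4 : ‖graphPt p e F s - cn‖ ≤ γ / 2 := by
          refine (norm_graphPt_sub_le p e F (hL s ⟨by linarith [hs.1], by linarith [hs.2]⟩
            (-(2 * γ)) ⟨by linarith, by linarith⟩)).trans ?_
          calc (1 + L) * |s - -(2 * γ)| ≤ (1 + L) * (k * γ) := by gcongr
            _ = γ / 2 := by rw [← mul_assoc, hk1]; ring
        simp [hV, bumpAt_eq_one hγ h4]
    rw [integral_const, smul_eq_mul, ← h1] at h2
    calc P * B⁻¹ * (2 * (k * γ)) ≤ ν.real univ * (P * B⁻¹) := by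
          rw [mul_comm]; gcongr
      _ ≤ -δ * E.re := h2
      _ ≤ |δ| * ‖E‖ := by
          refine (le_abs_self _).trans ?_
          rw [abs_mul, abs_neg]
          gcongr
          exact Complex.abs_re_le_norm E
  have hχP : p₀ * γ ≤ ‖χ 1 v‖ := by
    rw [hχv, norm_mul, norm_neg, Complex.norm_ofNat, hp₀, div_mul_eq_mul_div, div_le_iff₀ hδ0]
    linarith
  -- in each of the two norms, the size of `φ` is at most that of the lower bound, up to the factor `c`
  have hαA : √(2 * γ) * A ≤ 2 * (1 + L) * γ := by
    have h1 : √(2 * γ) ≤ A := Real.sqrt_le_sqrt (by linarith)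
    calc √(2 * γ) * A ≤ A * A := by gcongr
      _ = 2 * (1 + L) * γ := Real.mul_self_sqrt (by positivity)
  refine ⟨φ, ψ, hφne, hex, fun s hs1 hs0 => ⟨memHs_of_lt_top (hα.trans_lt ENNReal.ofReal_lt_top)
    (hβ.trans_lt ENNReal.ofReal_lt_top) hs1 hs0, memHs_of_lt_top hψl2 hψdual hs1 hs0,
    hsNorm_pos hA0 (by positivity : 0 < p₀ * γ) hvn hvA hχP hs1 hs0, ?_⟩⟩
  refine le_hsNorm hA0 (by positivity) hvn hvA hχP (Real.sqrt_nonneg _) (by positivity) hα hβ hc0.le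
    ?_ ?_
  · rw [le_div_iff₀ (by positivity)]
    calc c * √(2 * γ) * (2 * A) = 2 * c * (√(2 * γ) * A) := by ring
      _ ≤ 2 * c * (2 * (1 + L) * γ) := by gcongr
      _ = (c * (4 * (1 + L))) * γ := by ring
      _ ≤ p₀ * γ := by gcongr
  · rw [le_div_iff₀ (by norm_num)]
    calc c * ((8 * M + 4) * γ) * 2 = (c * (2 * (8 * M + 4))) * γ := by ring
      _ ≤ p₀ * γ := by gcongr

theorem mainTheorem5 (Ω₁ : Set Plane) (hΩ : IsCurvilinearPolygon Ω₁) (hv : ∃ p, IsVertex Ω₁ p) :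
    (∃ c : ℝ, 0 < c ∧ ∀ γ : ℝ, 0 < γ → γ < c → ∀ s : ℝ, -(1 / 2) ≤ s → s ≤ 0 →
      ∃ φ ψ : NeumannPair Ω₁, φ ≠ 0 ∧ MemHs γ Ω₁ s φ ∧ MemHs γ Ω₁ s ψ ∧ IsExchange γ Ω₁ φ ψ ∧
        ENNReal.ofReal c * hsNorm γ Ω₁ s φ ≤ hsNorm γ Ω₁ s (ψ - localExchange φ)) ∧
    (∀ s : ℝ, -(1 / 2) ≤ s → s ≤ 0 → ∀ a : ℝ, 0 < a → a < 1 →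
      ¬ ∃ c C Ca : ℝ, 0 < c ∧ 0 < C ∧ 0 < Ca ∧
        ∀ γ : ℝ, 0 < γ → γ < c → ∀ M : ℝ, 0 < M → M < Ca⁻¹ * γ ^ (-a) →
          ∀ φ ψ : NeumannPair Ω₁, MemHs γ Ω₁ s φ → IsExchange γ Ω₁ φ ψ →
            hsNorm γ Ω₁ s (ψ - localExchange φ) ≤
              ENNReal.ofReal (C * (1 + M ^ (1 / 2 : ℝ)) * γ ^ (1 / 2 : ℝ)) *
                hsNorm γ Ω₁ s φ) := by
  obtain ⟨c, hc0, hc⟩ := hΩ.exists_exchange_lower hv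
  refine ⟨⟨c, hc0, fun γ hγ hγc s hs1 hs0 => ?_⟩, ?_⟩
  · obtain ⟨φ, ψ, hφ, hex, hall⟩ := hc γ hγ hγc
    obtain ⟨h1, h2, -, h3⟩ := hall s hs1 hs0
    exact ⟨φ, ψ, hφ, h1, h2, hex, h3⟩
  · rintro s hs1 hs0 a ha0 - ⟨c', C, Ca, hc', hC, hCa, hbound⟩
    -- the choice `M = 1`, with `γ` so small that the factor of the upper bound is below `c`
    have hlim1 : Tendsto (fun γ : ℝ => C * (1 + (1 : ℝ) ^ (1 / 2 : ℝ)) * γ ^ (1 / 2 : ℝ)) (𝓝[>] 0)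
        (𝓝 0) := by
      have h1 : Tendsto (fun γ : ℝ => γ ^ (1 / 2 : ℝ)) (𝓝[>] 0) (𝓝 0) := by
        have := (Real.continuousAt_rpow_const 0 (1 / 2) (Or.inr (by norm_num))).tendsto
        rw [Real.zero_rpow (by norm_num)] at this
        exact this.mono_left nhdsWithin_le_nhds
      simpa using h1.const_mul (C * (1 + (1 : ℝ) ^ (1 / 2 : ℝ)))
    have hlim2 : Tendsto (fun γ : ℝ => Ca⁻¹ * γ ^ (-a)) (𝓝[>] 0) atTop :=
      (tendsto_rpow_neg_nhdsGT_zero (neg_lt_zero.2 ha0)).const_mul_atTop (by positivity)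
    have hmem : Ioo (0 : ℝ) (min c c') ∈ 𝓝[>] (0 : ℝ) := Ioo_mem_nhdsGT (lt_min hc0 hc')
    obtain ⟨γ, ⟨h1, h2⟩, h3⟩ := ((hlim1.eventually_lt_const hc0).and
      (hlim2.eventually_gt_atTop 1) |>.and hmem).exists
    obtain ⟨φ, ψ, -, hex, hall⟩ := hc γ h3.1 (h3.2.trans_le (min_le_left _ _))
    obtain ⟨k1, -, k3, k4⟩ := hall s hs1 hs0
    have hb := hbound γ h3.1 (h3.2.trans_le (min_le_right _ _)) 1 one_pos h2 φ ψ k1 hex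
    have hn0 : hsNorm γ Ω₁ s φ ≠ 0 := fun h0 => by
      rw [h0, mul_zero] at hb
      exact absurd hb (not_le.2 k3)
    have hlt := (ENNReal.mul_lt_mul_iff_left hn0 (ne_of_lt k1)).2
      ((ENNReal.ofReal_lt_ofReal_iff hc0).2 h1)
    exact absurd (k4.trans hb) (not_le.2 hlt)
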